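/- Let $(S,g)$ be a Sasaki–Einstein $7$-manifold: its metric cone $(S\times\mathbb R^+,\,r^2g+dr^2)$ is Kähler, with integrable complex structure $J$ and Kähler form $\omega^c(u,v)=g^c(Ju,v)$, and carries a holomorphic $(4,0)$-form $\widehat\Psi$ of unit length (of modulus $1$ on unitary frames; so the cone is Ricci-flat). Identify $S$ with $S\times\{1\}$; let $\xi=J\partial_r$ be the Reeb field, $\eta=g(\xi,\cdot)$ the contact form, $\Phi U=\nabla_U\xi$, $\Omega=\omega^c|_S$, $\Psi_++i\Psi_-=(\partial_r\lrcorner\widehat\Psi)|_S$, and let $$\varphi_t=\Omega\wedge\eta+\cos t\,\Psi_++\sin t\,\Psi_-\qquad(t\in\mathbb R)$$ be the associated family of nearly parallel $\mathrm G_2$-structures, all of which induce the metric $g$. **(1)** Suppose that $S$ is regular over a Kähler $3$-fold $(X,g_X,\omega_X)$ (for instance a projective one): $\pi:S\to X$ is a principal $S^1$-bundle whose circle action is generated by a positive constant multiple of $\xi$, with $g=\pi^*g_X+\eta\otimes\eta$ and $d\eta=2\pi^*\omega_X$. (By Chern–Weil theory its Euler class is then represented by a positive constant multiple of $\omega_X$.)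 Then for every complex curve $\Sigma\subset X$, i.e. every embedded $1$-dimensional complex submanifold, the preimage $Y_\Sigma=\pi^{-1}(\Sigma)$ is an embedded $3$-dimensional submanifold of $S$ such that * $Y_\Sigma$ is invariant for the contact structure: $\xi$ is tangent to $Y_\Sigma$, and $\Phi$ maps each tangent space of $Y_\Sigma$ to itself; * $Y_\Sigma$ is a minimal submanifold of $(S,g)$; * $Y_\Sigma$ has an orientation, independent of $t$, for which it is associative with respect to $\varphi_t$ for every $t\in\mathbb R$, i.e. $\varphi_t|_{Y_\Sigma}=\mathrm{vol}_{Y_\Sigma}$. **(2)** Let $P$ be any complex surface, for instance $P=\mathbb{CP}^1\times\mathbb{CP}^1$ (the case of $Q(1,1,1)$, the circle bundle over $(\mathbb{CP}^1)^3$ whose Euler class is the sum of the three generators) or a del Pezzo surface $P=P_k$, $3\le k\le 8$, that is $\mathbb{CP}^2$ blown up at $k$ points. Let $\pi:S\to\mathbb{CP}^1\times P$ be a principal $S^1$-bundle with $7$-dimensional total space $S$ and Euler class $[\omega_1]+[\omega_P]$, where $[\omega_1]$ is the positive generator of $H^2(\mathbb{CP}^1,\mathbb Z)$ and $\omega_P$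 is a $2$-form on $P$; that is, there is a connection form on $S$, with integral $1$ over the fibres, whose curvature is $\pi^*(\omega_1+\omega_P)$ with $\int_{\mathbb{CP}^1}\omega_1=1$. Let $p\in P$. Then $\Sigma=\mathbb{CP}^1\times\{p\}$ is a complex curve, so that (1) applies to it whenever $S$ moreover carries a regular Sasaki–Einstein structure as in (1), and $Y_\Sigma=\pi^{-1}(\Sigma)$ is diffeomorphic to $S^3$: it is the image of a smooth embedding $S^3\to S$. -/

import Mathlib

open scoped Manifold ContDiff Topology

namespace RiemannSphere
open Set Filter

noncomputable section

/-- Inversion `z ↦ 1 / z` of the Riemann sphere, with `0 ↦ ∞` and `∞ ↦ 0`. -/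
def inv (x : OnePoint ℂ) : OnePoint ℂ :=
  x.elim ((0 : ℂ) : OnePoint ℂ)
    (fun z => if z = 0 then OnePoint.infty else ((z⁻¹ : ℂ) : OnePoint ℂ))

@[simp] theorem inv_infty : inv OnePoint.infty = ((0 : ℂ) : OnePoint ℂ) := rfl

theorem inv_coe (z : ℂ) :
    inv (z : OnePoint ℂ) = if z = 0 then OnePoint.infty else ((z⁻¹ : ℂ) : OnePoint ℂ) := rfl

theorem inv_inv (x : OnePoint ℂ) : inv (inv x) = x := by
  induction x using OnePoint.rec with
  | infty => simp [inv_coe]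
  | coe z =>
    by_cases h : z = 0
    · subst h; simp [inv_coe]
    · simp [inv_coe, h]

theorem continuous_inv : Continuous inv := by
  rw [continuous_iff_continuousAt]
  intro x
  induction x using OnePoint.rec with
  | infty =>
    rw [OnePoint.continuousAt_infty', Filter.coclosedCompact_eq_cocompact]
    have h : Tendsto (fun z : ℂ => ((z⁻¹ : ℂ) : OnePoint ℂ)) (cocompact ℂ)
        (𝓝 ((0 : ℂ) : OnePoint ℂ)) := by
      refine (OnePoint.continuous_coe.tendsto 0).comp ?_
      rw [← Metric.cobounded_eq_cocompact]
      exact tendsto_inv₀_cobounded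
    refine h.congr' ?_
    filter_upwards [(isCompact_singleton (x := (0 : ℂ))).compl_mem_cocompact] with z hz
    have hz' : z ≠ 0 := hz
    simp [inv_coe, hz']
  | coe z =>
    rw [OnePoint.continuousAt_coe]
    by_cases h : z = 0
    · subst h
      rw [← continuousWithinAt_compl_self]
      have h : Tendsto (fun z : ℂ => ((z⁻¹ : ℂ) : OnePoint ℂ)) (𝓝[≠] 0)
          (𝓝 (OnePoint.infty : OnePoint ℂ)) := by
        have h1 : Tendsto (fun z : ℂ => z⁻¹) (𝓝[≠] 0) (cocompact ℂ) := by
          rw [← Metric.cobounded_eq_cocompact]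
          exact tendsto_inv₀_nhdsNE_zero
        have h2 := OnePoint.tendsto_coe_infty (X := ℂ)
        rw [Filter.coclosedCompact_eq_cocompact] at h2
        exact h2.comp h1
      have h0 : inv ((0 : ℂ) : OnePoint ℂ) = OnePoint.infty := by simp [inv_coe]
      unfold ContinuousWithinAt
      simp only [Function.comp_apply, h0]
      refine h.congr' ?_
      filter_upwards [self_mem_nhdsWithin] with z hz
      have hz' : z ≠ 0 := hz
      simp [inv_coe, hz']
    · have h1 : ContinuousAt (fun z : ℂ => ((z⁻¹ : ℂ) : OnePoint ℂ)) z :=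
        (OnePoint.continuous_coe.continuousAt).comp (continuousAt_inv₀ h)
      refine h1.congr ?_
      filter_upwards [isOpen_ne.mem_nhds h] with w hw
      simp [inv_coe, hw]

/-- Inversion as a homeomorphism of the Riemann sphere. -/
def invHomeomorph : OnePoint ℂ ≃ₜ OnePoint ℂ where
  toFun := inv
  invFun := inv
  left_inv := inv_inv
  right_inv := inv_inv
  continuous_toFun := continuous_inv
  continuous_invFun := continuous_inv

/-- The affine chart `z ↦ z` on the complement of `∞`. -/
def affineChart : OpenPartialHomeomorph (OnePoint ℂ) ℂ :=
  ((OnePoint.isOpenEmbedding_coe (X := ℂ)).toOpenPartialHomeomorph _).symm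

/-- The chart `z ↦ 1 / z` on the complement of `0`. -/
def inftyChart : OpenPartialHomeomorph (OnePoint ℂ) ℂ :=
  invHomeomorph.toOpenPartialHomeomorph.trans affineChart

theorem affineChart_source : affineChart.source = range ((↑) : ℂ → OnePoint ℂ) := by
  simp [affineChart]

theorem affineChart_coe (z : ℂ) : affineChart (z : OnePoint ℂ) = z :=
  (OnePoint.isOpenEmbedding_coe (X := ℂ)).toOpenPartialHomeomorph_left_inv _

theorem affineChart_symm (z : ℂ) : affineChart.symm z = (z : OnePoint ℂ) := rfl

/-- The complex projective line, as the Riemann sphere with its charts `z` and `1 / z`. -/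
instance : ChartedSpace ℂ (OnePoint ℂ) where
  atlas := {affineChart, inftyChart}
  chartAt x := open Classical in if x = OnePoint.infty then inftyChart else affineChart
  mem_chart_source x := by
    induction x using OnePoint.rec with
    | infty => simp [inftyChart, affineChart_source, invHomeomorph]
    | coe z => simp [affineChart_source]
  chart_mem_atlas x := by
    split_ifs <;> simp

theorem infty_symm_coe (z : ℂ) : inftyChart.symm z = inv z := rfl

theorem inftyChart_apply (x : OnePoint ℂ) : inftyChart x = affineChart (inv x) := rfl

theorem inftyChart_source : inftyChart.source = {((0 : ℂ) : OnePoint ℂ)}ᶜ := by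
  ext x
  induction x using OnePoint.rec with
  | infty => simp [inftyChart, affineChart_source, invHomeomorph]
  | coe z =>
    by_cases h : z = 0 <;> simp [inftyChart, affineChart_source, invHomeomorph, inv_coe, h]

instance : IsManifold 𝓘(ℂ, ℂ) ω (OnePoint ℂ) := by
  apply isManifold_of_contDiffOn
  have key : ∀ z : ℂ, z ≠ 0 → affineChart (inv z) = z⁻¹ := by
    intro z hz
    simp [inv_coe, hz, affineChart_coe]
  have hinv : ContDiffOn ℂ ω (fun z : ℂ => z⁻¹) {0}ᶜ := fun z hz =>
    (contDiffAt_inv ℂ hz).contDiffWithinAt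
  rintro e e' (rfl | rfl) (rfl | rfl)
  · have : ContDiffOn ℂ ω (id : ℂ → ℂ) univ := contDiffOn_id
    refine (this.congr ?_).mono (subset_univ _)
    intro z _
    simp [affineChart_symm, affineChart_coe]
  · refine (hinv.congr (f₁ := affineChart.symm ≫ₕ inftyChart) ?_).mono ?_
    · intro z hz
      simp [affineChart_symm, inftyChart_apply, key z hz]
    · intro z hz
      simp [inftyChart_source, affineChart_symm] at hz
      exact hz.2
  · refine (hinv.congr (f₁ := inftyChart.symm ≫ₕ affineChart) ?_).mono ?_
    · intro z hz
      simp [infty_symm_coe, key z hz]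
    · intro z hz
      rintro rfl
      simp [infty_symm_coe, affineChart_source, inv_coe] at hz
  · have : ContDiffOn ℂ ω (id : ℂ → ℂ) univ := contDiffOn_id
    refine (this.congr (f₁ := inftyChart.symm ≫ₕ inftyChart) ?_).mono (subset_univ _)
    intro z _
    simp [infty_symm_coe, inftyChart_apply, inv_inv, affineChart_coe]

end
end RiemannSphere

namespace SasakiGeometry

noncomputable section

/-! ### Differential forms on manifolds -/

section Forms

variable {E : Type*} [NormedAddCommGroup E] [NormedSpace ℝ E]
  {H : Type*} [TopologicalSpace H] (I : ModelWithCorners ℝ E H)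
  {M : Type*} [TopologicalSpace M] [ChartedSpace H M]
  {F : Type*} [NormedAddCommGroup F] [NormedSpace ℝ F] {k : ℕ}

/-- A (not necessarily smooth) differential `k`-form on `M` with values in `F`. -/
abbrev DiffForm (M : Type*) [TopologicalSpace M] [ChartedSpace H M] (k : ℕ)
    (F : Type*) [NormedAddCommGroup F] [NormedSpace ℝ F] :=
  ∀ x : M, TangentSpace I x [⋀^Fin k]→L[ℝ] F

variable {I}

/-- The expression of a form in the preferred chart at `x₀`: its pullback under the inverse of
the chart (meaningful on the target of the chart; all manifolds below are boundaryless). -/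
def formInChart (α : DiffForm I M k F) (x₀ : M) (y : E) : E [⋀^Fin k]→L[ℝ] F :=
  (α ((extChartAt I x₀).symm y)).compContinuousLinearMap
    (mfderiv 𝓘(ℝ, E) I (extChartAt I x₀).symm y)

/-- A form is smooth if all its chart expressions are smooth. -/
def IsSmoothForm (α : DiffForm I M k F) : Prop :=
  ∀ x₀ : M, ContDiffOn ℝ ∞ (formInChart α x₀) (extChartAt I x₀).target

/-- The exterior derivative, computed at `x` in the preferred chart at `x`
(with `dη(U, V) = U η(V) - V η(U) - η([U, V])` in degree one). -/
def extDerivative (α : DiffForm I M k F) : DiffForm I M (k + 1) F := fun x =>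
  (extDeriv (formInChart α x) (extChartAt I x x)).compContinuousLinearMap
    (mfderiv I 𝓘(ℝ, E) (extChartAt I x) x)

end Forms

/-! ### Submanifolds -/

section Submanifolds

/-- `Y` is an embedded `n`-times differentiable submanifold of dimension `k` over `𝕜` of the
boundaryless manifold `M`: around each of its points there is a chart of `M` that takes `Y` to a
linear subspace of dimension `k`. -/
def IsSubmanifold {𝕜 : Type*} [NontriviallyNormedField 𝕜]
    {E : Type*} [NormedAddCommGroup E] [NormedSpace 𝕜 E]
    {H : Type*} [TopologicalSpace H] (I : ModelWithCorners 𝕜 E H) (n : ℕ∞ω)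
    {M : Type*} [TopologicalSpace M] [ChartedSpace H M] (k : ℕ) (Y : Set M) : Prop :=
  ∀ y ∈ Y, ∃ e ∈ IsManifold.maximalAtlas I n M, y ∈ e.source ∧
    ∃ W : Submodule 𝕜 E, Module.finrank 𝕜 W = k ∧ ∀ q ∈ e.source, (q ∈ Y ↔ I (e q) ∈ W)

variable {E : Type*} [NormedAddCommGroup E] [NormedSpace ℝ E]
  {H : Type*} [TopologicalSpace H] (I : ModelWithCorners ℝ E H)
  {M : Type*} [TopologicalSpace M] [ChartedSpace H M]

/-- The velocity `γ'(0)` of a curve in `M`. -/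
def velocity (γ : ℝ → M) : TangentSpace I (γ 0) :=
  mfderiv 𝓘(ℝ, ℝ) I γ 0 (1 : ℝ)

/-- `γ` is a smooth curve of `M` that starts at `y` with velocity `v` and that lies in `Y` for
small times. -/
structure IsCurveIn (Y : Set M) (y : M) (v : TangentSpace I y) (γ : ℝ → M) : Prop where
  smooth : ContMDiff 𝓘(ℝ, ℝ) I ∞ γ
  mem : ∀ᶠ s in 𝓝 (0 : ℝ), γ s ∈ Y
  start : γ 0 = y
  velocity_eq : (velocity I γ : E) = v

/-- The tangent space at `y` of the submanifold `Y`, as a subspace of the tangent space of the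
ambient manifold: it consists of the velocities of curves in `Y` through `y`. -/
def tangentSubspace (Y : Set M) (y : M) : Submodule ℝ (TangentSpace I y) :=
  Submodule.span ℝ {v | ∃ γ : ℝ → M, IsCurveIn I Y y v γ}

end Submanifolds

/-! ### Minimal submanifolds of a Riemannian manifold -/

section Minimal

variable {E : Type*} [NormedAddCommGroup E] [NormedSpace ℝ E]
  {H : Type*} [TopologicalSpace H] {I : ModelWithCorners ℝ E H}
  {M : Type*} [TopologicalSpace M] [ChartedSpace H M] [IsManifold I ∞ M]

variable (I M) in
/-- Smooth Riemannian metrics on `M`. -/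
abbrev Metric := Bundle.ContMDiffRiemannianMetric I ∞ E (fun x : M => TangentSpace I x)

/-- The component `g_{ab}` of the metric in the preferred chart at `x₀`, for constant vectors
`a`, `b` of the model space. -/
def metricInChart (g : Metric I M) (x₀ : M) (a b : E) (y : E) : ℝ :=
  g.inner ((extChartAt I x₀).symm y)
    (mfderiv 𝓘(ℝ, E) I (extChartAt I x₀).symm y a)
    (mfderiv 𝓘(ℝ, E) I (extChartAt I x₀).symm y b)

/-- `g(∇_{γ'} γ', n)` at time `0`, for the Levi-Civita connection `∇` of `g`. In the chart at
`γ 0`, with `c` the curve there, `v = c'(0)` and `m` the expression of `n`, the Christoffel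
symbols of the first kind give `g(c''(0), m) + (∂_v g)(v, m) - (∂_m g)(v, v) / 2`. -/
def covariantAcceleration (g : Metric I M) (γ : ℝ → M) (n : TangentSpace I (γ 0)) : ℝ :=
  let c : ℝ → E := fun s => extChartAt I (γ 0) (γ s)
  let y : E := extChartAt I (γ 0) (γ 0)
  let v : E := deriv c 0
  let m : E := mfderiv I 𝓘(ℝ, E) (extChartAt I (γ 0)) (γ 0) n
  metricInChart g (γ 0) (deriv (deriv c) 0) m y
    + fderiv ℝ (metricInChart g (γ 0) v m) y v
    - fderiv ℝ (metricInChart g (γ 0) v v) y m / 2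

/-- `e` is an orthonormal basis of the tangent space at `y` of the `k`-dimensional submanifold
`Y`. -/
structure IsTangentFrame (g : Metric I M) (Y : Set M) (y : M) {k : ℕ}
    (e : Fin k → TangentSpace I y) : Prop where
  mem : ∀ i, e i ∈ tangentSubspace I Y y
  orthonormal : ∀ i j, g.inner y (e i) (e j) = if i = j then 1 else 0

/-- `Y` is a minimal submanifold of dimension `k`: its mean curvature vector vanishes. The normal
part of `∇_{γ'} γ'` is the second fundamental form of `Y` on `γ'(0)`, for curves `γ` in `Y`, so
the sums below are the inner products of the mean curvature vector with the normal vectors. -/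
def IsMinimalSubmanifold (g : Metric I M) (k : ℕ) (Y : Set M) : Prop :=
  IsSubmanifold I ∞ k Y ∧
  ∀ y ∈ Y, ∀ e : Fin k → TangentSpace I y, IsTangentFrame g Y y e →
    ∀ γ : Fin k → ℝ → M, (∀ i, IsCurveIn I Y y (e i) (γ i)) →
    ∀ n : TangentSpace I y, (∀ v ∈ tangentSubspace I Y y, g.inner y v n = 0) →
      ∑ i, covariantAcceleration g (γ i) (n : E) = 0

/-- The submanifold `Y` of dimension three, oriented by the restriction of the `3`-form `ν` of
`M`, is associative with respect to the `3`-form `φ`, where `g` is the metric of `φ`: the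
restriction of `φ` to `Y` is the volume form of `Y`. -/
structure IsAssociative (g : Metric I M) (φ : ∀ x : M, (Fin 3 → TangentSpace I x) → ℝ)
    (ν : DiffForm I M 3 ℝ) (Y : Set M) : Prop where
  submanifold : IsSubmanifold I ∞ 3 Y
  smooth : IsSmoothForm ν
  orients : ∀ y ∈ Y, ∀ e : Fin 3 → TangentSpace I y, IsTangentFrame g Y y e → ν y e ≠ 0
  calibrated : ∀ y ∈ Y, ∀ e : Fin 3 → TangentSpace I y, IsTangentFrame g Y y e →
    0 < ν y e → φ y e = 1

end Minimal

/-! ### Sasaki-Einstein 7-manifolds -/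

section SasakiEinstein

/-- The interval `(0, ∞)`, as a manifold. -/
abbrev PosReal : TopologicalSpace.Opens ℝ := ⟨Set.Ioi 0, isOpen_Ioi⟩

/-- The point `1` of `(0, ∞)`. -/
abbrev PosReal.one : PosReal := ⟨1, Set.mem_Ioi.2 one_pos⟩

/-- The model of the cone over a 7-manifold. -/
abbrev ConeModel := (𝓡 7).prod 𝓘(ℝ, ℝ)

variable (S : Type*) [TopologicalSpace S] [ChartedSpace (EuclideanSpace ℝ (Fin 7)) S]

/-- The cone `S × (0, ∞)`. -/
abbrev Cone := S × PosReal

variable {S}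

/-- The tangent vector `u + s ∂_r` of the cone. -/
def coneVector {x : S} (r : PosReal) (u : TangentSpace (𝓡 7) x) (s : ℝ) :
    TangentSpace ConeModel ((x, r) : Cone S) :=
  ((u, s) : EuclideanSpace ℝ (Fin 7) × ℝ)

/-- The component along `S` of a tangent vector of the cone. -/
def baseComponent {p : Cone S} (v : TangentSpace ConeModel p) : TangentSpace (𝓡 7) p.1 :=
  (v : EuclideanSpace ℝ (Fin 7) × ℝ).1

/-- The component along `∂_r` of a tangent vector of the cone. -/
def radialComponent {p : Cone S} (v : TangentSpace ConeModel p) : ℝ :=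
  (v : EuclideanSpace ℝ (Fin 7) × ℝ).2

variable [IsManifold (𝓡 7) ∞ S]

/-- The cone metric `r² g + dr²`. -/
def coneMetric (g : Metric (𝓡 7) S) (p : Cone S) (u v : TangentSpace ConeModel p) : ℝ :=
  (p.2 : ℝ) ^ 2 * g.inner p.1 (baseComponent u) (baseComponent v)
    + radialComponent u * radialComponent v

variable (S) in
/-- A Sasaki-Einstein structure on a 7-manifold `S`: a Riemannian metric `g` on `S` whose cone
`(S × (0, ∞), r² g + dr²)` is Kähler for a complex structure `J`, together with a holomorphic
4-form of unit length on the cone (so that the holonomy of the cone lies in `SU(4)` and the cone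
is Ricci-flat). -/
structure SasakiEinstein where
  /-- The metric on `S`. -/
  g : Metric (𝓡 7) S
  /-- The complex structure of the cone. -/
  J : ∀ p : Cone S, TangentSpace ConeModel p →L[ℝ] TangentSpace ConeModel p
  J_smooth : ContMDiff ConeModel
    (ConeModel.prod 𝓘(ℝ, (EuclideanSpace ℝ (Fin 7) × ℝ) →L[ℝ] (EuclideanSpace ℝ (Fin 7) × ℝ))) ∞
    (fun p => Bundle.TotalSpace.mk'
      ((EuclideanSpace ℝ (Fin 7) × ℝ) →L[ℝ] (EuclideanSpace ℝ (Fin 7) × ℝ))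
      (E := fun p : Cone S => TangentSpace ConeModel p →L[ℝ] TangentSpace ConeModel p) p (J p))
  J_sq : ∀ p v, J p (J p v) = -v
  J_isometry : ∀ p u v, coneMetric g p (J p u) (J p v) = coneMetric g p u v
  /-- The Nijenhuis tensor of `J` vanishes. -/
  J_integrable : ∀ U V : ∀ p : Cone S, TangentSpace ConeModel p,
    ContMDiff ConeModel ConeModel.tangent ∞
      (fun p => (⟨p, U p⟩ : TangentBundle ConeModel (Cone S))) →
    ContMDiff ConeModel ConeModel.tangent ∞
      (fun p => (⟨p, V p⟩ : TangentBundle ConeModel (Cone S))) →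
    ∀ p, VectorField.mlieBracket ConeModel (fun q => J q (U q)) (fun q => J q (V q)) p
        - J p (VectorField.mlieBracket ConeModel (fun q => J q (U q)) V p)
        - J p (VectorField.mlieBracket ConeModel U (fun q => J q (V q)) p)
        - VectorField.mlieBracket ConeModel U V p = 0
  /-- The Kähler form of the cone. -/
  kahlerForm : DiffForm ConeModel (Cone S) 2 ℝ
  kahlerForm_apply : ∀ p u v, kahlerForm p ![u, v] = coneMetric g p (J p u) v
  kahlerForm_smooth : IsSmoothForm kahlerForm
  kahlerForm_closed : extDerivative kahlerForm = 0
  /-- The holomorphic volume form of the cone. -/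
  volumeForm : DiffForm ConeModel (Cone S) 4 ℂ
  volumeForm_smooth : IsSmoothForm volumeForm
  /-- The form is of type `(4, 0)`. -/
  volumeForm_type : ∀ p a b c d,
    volumeForm p ![J p a, b, c, d] = Complex.I * volumeForm p ![a, b, c, d]
  /-- A form of type `(4, 0)` on a complex 4-manifold is holomorphic if and only if it is
  closed. -/
  volumeForm_closed : extDerivative volumeForm = 0
  /-- The form has modulus one on unitary frames. -/
  volumeForm_unit : ∀ p (f : Fin 4 → TangentSpace ConeModel p),
    (∀ i j, coneMetric g p (f i) (f j) = if i = j then 1 else 0) →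
    (∀ i j, coneMetric g p (J p (f i)) (f j) = 0) → ‖volumeForm p f‖ = 1

namespace SasakiEinstein

variable (s : SasakiEinstein S)

/-- The Reeb vector field `ξ = J ∂_r` on `S = S × {1}`. -/
def reeb (x : S) : TangentSpace (𝓡 7) x :=
  baseComponent (s.J (x, PosReal.one) (coneVector PosReal.one 0 1))

/-- The contact form `η = g(ξ, ·)`. -/
def contactForm : DiffForm (𝓡 7) S 1 ℝ := fun x =>
  ContinuousAlternatingMap.ofSubsingleton ℝ (TangentSpace (𝓡 7) x) ℝ (0 : Fin 1)
    (s.g.inner x (s.reeb x))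

/-- The endomorphism `Φ` of the tangent bundle of `S`, `Φ U = ∇_U ξ`. Since
`J U = ∇ᶜ_U ξ` on the cone, it is the component of `J U` tangent to `S = S × {1}`. -/
def structureTensor (x : S) (u : TangentSpace (𝓡 7) x) : TangentSpace (𝓡 7) x :=
  baseComponent (s.J (x, PosReal.one) (coneVector PosReal.one u 0))

/-- The horizontal Kähler form `Ω`, the restriction of the Kähler form of the cone to
`S = S × {1}`. -/
def horizontalKahlerForm (x : S) (u v : TangentSpace (𝓡 7) x) : ℝ :=
  s.kahlerForm (x, PosReal.one) ![coneVector PosReal.one u 0, coneVector PosReal.one v 0]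

/-- The horizontal complex volume form `Ψ = Ψ₊ + i Ψ₋`, the contraction of `∂_r` with the
holomorphic volume form of the cone, restricted to `S = S × {1}`. -/
def horizontalVolumeForm (x : S) (e : Fin 3 → TangentSpace (𝓡 7) x) : ℂ :=
  s.volumeForm (x, PosReal.one) ![coneVector PosReal.one 0 1, coneVector PosReal.one (e 0) 0,
    coneVector PosReal.one (e 1) 0, coneVector PosReal.one (e 2) 0]

/-- The nearly parallel G₂-forms `φ_t = Ω ∧ η + cos t Ψ₊ + sin t Ψ₋`, all of which induce the
metric `g`. -/
def g2Form (t : ℝ) (x : S) (e : Fin 3 → TangentSpace (𝓡 7) x) : ℝ :=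
  (s.horizontalKahlerForm x (e 0) (e 1) * s.contactForm x ![e 2]
      + s.horizontalKahlerForm x (e 1) (e 2) * s.contactForm x ![e 0]
      + s.horizontalKahlerForm x (e 2) (e 0) * s.contactForm x ![e 1])
    + Real.cos t * (s.horizontalVolumeForm x e).re
    + Real.sin t * (s.horizontalVolumeForm x e).im

/-- `Y` is invariant for the contact structure: the Reeb field is tangent to `Y` and `Φ` maps
each tangent space of `Y` to itself. -/
def IsInvariant (Y : Set S) : Prop :=
  ∀ y ∈ Y, s.reeb y ∈ tangentSubspace (𝓡 7) Y y ∧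
    ∀ u ∈ tangentSubspace (𝓡 7) Y y, s.structureTensor y u ∈ tangentSubspace (𝓡 7) Y y

end SasakiEinstein

end SasakiEinstein

/-! ### Kähler manifolds -/

section Kahler

/-- A complex manifold is a smooth manifold. -/
instance isManifold_real_of_complex {E : Type*} [NormedAddCommGroup E] [NormedSpace ℂ E]
    {X : Type*} [TopologicalSpace X] [ChartedSpace E X] [IsManifold 𝓘(ℂ, E) ω X] :
    IsManifold 𝓘(ℝ, E) ∞ X := by
  apply isManifold_of_contDiffOn
  intro e e' he he'
  have h := (contDiffGroupoid ω 𝓘(ℂ, E)).compatible he he'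
  rw [contDiffGroupoid, mem_groupoid_of_pregroupoid] at h
  have h1 := h.1
  simp only [contDiffPregroupoid] at h1
  have h2 : ContDiffOn ℂ ω (e.symm ≫ₕ e') (e.symm ≫ₕ e').source := by simpa using h1
  have h3 : ContDiffOn ℝ ω (e.symm ≫ₕ e') (e.symm ≫ₕ e').source := h2.restrict_scalars ℝ
  have h4 : ContDiffOn ℝ ∞ (e.symm ≫ₕ e') (e.symm ≫ₕ e').source := h3.of_le le_top
  simpa using h4

/-- The complex structure on the tangent spaces of a complex manifold. -/
def mulI {E : Type*} [NormedAddCommGroup E] [NormedSpace ℂ E]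
    {X : Type*} [TopologicalSpace X] [ChartedSpace E X] {x : X}
    (v : TangentSpace 𝓘(ℝ, E) x) : TangentSpace 𝓘(ℝ, E) x :=
  let w : E := v
  (Complex.I • w : E)

/-- A Kähler metric on the complex manifold `X`. -/
structure KahlerMetric (E : Type*) [NormedAddCommGroup E] [NormedSpace ℂ E]
    (X : Type*) [TopologicalSpace X] [ChartedSpace E X] [IsManifold 𝓘(ℂ, E) ω X] where
  /-- The Riemannian metric. -/
  g : Metric 𝓘(ℝ, E) X
  hermitian : ∀ x u v, g.inner x (mulI u) (mulI v) = g.inner x u v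
  /-- The Kähler form. -/
  form : DiffForm 𝓘(ℝ, E) X 2 ℝ
  form_apply : ∀ x u v, form x ![u, v] = g.inner x (mulI u) v
  form_smooth : IsSmoothForm form
  form_closed : extDerivative form = 0

end Kahler

/-! ### Principal circle bundles -/

section CircleBundles

variable {EX : Type*} [NormedAddCommGroup EX] [NormedSpace ℝ EX]
  {HX : Type*} [TopologicalSpace HX] (IX : ModelWithCorners ℝ EX HX)
  {X : Type*} [TopologicalSpace X] [ChartedSpace HX X]
  {S : Type*} [TopologicalSpace S] [ChartedSpace (EuclideanSpace ℝ (Fin 7)) S]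
  [MulAction Circle S]

/-- `π : S → X` is a smooth principal circle bundle. Over the open sets `U` of some cover,
`p ↦ (π p, τ p)` is a diffeomorphism to `U × S¹`, with inverse `(x, z) ↦ z • σ x`. -/
structure IsPrincipalCircleBundle (π : S → X) : Prop where
  smooth_action : ContMDiff ((𝓡 1).prod (𝓡 7)) (𝓡 7) ∞ (fun q : Circle × S => q.1 • q.2)
  smooth : ContMDiff (𝓡 7) IX ∞ π
  fibre : ∀ p q, π p = π q ↔ ∃ z : Circle, q = z • p
  free : ∀ (z : Circle) (p : S), z • p = p → z = 1
  locally_trivial : ∀ x : X, ∃ U : Set X, IsOpen U ∧ x ∈ U ∧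
    ∃ (σ : X → S) (τ : S → Circle), ContMDiffOn IX (𝓡 7) ∞ σ U ∧
      ContMDiffOn (𝓡 7) (𝓡 1) ∞ τ (π ⁻¹' U) ∧
      (∀ y ∈ U, π (σ y) = y) ∧ ∀ p ∈ π ⁻¹' U, τ p • σ (π p) = p

/-- The vector field `d/ds (exp(2πis) • p)` at `s = 0`, whose flow has period one. -/
def circleGenerator (p : S) : TangentSpace (𝓡 7) p :=
  (velocity (𝓡 7) (fun s : ℝ => Circle.exp (2 * Real.pi * s) • p) : EuclideanSpace ℝ (Fin 7))

end CircleBundles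

/-- The Sasaki-Einstein structure `s` on `S` is regular and arises from the principal circle
bundle `π : S → X` over the Kähler manifold `X`: the Reeb flow is, up to a constant change of
speed, the action of the circle, `g = π^* g_X + η ⊗ η` and `dη = 2 π^* ω_X`. -/
structure IsRegularOver {S : Type*} [TopologicalSpace S]
    [ChartedSpace (EuclideanSpace ℝ (Fin 7)) S] [IsManifold (𝓡 7) ∞ S] [MulAction Circle S]
    (s : SasakiEinstein S) {E : Type*} [NormedAddCommGroup E] [NormedSpace ℂ E]
    {X : Type*} [TopologicalSpace X] [ChartedSpace E X] [IsManifold 𝓘(ℂ, E) ω X]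
    (h : KahlerMetric E X) (π : S → X) : Prop where
  bundle : IsPrincipalCircleBundle 𝓘(ℝ, E) π
  reeb : ∃ c : ℝ, 0 < c ∧ ∀ p, circleGenerator p = c • s.reeb p
  metric : ∀ (p : S) (u v : TangentSpace (𝓡 7) p), s.g.inner p u v =
    h.g.inner (π p) (mfderiv (𝓡 7) 𝓘(ℝ, E) π p u) (mfderiv (𝓡 7) 𝓘(ℝ, E) π p v)
      + s.contactForm p ![u] * s.contactForm p ![v]
  curvature : ∀ (p : S) (u v : TangentSpace (𝓡 7) p), extDerivative s.contactForm p ![u, v] =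
    2 * h.form (π p) ![mfderiv (𝓡 7) 𝓘(ℝ, E) π p u, mfderiv (𝓡 7) 𝓘(ℝ, E) π p v]

/-! ### Circle bundles over `ℂP¹ × P` -/

/-- The complex projective line. -/
abbrev CP1 := OnePoint ℂ

/-- The product of the complex projective line and a complex manifold. -/
instance instChartedSpaceCP1Prod {E : Type*} [NormedAddCommGroup E] [NormedSpace ℂ E]
    {P : Type*} [TopologicalSpace P] [ChartedSpace E P] : ChartedSpace (ℂ × E) (CP1 × P) :=
  prodChartedSpace ℂ CP1 E P

instance instIsManifoldCP1Prod {E : Type*} [NormedAddCommGroup E] [NormedSpace ℂ E]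
    {P : Type*} [TopologicalSpace P] [ChartedSpace E P] [IsManifold 𝓘(ℂ, E) ω P] :
    IsManifold 𝓘(ℂ, ℂ × E) ω (CP1 × P) := by
  rw [modelWithCornersSelf_prod]
  exact IsManifold.prod (n := ω) (I := 𝓘(ℂ, ℂ)) (I' := 𝓘(ℂ, E)) CP1 P

/-- The integral of a `2`-form over the complex projective line, computed in the affine
coordinate `z`, which misses only one point. -/
def integralCP1 (β : DiffForm 𝓘(ℝ, ℂ) CP1 2 ℝ) : ℝ :=
  ∫ z : ℂ, β (z : CP1)
    ![mfderiv 𝓘(ℝ, ℂ) 𝓘(ℝ, ℂ) (fun w : ℂ => (w : CP1)) z (1 : ℂ),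
      mfderiv 𝓘(ℝ, ℂ) 𝓘(ℝ, ℂ) (fun w : ℂ => (w : CP1)) z Complex.I]

/-- The form `pr₁^* ω₁ + pr₂^* ω_P` on `ℂP¹ × P`, on the tangent vectors `u`, `v`. -/
def productForm {E : Type*} [NormedAddCommGroup E] [NormedSpace ℂ E]
    {P : Type*} [TopologicalSpace P] [ChartedSpace E P]
    (ω₁ : DiffForm 𝓘(ℝ, ℂ) CP1 2 ℝ) (ωP : DiffForm 𝓘(ℝ, E) P 2 ℝ)
    (x : CP1 × P) (u v : TangentSpace 𝓘(ℝ, ℂ × E) x) : ℝ :=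
  ω₁ x.1 ![(u : ℂ × E).1, (v : ℂ × E).1] + ωP x.2 ![(u : ℂ × E).2, (v : ℂ × E).2]

/-- `π : S → ℂP¹ × P` is a principal circle bundle whose Euler class is `[ω₁] + [ω_P]`, where
`[ω₁]` is the positive generator of `H²(ℂP¹, ℤ)`. By Chern-Weil theory this means
that there is a connection form `η`, normalised to integral one on the fibres, with
`dη = π^* (ω₁ + ω_P)`. -/
structure IsBundleWithUnitEulerClass {S : Type*} [TopologicalSpace S]
    [ChartedSpace (EuclideanSpace ℝ (Fin 7)) S] [MulAction Circle S]
    {E : Type*} [NormedAddCommGroup E] [NormedSpace ℂ E]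
    {P : Type*} [TopologicalSpace P] [ChartedSpace E P] (π : S → CP1 × P)
    (ω₁ : DiffForm 𝓘(ℝ, ℂ) CP1 2 ℝ) (ωP : DiffForm 𝓘(ℝ, E) P 2 ℝ)
    (η : DiffForm (𝓡 7) S 1 ℝ) : Prop where
  bundle : IsPrincipalCircleBundle 𝓘(ℝ, ℂ × E) π
  smooth₁ : IsSmoothForm ω₁
  smoothP : IsSmoothForm ωP
  integral₁ : integralCP1 ω₁ = 1
  smooth : IsSmoothForm η
  normalised : ∀ p, η p ![circleGenerator p] = 1
  curvature : ∀ (p : S) (u v : TangentSpace (𝓡 7) p), extDerivative η p ![u, v] =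
    productForm ω₁ ωP (π p)
      (mfderiv (𝓡 7) 𝓘(ℝ, ℂ × E) π p u) (mfderiv (𝓡 7) 𝓘(ℝ, ℂ × E) π p v)

end

end SasakiGeometry

open SasakiGeometry

namespace SasakiGeometry
open Set Filter
set_option linter.unusedSectionVars false

/-! Part (1) rests on the identity `dη = 2Ω`, valid on the link of every Kähler cone
(`extDeriv_contact_of_kahlerCone`, `SasakiEinstein.extDerivative_contactForm`). Compared with the
hypothesis `dη = 2 π^* ω_X` it gives `Ω = π^* ω_X`. Since `Ω = g(Φ·, ·)` and `dπ` is surjective, it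
follows that `dπ ∘ Φ = i dπ` (`IsRegularOver.tderiv_PhiAt`). The metric formula shows in addition
that `ker dπ` is spanned by `ξ`. The tangent space of `π⁻¹(Σ)` is therefore the inverse image under
`dπ` of a complex line: it has dimension three, contains `ξ` and is preserved by `Φ`.

Minimality is a computation in a complex chart of `X` that straightens `Σ` to a complex line `W`. In
the chart of `S` the metric is `k^* B + θ²`, with `k` the projection, `B` the metric of the base and
`θ` the contact form (`acceleration_identity`). For a curve in `π⁻¹(Σ)` and a normal vector `n`,
three kinds of terms occur. The second derivative of the projected curve lies in `W`, hence is
orthogonal to `n`. The terms with `θ` add up to `2 η(v) Ω(v, n) = 2 η(v) g(Φ v, n) = 0`. There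
remains a quadratic form in the velocity, built from first derivatives of `B`; closedness of the
Kähler form says that its values on `w` and `iw` cancel (`KahlerMetric.first_order_identity`), so
its trace vanishes (`sum_eq_zero_of_hermitian`).

For associativity, `ξ`, `u`, `Φ u` is an orthonormal frame on which `Ω ∧ η` equals `1`. The form `Ψ`
vanishes there because it contracts `∂_r` and `ξ = J ∂_r` into a form of type `(4, 0)`
(`SasakiEinstein.PsiAt_reeb`). So `φ_t` restricts to `Ω ∧ η` for every `t`, and `Ω ∧ η` is the
common orientation.

In part (2) the bundle over `ℂP¹ × {p}` is trivialised over the affine line by a section `s` and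
around infinity by a section `s₁`. After a gluing they satisfy `s z = (z/|z|)^k s₁(1/z)` for `|z| ≥
1` (`IsPrincipalCircleBundle.exists_section_plane`). The integral of `s^* η` over the circle of
radius `R` tends to the total curvature `1` by Stokes, and to `k` because `η` has integral one on
the fibres; hence `k = 1` (`IsBundleWithUnitEulerClass.degree_eq_one`). Then `(a, b) ↦ (b/|b|)
s(a/b)`, continued by `(a/|a|) s₁(b/a)` across `b = 0`, is smooth away from the origin of `ℂ²`, and
restricts to an embedding of the 3-sphere onto the preimage, as for the Hopf fibration. -/

theorem two_le_infty : minSmoothness ℝ 2 ≤ (∞ : ℕ∞ω) := by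
  rw [minSmoothness_of_isRCLikeNormedField]
  exact WithTop.coe_le_coe.2 (le_top : (2 : ℕ∞) ≤ ⊤)

/-! ### Derivatives of maps between manifolds, read on the model spaces -/

section Derivative

variable {E : Type*} [NormedAddCommGroup E] [NormedSpace ℝ E]
  {H : Type*} [TopologicalSpace H] (I : ModelWithCorners ℝ E H)
  {M : Type*} [TopologicalSpace M] [ChartedSpace H M]
  {E' : Type*} [NormedAddCommGroup E'] [NormedSpace ℝ E']
  {H' : Type*} [TopologicalSpace H'] (I' : ModelWithCorners ℝ E' H')
  {M' : Type*} [TopologicalSpace M'] [ChartedSpace H' M']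
  {E'' : Type*} [NormedAddCommGroup E''] [NormedSpace ℝ E'']
  {H'' : Type*} [TopologicalSpace H''] (I'' : ModelWithCorners ℝ E'' H'')
  {M'' : Type*} [TopologicalSpace M''] [ChartedSpace H'' M'']

/-- The derivative of a map between manifolds, as a map of model spaces. -/
noncomputable def tderiv (f : M → M') (x : M) : E →L[ℝ] E' := mfderiv I I' f x

variable {I I' I''}

theorem tderiv_congr {f g : M → M'} {x : M} (h : f =ᶠ[𝓝 x] g) :
    tderiv I I' f x = tderiv I I' g x := by
  have := h.mfderiv_eq (I := I) (I' := I')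
  exact this

theorem tderiv_comp {g : M' → M''} {f : M → M'} (x : M) (hg : MDifferentiableAt I' I'' g (f x))
    (hf : MDifferentiableAt I I' f x) :
    tderiv I I'' (fun y => g (f y)) x = (tderiv I' I'' g (f x)).comp (tderiv I I' f x) :=
  mfderiv_comp x hg hf

theorem tderiv_comp_apply {g : M' → M''} {f : M → M'} (x : M)
    (hg : MDifferentiableAt I' I'' g (f x)) (hf : MDifferentiableAt I I' f x) (u : E) :
    tderiv I I'' (fun y => g (f y)) x u = tderiv I' I'' g (f x) (tderiv I I' f x u) := by
  rw [tderiv_comp x hg hf]; rfl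

theorem tderiv_eq_fderiv (f : E → E') (x : E) : tderiv 𝓘(ℝ, E) 𝓘(ℝ, E') f x = fderiv ℝ f x :=
  mfderiv_eq_fderiv

theorem tderiv_id' (x : M) : tderiv I I (fun y : M => y) x = ContinuousLinearMap.id ℝ E :=
  mfderiv_id

theorem tderiv_const' (x : M) (c : M') : tderiv I I' (fun _ : M => c) x = 0 :=
  mfderiv_const

/-- The tangent space at `x` is the model space as seen through the preferred chart at `x`, so that
chart has identity derivative at its own base point. This is why computations at `x` in this chart
need no change of basis. -/
theorem tderiv_extChartAt_self [IsManifold I ∞ M] (x : M) :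
    tderiv I 𝓘(ℝ, E) (extChartAt I x) x = ContinuousLinearMap.id ℝ E :=
  haveI : IsManifold I 1 M := .of_le (n := ∞) (by simp)
  mfderiv_extChartAt_self

/-- In the charts at `x` and `f x` the derivative at `x` is the derivative of `f` in charts. -/
theorem tderiv_eq_fderiv_extChartAt [IsManifold I' ∞ M'] {f : E → M'} {x : E}
    (hf : MDifferentiableAt 𝓘(ℝ, E) I' f x) :
    tderiv 𝓘(ℝ, E) I' f x = fderiv ℝ (fun w => extChartAt I' (f x) (f w)) x := by
  have h : MDifferentiableAt I' 𝓘(ℝ, E') (extChartAt I' (f x)) (f x) :=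
    mdifferentiableAt_extChartAt (by simp)
  rw [← tderiv_eq_fderiv, tderiv_comp x h hf, tderiv_extChartAt_self, ContinuousLinearMap.id_comp]

variable [I.Boundaryless]

theorem contMDiffAt_extChartAt_symm [IsManifold I ∞ M] (x : M) {y : E}
    (hy : y ∈ (extChartAt I x).target) :
    ContMDiffAt 𝓘(ℝ, E) I ∞ (extChartAt I x).symm y :=
  (contMDiffOn_extChartAt_symm x).contMDiffAt ((isOpen_extChartAt_target x).mem_nhds hy)

theorem tderiv_symm_extChartAt [IsManifold I ∞ M] {x y : M} (hy : y ∈ (extChartAt I x).source)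
    (u : E) : tderiv 𝓘(ℝ, E) I (extChartAt I x).symm (extChartAt I x y)
      (tderiv I 𝓘(ℝ, E) (extChartAt I x) y u) = u := by
  have h1 := (contMDiffAt_extChartAt_symm (I := I) x ((extChartAt I x).map_source hy))
  have h2 : MDifferentiableAt I 𝓘(ℝ, E) (extChartAt I x) y :=
    mdifferentiableAt_extChartAt (by rwa [extChartAt_source] at hy)
  rw [← tderiv_comp_apply y (h1.mdifferentiableAt (by simp)) h2]
  rw [tderiv_congr (g := fun y => y), tderiv_id']; · rfl
  filter_upwards [(isOpen_extChartAt_source (I := I) x).mem_nhds hy] with w hw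
  exact (extChartAt I x).left_inv hw

theorem tderiv_extChartAt_symm [IsManifold I ∞ M] {x : M} {y : E}
    (hy : y ∈ (extChartAt I x).target)
    (u : E) : tderiv I 𝓘(ℝ, E) (extChartAt I x) ((extChartAt I x).symm y)
      (tderiv 𝓘(ℝ, E) I (extChartAt I x).symm y u) = u := by
  have h1 := (contMDiffAt_extChartAt_symm (I := I) x hy)
  have h2 : MDifferentiableAt I 𝓘(ℝ, E) (extChartAt I x) ((extChartAt I x).symm y) :=
    mdifferentiableAt_extChartAt (by
      have := (extChartAt I x).map_target hy; rwa [extChartAt_source] at this)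
  rw [← tderiv_comp_apply y h2 (h1.mdifferentiableAt (by simp))]
  rw [tderiv_congr (g := fun y => y), tderiv_id']; · rfl
  filter_upwards [(isOpen_extChartAt_target (I := I) x).mem_nhds hy] with w hw
  exact (extChartAt I x).right_inv hw

end Derivative

/-! ### Pullback of forms and naturality of the exterior derivative -/

section Pullback

variable {E : Type*} [NormedAddCommGroup E] [NormedSpace ℝ E]
  {H : Type*} [TopologicalSpace H] {I : ModelWithCorners ℝ E H}
  {M : Type*} [TopologicalSpace M] [ChartedSpace H M]
  {F : Type*} [NormedAddCommGroup F] [NormedSpace ℝ F] {k : ℕ}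
  {V : Type*} [NormedAddCommGroup V] [NormedSpace ℝ V]

/-- The value of a form at a point, on the model space. -/
def formAt (α : DiffForm I M k F) (x : M) : E [⋀^Fin k]→L[ℝ] F := α x

/-- The pullback of a form under a map from a vector space. -/
noncomputable def pullbackForm (f : V → M) (α : DiffForm I M k F) (v : V) : V [⋀^Fin k]→L[ℝ] F :=
  (formAt α (f v)).compContinuousLinearMap (tderiv 𝓘(ℝ, V) I f v)

theorem formInChart_eq (α : DiffForm I M k F) (x : M) :
    formInChart α x = pullbackForm (extChartAt I x).symm α := rfl

variable [IsManifold I ∞ M]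

theorem contDiffAt_extChartAt_comp {f : V → M} {v : V} {x : M}
    (hf : ContMDiffAt 𝓘(ℝ, V) I ∞ f v) (hx : f v ∈ (extChartAt I x).source) :
    ContDiffAt ℝ ∞ (fun w => extChartAt I x (f w)) v := by
  rw [← contMDiffAt_iff_contDiffAt]
  rw [extChartAt_source] at hx
  exact (contMDiffAt_extChartAt' hx).comp v hf

variable [I.Boundaryless]

/-- The pullback of a form is the pullback of its chart expression. -/
theorem pullbackForm_eq_chart {f : V → M} {v : V} {x : M}
    (hf : ContMDiffAt 𝓘(ℝ, V) I ∞ f v) (hx : f v ∈ (extChartAt I x).source)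
    (α : DiffForm I M k F) :
    pullbackForm f α v = (formInChart α x (extChartAt I x (f v))).compContinuousLinearMap
      (fderiv ℝ (fun w => extChartAt I x (f w)) v) := by
  have hc := (contDiffAt_extChartAt_comp hf hx)
  have hs := (contMDiffAt_extChartAt_symm (I := I) x ((extChartAt I x).map_source hx))
  have h1 : f =ᶠ[𝓝 v] fun w => (extChartAt I x).symm (extChartAt I x (f w)) := by
    filter_upwards [hf.continuousAt.preimage_mem_nhds
      ((isOpen_extChartAt_source (I := I) x).mem_nhds hx)] with w hw
    exact ((extChartAt I x).left_inv hw).symm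
  have h2 : tderiv 𝓘(ℝ, V) I f v = (tderiv 𝓘(ℝ, E) I (extChartAt I x).symm
      (extChartAt I x (f v))).comp (fderiv ℝ (fun w => extChartAt I x (f w)) v) := by
    rw [tderiv_congr h1, tderiv_comp v (hs.mdifferentiableAt (by simp))
      ((hc.contMDiffAt).mdifferentiableAt (by simp)), tderiv_eq_fderiv]
  have h3 : (extChartAt I x).symm (extChartAt I x (f v)) = f v := (extChartAt I x).left_inv hx
  ext u
  simp only [formInChart_eq, pullbackForm,
    ContinuousAlternatingMap.compContinuousLinearMap_apply, h2, h3]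
  rfl

/-- Near `v` the pullback by `f` is the pullback of one fixed chart expression of `α` under a map of
vector spaces, for which naturality of `extDeriv` is available. The chart is the one at `f v`, the
same in which `extDerivative α` is evaluated there, and its derivative at `f v` is the identity. -/
theorem extDeriv_pullbackForm {f : V → M} {v : V} {α : DiffForm I M k F} (hα : IsSmoothForm α)
    (hf : ∀ᶠ w in 𝓝 v, ContMDiffAt 𝓘(ℝ, V) I ∞ f w) :
    extDeriv (pullbackForm f α) v = pullbackForm f (extDerivative α) v := by
  have hfv := hf.self_of_nhds
  have hx : f v ∈ (extChartAt I (f v)).source := mem_extChartAt_source _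
  have hmem : (extChartAt I (f v) (f v)) ∈ (extChartAt I (f v)).target := mem_extChartAt_target _
  have hev : ∀ᶠ w in 𝓝 v, pullbackForm f α w =
      (formInChart α (f v) (extChartAt I (f v) (f w))).compContinuousLinearMap
      (fderiv ℝ (fun w => extChartAt I (f v) (f w)) w) := by
    filter_upwards [hf, hfv.continuousAt.preimage_mem_nhds
      ((isOpen_extChartAt_source (I := I) (f v)).mem_nhds hx)] with w hw hw'
    exact pullbackForm_eq_chart hw hw' α
  have hsm : ContDiffAt ℝ ∞ (formInChart α (f v)) (extChartAt I (f v) (f v)) :=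
    (hα (f v)).contDiffAt ((isOpen_extChartAt_target (f v)).mem_nhds hmem)
  rw [Filter.EventuallyEq.extDeriv_eq hev,
    extDeriv_pullback (f := fun w => extChartAt I (f v) (f w)) (hsm.differentiableAt (by simp))
      (contDiffAt_extChartAt_comp hfv hx) two_le_infty]
  have h2 := tderiv_eq_fderiv_extChartAt (hfv.mdifferentiableAt (by simp))
  have h3 : formAt (extDerivative α) (f v)
      = (extDeriv (formInChart α (f v)) (extChartAt I (f v) (f v))) := by
    have : formAt (extDerivative α) (f v)
      = (extDeriv (formInChart α (f v)) (extChartAt I (f v) (f v))).compContinuousLinearMap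
        (tderiv I 𝓘(ℝ, E) (extChartAt I (f v)) (f v)) := rfl
    rw [this, tderiv_extChartAt_self]
    rfl
  rw [pullbackForm, h2, h3]

end Pullback

/-! ### Smoothness of families of alternating forms -/

section FiniteDim

variable {E : Type*} [NormedAddCommGroup E] [NormedSpace ℝ E] [FiniteDimensional ℝ E]
  {F : Type*} [NormedAddCommGroup F] [NormedSpace ℝ F] [FiniteDimensional ℝ F] {k : ℕ}
  {V : Type*} [NormedAddCommGroup V] [NormedSpace ℝ V]

/-- A family of alternating forms is smooth if its values on all vectors are. -/
theorem contDiffOn_alternating {α : V → E [⋀^Fin k]→L[ℝ] F} {s : Set V} {n : ℕ∞ω}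
    (h : ∀ v : Fin k → E, ContDiffOn ℝ n (fun x => α x v) s) : ContDiffOn ℝ n α s := by
  let b := Module.finBasis ℝ E
  -- Evaluation on tuples of basis vectors is injective. A linear left inverse, continuous by finite
  -- dimension, recovers the form from finitely many smooth coefficients.
  let L : (E [⋀^Fin k]→L[ℝ] F) →ₗ[ℝ] ((Fin k → Fin (Module.finrank ℝ E)) → F) :=
    { toFun := fun a i => a (fun j => b (i j))
      map_add' := fun _ _ => rfl
      map_smul' := fun _ _ => rfl }
  have hinj : LinearMap.ker L = ⊥ := by
    rw [LinearMap.ker_eq_bot]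
    intro a a' h
    have : a.toAlternatingMap.toMultilinearMap = a'.toAlternatingMap.toMultilinearMap :=
      Module.Basis.ext_multilinear (fun _ => b) fun i => congrFun h i
    ext v
    exact congrArg (fun m : MultilinearMap ℝ (fun _ : Fin k => E) F => m v) this
  obtain ⟨Q, hQ⟩ := L.exists_leftInverse_of_injective hinj
  have h1 : ContDiffOn ℝ n (fun x => L (α x)) s := by
    rw [contDiffOn_pi]
    exact fun i => h _
  have h2 := (LinearMap.toContinuousLinearMap Q).contDiff.comp_contDiffOn h1
  refine h2.congr fun x _ => ?_
  exact (LinearMap.congr_fun hQ (α x)).symm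

end FiniteDim

/-! ### Charts from the inverse function theorem -/

section InverseFunction

variable {V W : Type*} [NormedAddCommGroup V] [NormedSpace ℝ V] [CompleteSpace V]
  [NormedAddCommGroup W] [NormedSpace ℝ W]

/-- The inverse function theorem, with a smooth inverse on the whole target. -/
theorem exists_openPartialHomeomorph_eqOn {G : V → W} {U : Set V} (hU : IsOpen U) {x : V}
    (hx : x ∈ U) (hG : ContDiffOn ℝ ∞ G U) (A : V ≃L[ℝ] W) (hA : fderiv ℝ G x = A) :
    ∃ Ψ : OpenPartialHomeomorph V W, x ∈ Ψ.source ∧ Ψ.source ⊆ U ∧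
      (∀ y, Ψ y = G y) ∧ ContDiffOn ℝ ∞ Ψ.symm Ψ.target := by
  have hGx : ContDiffAt ℝ ∞ G x := hG.contDiffAt (hU.mem_nhds hx)
  have hd : HasFDerivAt G (A : V →L[ℝ] W) x := by
    rw [← hA]; exact (hGx.differentiableAt (by simp)).hasFDerivAt
  let Ψ₀ := hGx.toOpenPartialHomeomorph G hd (by simp)
  -- The theorem gives smoothness of the inverse only where the derivative of `G` is invertible.
  -- This is an open condition, and restricting the source to it makes the inverse smooth on its
  -- whole target.
  let O : Set V := {y | fderiv ℝ G y ∈ range ((↑) : (V ≃L[ℝ] W) → V →L[ℝ] W)} ∩ U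
  have hO : IsOpen O := by
    have := (hG.continuousOn_fderiv_of_isOpen hU (by simp)).isOpen_inter_preimage hU
      ContinuousLinearEquiv.isOpen
    rwa [inter_comm] at this
  refine ⟨Ψ₀.restrOpen O hO, ⟨hGx.mem_toOpenPartialHomeomorph_source hd (by simp), ⟨A, hA.symm⟩, hx⟩,
    fun y hy => hy.2.2, fun y => rfl, ?_⟩
  intro z hz
  have hy := (Ψ₀.restrOpen O hO).map_target hz
  obtain ⟨B, hB⟩ := hy.2.1
  have hGy : ContDiffAt ℝ ∞ G ((Ψ₀.restrOpen O hO).symm z) := hG.contDiffAt (hU.mem_nhds hy.2.2)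
  refine ((Ψ₀.restrOpen O hO).contDiffAt_symm (f₀' := B) hz ?_ hGy).contDiffWithinAt
  rw [hB]
  exact (hGy.differentiableAt (by simp)).hasFDerivAt

variable {M : Type*} [TopologicalSpace M] [ChartedSpace V M] [IsManifold 𝓘(ℝ, V) ∞ M]

theorem contMDiffAt_chartAt_symm (p : M) {y : V} (hy : y ∈ (chartAt V p).target) :
    ContMDiffAt 𝓘(ℝ, V) 𝓘(ℝ, V) ∞ (chartAt V p).symm y :=
  contMDiffOn_chart_symm.contMDiffAt ((chartAt V p).open_target.mem_nhds hy)

theorem trans_mem_maximalAtlas {e : OpenPartialHomeomorph M V}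
    (he : e ∈ IsManifold.maximalAtlas 𝓘(ℝ, V) ∞ M) {Ψ : OpenPartialHomeomorph V V}
    (h : ContDiffOn ℝ ∞ Ψ Ψ.source) (h' : ContDiffOn ℝ ∞ Ψ.symm Ψ.target) :
    e ≫ₕ Ψ ∈ IsManifold.maximalAtlas 𝓘(ℝ, V) ∞ M := by
  refine OpenPartialHomeomorph.mem_maximalAtlas_of_contMDiffOn _ ?_ ?_
  · intro q hq
    rw [OpenPartialHomeomorph.trans_source] at hq
    have h1 := contMDiffAt_of_mem_maximalAtlas he hq.1
    have h2 := (h.contDiffAt (Ψ.open_source.mem_nhds hq.2)).contMDiffAt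
    exact (h2.comp q h1).contMDiffWithinAt
  · intro z hz
    rw [OpenPartialHomeomorph.trans_target] at hz
    have h2 := contMDiffAt_symm_of_mem_maximalAtlas he hz.2
    have h1 := (h'.contDiffAt (Ψ.open_target.mem_nhds hz.1)).contMDiffAt
    exact (h2.comp z h1).contMDiffWithinAt

/-- A smooth map to the model space with invertible derivative is a chart. -/
theorem exists_chart_eqOn {F : M → V} {U : Set M} (hU : IsOpen U) {p : M} (hp : p ∈ U)
    (hF : ContMDiffOn 𝓘(ℝ, V) 𝓘(ℝ, V) ∞ F U) (A : V ≃L[ℝ] V)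
    (hA : tderiv 𝓘(ℝ, V) 𝓘(ℝ, V) F p = A) :
    ∃ e ∈ IsManifold.maximalAtlas 𝓘(ℝ, V) ∞ M, p ∈ e.source ∧ e.source ⊆ U ∧
      ∀ q ∈ e.source, e q = F q := by
  let c := chartAt V p
  have hc : c.symm (c p) = p := c.left_inv (mem_chart_source V p)
  have hU' : IsOpen (c.target ∩ c.symm ⁻¹' U) := c.isOpen_inter_preimage_symm hU
  have hG : ContDiffOn ℝ ∞ (fun y => F (c.symm y)) (c.target ∩ c.symm ⁻¹' U) := by
    rw [← contMDiffOn_iff_contDiffOn]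
    exact hF.comp (contMDiffOn_chart_symm.mono inter_subset_left) (fun y hy => hy.2)
  have hA' : fderiv ℝ (fun y => F (c.symm y)) (c p) = A := by
    have h1 := (contMDiffAt_chartAt_symm p ((chartAt V p).map_source (mem_chart_source V p)))
    have h2 : MDifferentiableAt 𝓘(ℝ, V) 𝓘(ℝ, V) F (c.symm (c p)) := by
      rw [hc]; exact (hF.contMDiffAt (hU.mem_nhds hp)).mdifferentiableAt (by simp)
    rw [← tderiv_eq_fderiv, tderiv_comp _ h2 (h1.mdifferentiableAt (by simp)), hc, hA]
    have h3 : tderiv 𝓘(ℝ, V) 𝓘(ℝ, V) c.symm (c p) = ContinuousLinearMap.id ℝ V := by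
      ext u
      have := tderiv_symm_extChartAt (I := 𝓘(ℝ, V)) (mem_extChartAt_source (I := 𝓘(ℝ, V)) p) u
      rw [tderiv_extChartAt_self] at this
      simpa using this
    rw [h3, ContinuousLinearMap.comp_id]
  obtain ⟨Ψ, h1, h2, h3, h4⟩ := exists_openPartialHomeomorph_eqOn hU'
    ⟨c.map_source (mem_chart_source V p), by rwa [mem_preimage, hc]⟩ hG A hA'
  refine ⟨c ≫ₕ Ψ, trans_mem_maximalAtlas (IsManifold.chart_mem_maximalAtlas p) ?_ h4, ?_, ?_, ?_⟩
  · exact (hG.mono h2).congr fun y _ => h3 y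
  · rw [OpenPartialHomeomorph.trans_source]
    exact ⟨mem_chart_source V p, h1⟩
  · intro q hq
    rw [OpenPartialHomeomorph.trans_source] at hq
    have := (h2 hq.2).2
    rwa [mem_preimage, c.left_inv hq.1] at this
  · intro q hq
    rw [OpenPartialHomeomorph.trans_source] at hq
    rw [OpenPartialHomeomorph.trans_apply, h3, c.left_inv hq.1]

end InverseFunction

/-! ### Maps with injective derivative are immersions -/

section Immersion

variable {E E' : Type*} [NormedAddCommGroup E] [NormedSpace ℝ E] [FiniteDimensional ℝ E]
  [NormedAddCommGroup E'] [NormedSpace ℝ E'] [FiniteDimensional ℝ E']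
  {F : Type*} [NormedAddCommGroup F] [NormedSpace ℝ F] [FiniteDimensional ℝ F]
  {M : Type*} [TopologicalSpace M] [ChartedSpace E M] [IsManifold 𝓘(ℝ, E) ∞ M]
  {N : Type*} [TopologicalSpace N] [ChartedSpace E' N] [IsManifold 𝓘(ℝ, E') ∞ N]

/-- A smooth map with injective derivative is an immersion. -/
theorem isImmersionAtOfComplement_of_injective
    (hdim : Module.finrank ℝ E + Module.finrank ℝ F = Module.finrank ℝ E') {f : M → N}
    (hf : ContMDiff 𝓘(ℝ, E) 𝓘(ℝ, E') ∞ f) (x : M)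
    (hinj : Function.Injective (tderiv 𝓘(ℝ, E) 𝓘(ℝ, E') f x)) :
    Manifold.IsImmersionAtOfComplement F 𝓘(ℝ, E) 𝓘(ℝ, E') ∞ f x := by
  set A := tderiv 𝓘(ℝ, E) 𝓘(ℝ, E') f x with hAdef
  -- `F` is identified with a complement of the image of the derivative, so that `B = A + ι` is an
  -- isomorphism `E × F → E'`.
  obtain ⟨C, hC⟩ := (LinearMap.range (A : E →ₗ[ℝ] E')).exists_isCompl
  have hCdim : Module.finrank ℝ F = Module.finrank ℝ C := by
    have h1 := Submodule.finrank_add_eq_of_isCompl hC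
    have h2 := LinearMap.finrank_range_of_inj (f := (A : E →ₗ[ℝ] E')) hinj
    omega
  let ι : F →L[ℝ] E' := C.subtypeL.comp (ContinuousLinearEquiv.ofFinrankEq hCdim : F →L[ℝ] C)
  have hι : ∀ w, ι w ∈ C := fun w => Subtype.property _
  let B : E × F →L[ℝ] E' := A.coprod ι
  have hBinj : Function.Injective B := by
    rw [injective_iff_map_eq_zero]
    rintro ⟨u, w⟩ h
    have h0 : A u + ι w = 0 := by simpa [B] using h
    have h1 : A u ∈ LinearMap.range (A : E →ₗ[ℝ] E') ⊓ C := by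
      refine ⟨⟨u, rfl⟩, ?_⟩
      rw [eq_neg_of_add_eq_zero_left h0]
      exact C.neg_mem (hι w)
    rw [hC.inf_eq_bot, Submodule.mem_bot] at h1
    have hu : u = 0 := hinj (by rw [h1, map_zero])
    have hw : ι w = 0 := by rwa [h1, zero_add] at h0
    have hw' : w = 0 := by
      have : (ContinuousLinearEquiv.ofFinrankEq hCdim w : C) = 0 := Subtype.ext hw
      simpa using this
    rw [hu, hw']; rfl
  let equiv : (E × F) ≃L[ℝ] E' := (LinearEquiv.ofInjectiveOfFinrankEq (B : E × F →ₗ[ℝ] E') hBinj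
    (by rw [Module.finrank_prod, hdim])).toContinuousLinearEquiv
  have hequiv : (equiv : E × F →L[ℝ] E') = B := by ext <;> rfl
  let c := chartAt E x
  let d := chartAt E' (f x)
  have hcx : c.symm (c x) = x := c.left_inv (mem_chart_source E x)
  let U : Set E := c.target ∩ c.symm ⁻¹' (f ⁻¹' d.source)
  have hU : IsOpen U := c.isOpen_inter_preimage_symm (d.open_source.preimage hf.continuous)
  have hcU : c x ∈ U := ⟨c.map_source (mem_chart_source E x), by
    rw [mem_preimage, hcx]; exact mem_chart_source E' (f x)⟩
  have hfU : ContDiffOn ℝ ∞ (fun y => d (f (c.symm y))) U := by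
    rw [← contMDiffOn_iff_contDiffOn]
    exact (contMDiffOn_chart (x := f x)).comp
      (hf.comp_contMDiffOn (contMDiffOn_chart_symm.mono inter_subset_left)) fun y hy => hy.2
  have hderiv : fderiv ℝ (fun y => d (f (c.symm y))) (c x) = A := by
    have h1 := (contMDiffAt_chartAt_symm x ((chartAt E x).map_source (mem_chart_source E x)))
    have h2 := (contMDiffOn_chart (I := 𝓘(ℝ, E')) (n := ∞) (x := f x)).contMDiffAt
      (d.open_source.mem_nhds (mem_chart_source E' (f x)))
    have hfx : MDifferentiableAt 𝓘(ℝ, E) 𝓘(ℝ, E') f (c.symm (c x)) :=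
      (hf _).mdifferentiableAt (by simp)
    have h3 : tderiv 𝓘(ℝ, E) 𝓘(ℝ, E) c.symm (c x) = ContinuousLinearMap.id ℝ E := by
      ext u
      have := tderiv_symm_extChartAt (I := 𝓘(ℝ, E)) (mem_extChartAt_source (I := 𝓘(ℝ, E)) x) u
      rw [tderiv_extChartAt_self] at this
      simpa using this
    have h4 : tderiv 𝓘(ℝ, E') 𝓘(ℝ, E') d (f x) = ContinuousLinearMap.id ℝ E' := by
      simpa using tderiv_extChartAt_self (I := 𝓘(ℝ, E')) (f x)
    rw [← tderiv_eq_fderiv, tderiv_comp (c x) (g := d) (f := fun y => f (c.symm y))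
      (I' := 𝓘(ℝ, E')) (by rw [hcx]; exact h2.mdifferentiableAt (by simp))
      (hfx.comp _ (h1.mdifferentiableAt (by simp))),
      tderiv_comp (c x) hfx (h1.mdifferentiableAt (by simp)), hcx, h3, h4]
    simp [hAdef]
  -- Adding `ι` in the chart of `N` extends `f` to a local diffeomorphism `Ψ` of `E × F` whose slice
  -- over `0` is `f`. Its inverse, followed by `equiv`, is the chart in which `f` becomes `u ↦ equiv
  -- (u, 0)`.
  have hG : ContDiffOn ℝ ∞ (fun q : E × F => d (f (c.symm q.1)) + ι q.2) (U ×ˢ univ) :=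
    (hfU.comp contDiffOn_fst fun q hq => hq.1).add (ι.contDiff.comp_contDiffOn contDiffOn_snd)
  obtain ⟨Ψ, h1, h2, h3, h4⟩ := exists_openPartialHomeomorph_eqOn (x := (c x, (0 : F)))
    (hU.prod isOpen_univ) (mk_mem_prod hcU (mem_univ _)) hG equiv (by
      rw [hequiv]
      have e1 : HasFDerivAt (fun y => d (f (c.symm y))) A (c x) := by
        rw [← hderiv]
        exact ((hfU.contDiffAt (hU.mem_nhds hcU)).differentiableAt (by simp)).hasFDerivAt
      have e2 : HasFDerivAt (fun q : E × F => d (f (c.symm q.1)))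
          (A.comp (ContinuousLinearMap.fst ℝ E F)) (c x, (0 : F)) :=
        HasFDerivAt.comp (g := fun y => d (f (c.symm y))) (c x, (0 : F)) e1 hasFDerivAt_fst
      have e3 : HasFDerivAt (fun q : E × F => ι q.2) (ι.comp (ContinuousLinearMap.snd ℝ E F))
          (c x, (0 : F)) := ι.hasFDerivAt.comp _ hasFDerivAt_snd
      exact (e2.add e3).fderiv.trans (by ext <;> simp [B]))
  -- The chart of `M` is shrunk so that the slice `(u, 0)` stays in the source of `Ψ`, where
  -- `Ψ.symm` is a left inverse.
  let O : Set E := U ∩ (fun u => (u, (0 : F))) ⁻¹' Ψ.source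
  have hO : IsOpen O := hU.inter (Ψ.open_source.preimage (by fun_prop))
  let dom : OpenPartialHomeomorph M E := c ≫ₕ OpenPartialHomeomorph.ofSet O hO
  have hdom : dom ∈ IsManifold.maximalAtlas 𝓘(ℝ, E) ∞ M :=
    trans_mem_maximalAtlas (IsManifold.chart_mem_maximalAtlas x) contDiffOn_id contDiffOn_id
  let Θ : OpenPartialHomeomorph E' E' := Ψ.symm ≫ₕ equiv.toHomeomorph.toOpenPartialHomeomorph
  have hΘ1 : ContDiffOn ℝ ∞ Θ Θ.source := by
    have : Θ.source = Ψ.target := by simp [Θ]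
    rw [this]
    exact equiv.contDiff.comp_contDiffOn h4
  have hΘ2 : ContDiffOn ℝ ∞ Θ.symm Θ.target := by
    intro z hz
    simp only [Θ, OpenPartialHomeomorph.trans_target] at hz
    have hz' : equiv.symm z ∈ Ψ.source := hz.2
    have : ContDiffAt ℝ ∞ (fun y => Ψ (equiv.symm y)) z := by
      refine ContDiffAt.comp z ?_ equiv.symm.contDiff.contDiffAt
      have h5 : ContDiffAt ℝ ∞ (fun q : E × F => d (f (c.symm q.1)) + ι q.2) (equiv.symm z) :=
        hG.contDiffAt ((hU.prod isOpen_univ).mem_nhds (h2 hz'))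
      exact h5.congr_of_eventuallyEq (Eventually.of_forall h3)
    exact this.contDiffWithinAt
  let cod : OpenPartialHomeomorph N E' := d ≫ₕ Θ
  have hcod : cod ∈ IsManifold.maximalAtlas 𝓘(ℝ, E') ∞ N :=
    trans_mem_maximalAtlas (IsManifold.chart_mem_maximalAtlas (f x)) hΘ1 hΘ2
  refine Manifold.IsImmersionAtOfComplement.mk_of_continuousAt hf.continuous.continuousAt equiv
    dom cod ?_ ?_ hdom hcod ?_
  · simp only [dom, OpenPartialHomeomorph.trans_source]
    exact ⟨mem_chart_source E x, hcU, h1⟩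
  · simp only [cod, Θ, OpenPartialHomeomorph.trans_source]
    refine ⟨mem_chart_source E' (f x), ?_⟩
    have : d (f x) = Ψ (c x, 0) := by rw [h3]; simp [hcx]
    refine ⟨?_, mem_univ _⟩
    rw [this]
    exact Ψ.map_source h1
  · intro u hu
    have hu' : u ∈ O := by
      simp only [dom, OpenPartialHomeomorph.extend_target] at hu
      exact hu.1.1
    have : d (f (c.symm u)) = Ψ (u, 0) := by rw [h3]; simp
    change equiv (Ψ.symm (d (f (c.symm u)))) = equiv (u, 0)
    rw [this, Ψ.left_inv hu'.2]

end Immersion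

/-! ### Exterior derivatives in degrees one and two -/

section Forms

variable {E : Type*} [NormedAddCommGroup E] [NormedSpace ℝ E]

theorem extDeriv_one_apply {θ : E → E [⋀^Fin 1]→L[ℝ] ℝ} {x : E} (h : DifferentiableAt ℝ θ x)
    (u v : E) : extDeriv θ x ![u, v] =
      fderiv ℝ (fun y => θ y ![v]) x u - fderiv ℝ (fun y => θ y ![u]) x v := by
  rw [extDeriv_apply h, Fin.sum_univ_two]
  have h0 : (0 : Fin 2).removeNth ![u, v] = ![v] := by ext i; fin_cases i; rfl
  have h1 : (1 : Fin 2).removeNth ![u, v] = ![u] := by ext i; fin_cases i; rfl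
  simp only [h0, h1]
  simp [sub_eq_add_neg]

theorem extDeriv_two_apply {κ : E → E [⋀^Fin 2]→L[ℝ] ℝ} {x : E} (h : DifferentiableAt ℝ κ x)
    (u v w : E) : extDeriv κ x ![u, v, w] =
      fderiv ℝ (fun y => κ y ![v, w]) x u - fderiv ℝ (fun y => κ y ![u, w]) x v
        + fderiv ℝ (fun y => κ y ![u, v]) x w := by
  rw [extDeriv_apply h, Fin.sum_univ_three]
  have h0 : (0 : Fin 3).removeNth ![u, v, w] = ![v, w] := by ext i; fin_cases i <;> rfl
  have h1 : (1 : Fin 3).removeNth ![u, v, w] = ![u, w] := by ext i; fin_cases i <;> rfl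
  have h2 : (2 : Fin 3).removeNth ![u, v, w] = ![u, v] := by ext i; fin_cases i <;> rfl
  simp only [h0, h1, h2]
  simp [sub_eq_add_neg]

theorem alternating_two_swap (α : E [⋀^Fin 2]→L[ℝ] ℝ) (u v : E) : α ![u, v] = - α ![v, u] := by
  have := α.toAlternatingMap.map_swap ![v, u] (i := 0) (j := 1) (by decide)
  have h : ![v, u] ∘ Equiv.swap (0 : Fin 2) 1 = ![u, v] := by ext i; fin_cases i <;> rfl
  rw [h] at this
  exact this

theorem alternating_two_add_left (α : E [⋀^Fin 2]→L[ℝ] ℝ) (u u' v : E) :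
    α ![u + u', v] = α ![u, v] + α ![u', v] := by
  have := α.map_update_add ![u, v] 0 u u'
  have h : ∀ w, Function.update ![u, v] 0 w = ![w, v] := by
    intro w; ext i; fin_cases i <;> rfl
  simpa only [h] using this

theorem alternating_two_smul_left (α : E [⋀^Fin 2]→L[ℝ] ℝ) (c : ℝ) (u v : E) :
    α ![c • u, v] = c * α ![u, v] := by
  have := α.map_update_smul ![u, v] 0 c u
  have h : ∀ w, Function.update ![u, v] 0 w = ![w, v] := by
    intro w; ext i; fin_cases i <;> rfl
  simpa only [h, smul_eq_mul] using this

theorem hasFDerivAt_alternating_apply {k : ℕ} {V : Type*} [NormedAddCommGroup V] [NormedSpace ℝ V]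
    {κ : V → E [⋀^Fin k]→L[ℝ] ℝ} {x : V}
    {κ' : V →L[ℝ] E [⋀^Fin k]→L[ℝ] ℝ} (h : HasFDerivAt κ κ' x) (v : Fin k → E) :
    HasFDerivAt (fun y => κ y v) ((ContinuousAlternatingMap.apply ℝ E ℝ v).comp κ') x :=
  (ContinuousAlternatingMap.apply ℝ E ℝ v).hasFDerivAt.comp x h

end Forms

/-! ### The identity `dη = 2Ω` on a Kähler cone, in coordinates -/

section ConeCore

variable {E : Type*} [NormedAddCommGroup E] [NormedSpace ℝ E]

/-- On a Kähler cone, in coordinates: the form `ι_{∂_r} κ`, restricted to `r = 1`, has exterior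
derivative `2 κ`. -/
theorem extDeriv_contact_of_kahlerCone {y₀ : E} {J : E × ℝ → (E × ℝ) →L[ℝ] (E × ℝ)}
    {J' : (E × ℝ) →L[ℝ] (E × ℝ) →L[ℝ] (E × ℝ)} (hJ : HasFDerivAt J J' (y₀, 1))
    {g : E → E →L[ℝ] E →L[ℝ] ℝ}
    {κ : E × ℝ → (E × ℝ) [⋀^Fin 2]→L[ℝ] ℝ} (hκ : DifferentiableAt ℝ κ (y₀, 1))
    (hκJ : ∀ᶠ q in 𝓝 (y₀, (1 : ℝ)), ∀ a b, κ q ![a, b] =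
      q.2 ^ 2 * g q.1 (J q a).1 b.1 + (J q a).2 * b.2)
    (hθ : ∀ᶠ q in 𝓝 (y₀, (1 : ℝ)), ∀ b, κ q ![(0, q.2), b] = - (q.2 * (J q b).2))
    (hJ2 : ∀ᶠ q in 𝓝 (y₀, (1 : ℝ)), ∀ a, J q (J q a) = - a)
    (hiso : ∀ a b, g y₀ (J (y₀, 1) a).1 (J (y₀, 1) b).1 + (J (y₀, 1) a).2 * (J (y₀, 1) b).2
      = g y₀ a.1 b.1 + a.2 * b.2)
    (hN : ∀ a b, J' (J (y₀, 1) a) b - J' (J (y₀, 1) b) a + J (y₀, 1) (J' b a)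
      - J (y₀, 1) (J' a b) = 0)
    (hdκ : extDeriv κ (y₀, 1) = 0)
    {θ : E → E [⋀^Fin 1]→L[ℝ] ℝ} (hθd : DifferentiableAt ℝ θ y₀)
    (hθκ : ∀ᶠ y in 𝓝 y₀, ∀ u, θ y ![u] = κ (y, 1) ![(0, 1), (u, 0)]) (u v : E) :
    extDeriv θ y₀ ![u, v] = 2 * κ (y₀, 1) ![(u, 0), (v, 0)] := by
  -- Let `X = r ∂_r`. By Cartan's formula and `dκ = 0`, `d(ι_X κ)` is the Lie derivative of `κ`
  -- along `X`; the cone metric is homogeneous of degree two, so this equals `2κ` plus the cone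
  -- metric applied to `(L_X J)·`. The forms `d(ι_X κ)` and `κ` are invariant under `J`, the last
  -- term changes sign under `J`, so it vanishes. At `r = 1` the fields `X` and `∂_r` agree, which
  -- gives the claim.
  set j := J (y₀, 1) with hj
  have hκJ0 := hκJ.self_of_nhds
  have hθ0 := hθ.self_of_nhds
  have hJ20 := hJ2.self_of_nhds
  simp only [← hj] at hκJ0 hθ0 hJ20
  have hJapp : ∀ b, HasFDerivAt (fun q => J q b) (J'.flip b) (y₀, (1 : ℝ)) := fun b => by
    have := hJ.clm_apply (hasFDerivAt_const b (y₀, (1 : ℝ)))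
    refine this.congr_fderiv ?_
    ext <;> simp
  -- the derivative of `J² = -1`
  have hJJ : ∀ a b, J' a (j b) = - j (J' a b) := by
    intro a b
    have h1 : HasFDerivAt (fun q => J q (J q b)) (j.comp (J'.flip b) + J'.flip (j b))
        (y₀, (1 : ℝ)) := hJ.clm_apply (hJapp b)
    have h2 : HasFDerivAt (fun q => J q (J q b)) (0 : (E × ℝ) →L[ℝ] (E × ℝ)) (y₀, (1 : ℝ)) :=
      (hasFDerivAt_const (-b) _).congr_of_eventuallyEq (hJ2.mono fun q hq => hq b)
    have h3 := DFunLike.congr_fun (h1.unique h2) a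
    simp at h3
    exact eq_neg_of_add_eq_zero_right h3
  -- derivative of `ι_R κ`
  have hD1 : ∀ a b, fderiv ℝ (fun q => κ q ![(0, 1), b]) (y₀, 1) a
      = - a.2 * (j b).2 - (J' a b).2 - κ (y₀, 1) ![(0, a.2), b] := by
    intro a b
    have h1 : HasFDerivAt (fun q : E × ℝ => - ((J q b).2))
        (-((ContinuousLinearMap.snd ℝ E ℝ).comp (J'.flip b))) (y₀, (1 : ℝ)) :=
      ((ContinuousLinearMap.snd ℝ E ℝ).hasFDerivAt.comp _ (hJapp b)).neg
    have h2 : (fun q => κ q ![(0, 1), b]) =ᶠ[𝓝 (y₀, (1 : ℝ))] fun q => - ((J q b).2) := by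
      have : ∀ᶠ q : E × ℝ in 𝓝 (y₀, (1 : ℝ)), 0 < q.2 :=
        (continuous_snd.tendsto (y₀, (1 : ℝ))).eventually (lt_mem_nhds one_pos)
      filter_upwards [hθ, this] with q hq hq0
      have h3 : ((0 : E), q.2) = q.2 • ((0 : E), (1 : ℝ)) := by simp
      have h4 := hq b
      rw [h3, alternating_two_smul_left] at h4
      have : q.2 * (κ q ![(0, 1), b] + (J q b).2) = 0 := by linarith
      rcases mul_eq_zero.1 this with h | h
      · exact absurd h hq0.ne'
      · linarith
    rw [h2.fderiv_eq, h1.fderiv]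
    have h3 : ((0 : E), a.2) = a.2 • ((0 : E), (1 : ℝ)) := by simp
    have h4 := hθ0 b
    simp only [one_mul] at h4
    rw [h3, alternating_two_smul_left, h4]
    simp
    ring
  -- derivative along the ray
  have hD2 : ∀ a b, fderiv ℝ (fun q => κ q ![a, b]) (y₀, 1) (0, 1)
      = 2 * g y₀ (j a).1 b.1 + (g y₀ (J' (0, 1) a).1 b.1 + (J' (0, 1) a).2 * b.2) := by
    intro a b
    have hray : HasDerivAt (fun r : ℝ => ((y₀, r) : E × ℝ)) (0, 1) 1 :=
      (hasDerivAt_const 1 y₀).prodMk (hasDerivAt_id 1)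
    have hκd : DifferentiableAt ℝ (fun q => κ q ![a, b]) (y₀, (1 : ℝ)) :=
      (hasFDerivAt_alternating_apply hκ.hasFDerivAt _).differentiableAt
    have h1 : HasDerivAt (fun r : ℝ => κ (y₀, r) ![a, b])
        (fderiv ℝ (fun q => κ q ![a, b]) (y₀, 1) (0, 1)) 1 :=
      hκd.hasFDerivAt.comp_hasDerivAt (1 : ℝ) hray
    have hjd : HasDerivAt (fun r : ℝ => J (y₀, r) a) (J' (0, 1) a) 1 :=
      (hJapp a).comp_hasDerivAt (1 : ℝ) hray
    have hfst : HasDerivAt (fun r : ℝ => g y₀ (J (y₀, r) a).1 b.1) (g y₀ (J' (0, 1) a).1 b.1) 1 :=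
      (((g y₀).flip b.1).comp (ContinuousLinearMap.fst ℝ E ℝ)).hasFDerivAt.comp_hasDerivAt
        (1 : ℝ) hjd
    have hsnd : HasDerivAt (fun r : ℝ => (J (y₀, r) a).2) (J' (0, 1) a).2 1 :=
      (ContinuousLinearMap.snd ℝ E ℝ).hasFDerivAt.comp_hasDerivAt (1 : ℝ) hjd
    have h2 := (((hasDerivAt_pow 2 (1 : ℝ)).mul hfst).add (hsnd.mul_const b.2))
    have h3 : (fun r : ℝ => κ (y₀, r) ![a, b]) =ᶠ[𝓝 1] ((fun r : ℝ => r ^ 2) *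
        fun r => g y₀ (J (y₀, r) a).1 b.1) + fun r => (J (y₀, r) a).2 * b.2 := by
      have : Tendsto (fun r : ℝ => ((y₀, r) : E × ℝ)) (𝓝 1) (𝓝 (y₀, 1)) :=
        hray.continuousAt.tendsto
      filter_upwards [this.eventually hκJ] with r hr
      simpa using hr a b
    rw [(h2.congr_of_eventuallyEq h3).unique h1 |>.symm]
    simp only [← hj]
    ring
  -- `T` is `d(ι_X κ)` at the point, computed from `ι_X κ = -r dr ∘ J`.
  let T : E × ℝ → E × ℝ → ℝ := fun a b =>
    - a.2 * (j b).2 + b.2 * (j a).2 - (J' a b).2 + (J' b a).2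
  -- This is where integrability enters: together with the derivative of `J² = -1` it says that `J'
  -- (j a) (j b)` and `J' a b` have the same skew part in `a`, `b`.
  have hTJ : ∀ a b, T (j a) (j b) = T a b := by
    intro a b
    have h1 := hN a b
    have h2 : J' (j a) (j b) - J' (j b) (j a) = J' a b - J' b a := by
      rw [hJJ, hJJ]
      have h3 : J' (j a) b - J' (j b) a = j (J' a b) - j (J' b a) := by
        rw [← sub_eq_zero, ← h1]; abel
      have h4 := congrArg j h3
      rw [map_sub, map_sub, hJ20, hJ20] at h4
      calc -j (J' (j a) b) - -j (J' (j b) a) = -(j (J' (j a) b) - j (J' (j b) a)) := by abel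
        _ = _ := by rw [h4]; abel
    have h3 := congrArg Prod.snd h2
    simp only [Prod.snd_sub] at h3
    simp only [T, hJ20, Prod.snd_neg]
    linarith
  -- Cartan's formula in coordinates: `dκ = 0` on the triple `∂_r`, `a`, `b`. The vector `J' (0, 1)
  -- a + j (0, a.2) - (0, (j a).2)` is `(L_X J) a`, as `X` has derivative `a ↦ (0, a.2)`.
  have hT2 : ∀ a b, T a b = 2 * κ (y₀, 1) ![a, b] + (g y₀ (J' (0, 1) a + j (0, a.2) - (0, (j a).2)).1
      b.1 + (J' (0, 1) a + j (0, a.2) - (0, (j a).2)).2 * b.2) := by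
    intro a b
    have h1 := extDeriv_two_apply hκ (0, 1) a b
    rw [hdκ, hD2, hD1, hD1] at h1
    have h2 := hκJ0 (0, a.2) b
    have h3 := hκJ0 a (0, b.2)
    have h3' := alternating_two_swap (κ (y₀, 1)) (0, b.2) a
    have h4 := hκJ0 a b
    have h5 : (0 : (E × ℝ) [⋀^Fin 3]→L[ℝ] ℝ) ![(0, 1), a, b] = 0 := rfl
    rw [h5] at h1
    simp only [one_pow, one_mul, map_zero, zero_add] at h2 h3 h4
    simp only [T, Prod.fst_sub, Prod.fst_add, Prod.snd_sub, Prod.snd_add, map_add, map_sub,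
      add_apply, sub_apply, map_zero,
      zero_apply]
    linarith
  have hκinv : ∀ a b, κ (y₀, 1) ![j a, j b] = κ (y₀, 1) ![a, b] := by
    intro a b
    rw [hκJ0, hκJ0]
    have := hiso (j a) b
    simp only [one_pow, one_mul]
    exact hiso (j a) b
  -- The Lie derivative of `J² = -1`: the endomorphism `L_X J` anticommutes with `J`.
  have hanti : ∀ a, (J' (0, 1) (j a) + j (0, (j a).2) - (0, (j (j a)).2))
      = - j (J' (0, 1) a + j (0, a.2) - (0, (j a).2)) := by
    intro a
    rw [map_sub, map_add, hJ20, hJ20, hJJ]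
    have : ((0 : E), (-a).2) = - ((0 : E), a.2) := by simp
    rw [this]
    abel
  have hT0 : ∀ a b, T a b = 2 * κ (y₀, 1) ![a, b] := by
    intro a b
    have h1 := hT2 (j a) (j b)
    rw [hTJ, hκinv, hanti] at h1
    have h2 := hiso (J' (0, 1) a + j (0, a.2) - (0, (j a).2)) b
    have h3 := hT2 a b
    simp only [Prod.fst_neg, Prod.snd_neg, map_neg, neg_apply] at h1
    linarith
  have hθu : ∀ u v : E, fderiv ℝ (fun y => θ y ![v]) y₀ u = - (J' (u, 0) (v, 0)).2 := by
    intro u v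
    have h1 : HasFDerivAt (fun y : E => κ (y, 1) ![(0, 1), (v, 0)])
        ((fderiv ℝ (fun q => κ q ![(0, 1), (v, 0)]) (y₀, 1)).comp
          (ContinuousLinearMap.inl ℝ E ℝ)) y₀ := by
      have hκd : DifferentiableAt ℝ (fun q => κ q ![(0, 1), (v, 0)]) (y₀, (1 : ℝ)) :=
        (hasFDerivAt_alternating_apply hκ.hasFDerivAt _).differentiableAt
      exact HasFDerivAt.comp (f := fun y : E => ((y, 1) : E × ℝ)) y₀ hκd.hasFDerivAt
        (hasFDerivAt_prodMk_left y₀ 1)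
    have h2 : (fun y => θ y ![v]) =ᶠ[𝓝 y₀] fun y : E => κ (y, 1) ![(0, 1), (v, 0)] :=
      hθκ.mono fun y hy => hy v
    rw [h2.fderiv_eq, h1.fderiv]
    have h3 := hD1 (u, 0) (v, 0)
    have h4 : κ (y₀, 1) ![((0 : E), (0 : ℝ)), (v, 0)] = 0 :=
      (κ (y₀, 1)).map_coord_zero 0 rfl
    simp only [neg_zero, zero_mul, zero_sub, h4, sub_zero] at h3
    simpa using h3
  rw [extDeriv_one_apply hθd, hθu, hθu]
  have := hT0 (u, 0) (v, 0)
  simp only [T] at this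
  rw [← this]; ring

end ConeCore

/-! ### Vector fields and Lie brackets in charts -/

section VectorFields

variable {E : Type*} [NormedAddCommGroup E] [NormedSpace ℝ E]
  {H : Type*} [TopologicalSpace H] {I : ModelWithCorners ℝ E H}
  {M : Type*} [TopologicalSpace M] [ChartedSpace H M] [IsManifold I ∞ M]
  {E' : Type*} [NormedAddCommGroup E'] [NormedSpace ℝ E']
  {H' : Type*} [TopologicalSpace H'] {I' : ModelWithCorners ℝ E' H'}
  {N : Type*} [TopologicalSpace N] [ChartedSpace H' N]

theorem isManifold_one : IsManifold I 1 M := .of_le (n := ∞) (by simp)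

theorem trivializationAt_snd_eq_tderiv {x q : M} (hq : q ∈ (chartAt H x).source)
    (w : TangentSpace I q) : (trivializationAt E (TangentSpace I) x ⟨q, w⟩).2 =
      tderiv I 𝓘(ℝ, E) (extChartAt I x) q w := by
  have := isManifold_one (I := I) (M := M)
  have h := TangentBundle.continuousLinearMapAt_trivializationAt (I := I) hq
  have h2 : (trivializationAt E (TangentSpace I) x).continuousLinearMapAt ℝ q w =
      (trivializationAt E (TangentSpace I) x ⟨q, w⟩).2 := by
    rw [Bundle.Trivialization.continuousLinearMapAt_apply,
      Bundle.Trivialization.linearMapAt_apply]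
    exact if_pos hq
  rw [← h2, h]
  rfl

/-- A vector field along a map is smooth if and only if its chart expression is. -/
theorem contMDiffAt_tangentBundle_iff {f : N → M} {W : ∀ v, TangentSpace I (f v)} {v : N} :
    ContMDiffAt I' I.tangent ∞ (fun v => (⟨f v, W v⟩ : TangentBundle I M)) v ↔
      ContMDiffAt I' I ∞ f v ∧ ContMDiffAt I' 𝓘(ℝ, E) ∞
        (fun w => tderiv I 𝓘(ℝ, E) (extChartAt I (f v)) (f w) (W w)) v := by
  have := isManifold_one (I := I) (M := M)
  rw [Bundle.contMDiffAt_totalSpace]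
  refine and_congr_right fun hf => ?_
  refine Filter.EventuallyEq.contMDiffAt_iff ?_
  filter_upwards [hf.continuousAt.preimage_mem_nhds
    ((chartAt H (f v)).open_source.mem_nhds (mem_chart_source H (f v)))] with w hw
  exact trivializationAt_snd_eq_tderiv hw _

variable [I.Boundaryless]

/-- The constant field `a` in a chart, on the manifold. -/
theorem contMDiffAt_tderiv_apply {f : E' → M} {v : E'}
    (hf : ∀ᶠ w in 𝓝 v, ContMDiffAt 𝓘(ℝ, E') I ∞ f w) (a : E') :
    ContMDiffAt 𝓘(ℝ, E') I.tangent ∞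
      (fun w => (⟨f w, (tderiv 𝓘(ℝ, E') I f w a : E)⟩ : TangentBundle I M)) v := by
  have hv := hf.self_of_nhds
  refine contMDiffAt_tangentBundle_iff.2 ⟨hv, ?_⟩
  have hc := contDiffAt_extChartAt_comp hv (mem_extChartAt_source (f v))
  have h2 : ContDiffAt ℝ ∞ (fun w => fderiv ℝ (fun z => extChartAt I (f v) (f z)) w a) v :=
    (hc.fderiv_right (m := ∞) (by simp)).clm_apply contDiffAt_const
  refine (h2.congr_of_eventuallyEq ?_).contMDiffAt
  filter_upwards [hf, hv.continuousAt.preimage_mem_nhds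
    ((isOpen_extChartAt_source (I := I) (f v)).mem_nhds (mem_extChartAt_source (f v)))] with w hw hw'
  have h3 : MDifferentiableAt I 𝓘(ℝ, E) (extChartAt I (f v)) (f w) :=
    mdifferentiableAt_extChartAt (by rw [← extChartAt_source I]; exact hw')
  rw [← tderiv_eq_fderiv, tderiv_comp_apply w h3 (hw.mdifferentiableAt (by simp))]

theorem inverse_mfderivWithin_extChartAt_symm {x : M} {y : E}
    (hy : y ∈ (extChartAt I x).target) (w : TangentSpace I ((extChartAt I x).symm y)) :
    ((mfderivWithin 𝓘(ℝ, E) I (extChartAt I x).symm (range I) y).inverse w : E) =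
      tderiv I 𝓘(ℝ, E) (extChartAt I x) ((extChartAt I x).symm y) w := by
  have := isManifold_one (I := I) (M := M)
  have hinv := isInvertible_mfderivWithin_extChartAt_symm (I := I) hy
  have h1 : (mfderivWithin 𝓘(ℝ, E) I (extChartAt I x).symm (range I) y)
      (tderiv I 𝓘(ℝ, E) (extChartAt I x) ((extChartAt I x).symm y) w : E) = w := by
    rw [ModelWithCorners.range_eq_univ, mfderivWithin_univ]
    have h2 := (extChartAt I x).map_target hy
    have h3 := tderiv_symm_extChartAt h2 w
    rw [(extChartAt I x).right_inv hy] at h3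
    exact h3
  have h2 := ContinuousLinearMap.IsInvertible.inverse_apply_self hinv
    (tderiv I 𝓘(ℝ, E) (extChartAt I x) ((extChartAt I x).symm y) w : E)
  rw [h1] at h2
  exact h2

/-- The bracket at `x` is computed by pulling both fields back to the chart at `x` and returning
with the derivative of that chart, which is the identity at `x`. -/
theorem mlieBracket_eq_lieBracket_chart (U V : ∀ p : M, TangentSpace I p) (x : M) :
    (VectorField.mlieBracket I U V x : E) = VectorField.lieBracket ℝ
      (fun y => tderiv I 𝓘(ℝ, E) (extChartAt I x) ((extChartAt I x).symm y)
        (U ((extChartAt I x).symm y)))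
      (fun y => tderiv I 𝓘(ℝ, E) (extChartAt I x) ((extChartAt I x).symm y)
        (V ((extChartAt I x).symm y))) (extChartAt I x x) := by
  have h1 : ∀ W : ∀ p : M, TangentSpace I p,
      VectorField.mpullbackWithin 𝓘(ℝ, E) I (extChartAt I x).symm W (range I)
      =ᶠ[𝓝 (extChartAt I x x)] fun y => tderiv I 𝓘(ℝ, E) (extChartAt I x)
        ((extChartAt I x).symm y) (W ((extChartAt I x).symm y)) := by
    intro W
    filter_upwards [(isOpen_extChartAt_target (I := I) x).mem_nhds (mem_extChartAt_target x)]
      with y hy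
    exact inverse_mfderivWithin_extChartAt_symm hy _
  have h2 : (VectorField.mlieBracket I U V x : E) = (mfderiv I 𝓘(ℝ, E) (extChartAt I x) x).inverse
    ((VectorField.lieBracketWithin ℝ
      (VectorField.mpullbackWithin 𝓘(ℝ, E) I (extChartAt I x).symm U (range I))
      (VectorField.mpullbackWithin 𝓘(ℝ, E) I (extChartAt I x).symm V (range I))
      ((extChartAt I x).symm ⁻¹' univ ∩ range I)) ((extChartAt I x x))) := rfl
  have h3 : (mfderiv I 𝓘(ℝ, E) (extChartAt I x) x).inverse = ContinuousLinearMap.id ℝ E := by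
    have h4 := tderiv_extChartAt_self (I := I) x
    have h5 : ContinuousLinearMap.inverse (tderiv I 𝓘(ℝ, E) (extChartAt I x) x) =
      ContinuousLinearMap.id ℝ E := by rw [h4, ContinuousLinearMap.inverse_id]
    exact h5
  rw [h2, h3]
  have h6 := Filter.EventuallyEq.lieBracket_vectorField_eq (𝕜 := ℝ) (h1 U) (h1 V)
  have h7 : (extChartAt I x).symm ⁻¹' univ ∩ range I = univ := by
    simp [ModelWithCorners.range_eq_univ]
  rw [h7, ← h6]
  exact congrFun (VectorField.lieBracketWithin_univ (𝕜 := ℝ) (E := E)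
    (V := VectorField.mpullbackWithin 𝓘(ℝ, E) I (extChartAt I x).symm U (range I))
    (W := VectorField.mpullbackWithin 𝓘(ℝ, E) I (extChartAt I x).symm V (range I))) _

/-- A vector in the chart at `x` extends to a global field that is constant in the chart near
`x`. -/
theorem exists_contMDiff_vectorField [FiniteDimensional ℝ E] [T2Space M] (x : M) (a : E) :
    ∃ U : ∀ p : M, TangentSpace I p,
      ContMDiff I I.tangent ∞ (fun p => (⟨p, U p⟩ : TangentBundle I M)) ∧
      ∀ᶠ p in 𝓝 x, (U p : E) =
        tderiv 𝓘(ℝ, E) I (extChartAt I x).symm (extChartAt I x p) a := by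
  have := isManifold_one (I := I) (M := M)
  -- Integrability of `J` is a condition on globally smooth fields, so the local constant field has
  -- to be extended by zero with a bump function.
  obtain ⟨χ⟩ : Nonempty (SmoothBumpFunction I x) := inferInstance
  let W : ∀ p : M, TangentSpace I p := fun p =>
    (tderiv 𝓘(ℝ, E) I (extChartAt I x).symm (extChartAt I x p) a : E)
  have hW : ∀ p ∈ (chartAt H x).source,
      ContMDiffAt I I.tangent ∞ (fun p => (⟨p, W p⟩ : TangentBundle I M)) p := by
    intro p hp
    have hp' : p ∈ (extChartAt I x).source := by rwa [extChartAt_source]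
    have h0 : ContMDiffAt 𝓘(ℝ, E) I.tangent ∞ (fun y : E => (⟨(extChartAt I x).symm y,
        (tderiv 𝓘(ℝ, E) I (extChartAt I x).symm y a : E)⟩ : TangentBundle I M))
        (extChartAt I x p) := by
      refine contMDiffAt_tderiv_apply ?_ a
      filter_upwards [(isOpen_extChartAt_target (I := I) x).mem_nhds
        ((extChartAt I x).map_source hp')] with y hy
      exact contMDiffAt_extChartAt_symm x hy
    have h1 : ContMDiffAt I I.tangent ∞ (fun p => (⟨(extChartAt I x).symm (extChartAt I x p),
        (tderiv 𝓘(ℝ, E) I (extChartAt I x).symm (extChartAt I x p) a : E)⟩ :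
          TangentBundle I M)) p :=
      ContMDiffAt.comp p h0 (contMDiffAt_extChartAt' hp)
    refine h1.congr_of_eventuallyEq ?_
    filter_upwards [(chartAt H x).open_source.mem_nhds hp] with q hq
    have hq' : (extChartAt I x).symm (extChartAt I x q) = q :=
      (extChartAt I x).left_inv (by rwa [extChartAt_source])
    have key : ∀ (r : M) (_ : r = q) (w : E), (⟨q, w⟩ : TangentBundle I M) = ⟨r, w⟩ := by
      rintro r rfl w; rfl
    exact key _ hq' _
  refine ⟨fun p => χ p • W p, ?_, ?_⟩
  · intro p
    by_cases hp : p ∈ tsupport χ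
    · have hp' := χ.tsupport_subset_chartAt_source hp
      have hχ : ContMDiffAt I 𝓘(ℝ, ℝ) ∞ χ p := χ.contMDiffAt
      exact ContMDiffAt.smul_section hχ (hW p hp')
    · have h0 : ContMDiffAt I I.tangent ∞
          (fun p => (⟨p, (0 : TangentSpace I p)⟩ : TangentBundle I M)) p :=
        (Bundle.contMDiff_zeroSection ℝ (TangentSpace I : M → Type _)).contMDiffAt
      refine h0.congr_of_eventuallyEq ?_
      have := (isClosed_tsupport χ).isOpen_compl.mem_nhds hp
      filter_upwards [this] with q hq
      have : χ q = 0 := image_eq_zero_of_notMem_tsupport hq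
      simp [this]
  · filter_upwards [χ.eventuallyEq_one] with q hq
    have hq' : χ q = 1 := hq
    change χ q • W q = _
    rw [hq', one_smul]

end VectorFields

section ProdDerivative

variable {E : Type*} [NormedAddCommGroup E] [NormedSpace ℝ E]
  {H : Type*} [TopologicalSpace H] {I : ModelWithCorners ℝ E H}
  {M : Type*} [TopologicalSpace M] [ChartedSpace H M]
  {E' : Type*} [NormedAddCommGroup E'] [NormedSpace ℝ E']
  {H' : Type*} [TopologicalSpace H'] {I' : ModelWithCorners ℝ E' H'}
  {M' : Type*} [TopologicalSpace M'] [ChartedSpace H' M']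
  {F : Type*} [NormedAddCommGroup F] [NormedSpace ℝ F]
  {G : Type*} [TopologicalSpace G] {J : ModelWithCorners ℝ F G}
  {N : Type*} [TopologicalSpace N] [ChartedSpace G N]

theorem tderiv_prodMk {f : N → M} {g : N → M'} {x : N} (hf : MDifferentiableAt J I f x)
    (hg : MDifferentiableAt J I' g x) (u : F) :
    tderiv J (I.prod I') (fun y => (f y, g y)) x u = (tderiv J I f x u, tderiv J I' g x u) := by
  have h := hf.mfderiv_prod hg
  have h2 : tderiv J (I.prod I') (fun y => (f y, g y)) x =
    (tderiv J I f x).prod (tderiv J I' g x) := h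
  rw [h2]; rfl

end ProdDerivative

/-- A map into linear maps on a finite-dimensional space is smooth if its evaluations are. -/
theorem contDiffAt_clm_of_apply {D E F : Type*} [NormedAddCommGroup D] [NormedSpace ℝ D]
    [NormedAddCommGroup E] [NormedSpace ℝ E] [FiniteDimensional ℝ E]
    [NormedAddCommGroup F] [NormedSpace ℝ F] {n : ℕ∞ω} {f : D → E →L[ℝ] F} {x : D}
    (h : ∀ b, ContDiffAt ℝ n (fun y => f y b) x) : ContDiffAt ℝ n f x := by
  let e₁ := ContinuousLinearEquiv.ofFinrankEq (𝕜 := ℝ)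
    (Module.finrank_fin_fun ℝ (n := Module.finrank ℝ E)).symm
  let e₂ := (e₁.arrowCongr (1 : F ≃L[ℝ] F)).trans
    (ContinuousLinearEquiv.piRing (Fin (Module.finrank ℝ E)))
  rw [← Function.id_comp f, ← e₂.symm_comp_self]
  exact e₂.symm.contDiff.contDiffAt.comp x (contDiffAt_pi.2 fun i => h _)

/-! ### Charts of the half-line and of the cone -/

section PosRealChart

theorem extChartAt_posReal_apply (r q : PosReal) : extChartAt 𝓘(ℝ, ℝ) r q = (q : ℝ) := rfl

theorem extChartAt_posReal_source (r : PosReal) : (extChartAt 𝓘(ℝ, ℝ) r).source = univ := by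
  ext y
  simp [TopologicalSpace.Opens.chartAt_eq, mfld_simps]
  trivial

theorem extChartAt_posReal_target (r : PosReal) : (extChartAt 𝓘(ℝ, ℝ) r).target = Ioi 0 := by
  have h1 : (extChartAt 𝓘(ℝ, ℝ) r).target = range (fun q : PosReal => (q : ℝ)) := by
    ext y
    constructor
    · intro hy
      exact ⟨_, (extChartAt 𝓘(ℝ, ℝ) r).right_inv hy⟩
    · rintro ⟨q, rfl⟩
      exact (extChartAt 𝓘(ℝ, ℝ) r).map_source (by rw [extChartAt_posReal_source]; trivial)
  rw [h1]
  exact Subtype.range_coe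

theorem extChartAt_posReal_symm (r : PosReal) {y : ℝ} (hy : 0 < y) :
    (extChartAt 𝓘(ℝ, ℝ) r).symm y = (⟨y, hy⟩ : PosReal) := by
  have h1 : y ∈ (extChartAt 𝓘(ℝ, ℝ) r).target := by rw [extChartAt_posReal_target]; exact hy
  have := (extChartAt 𝓘(ℝ, ℝ) r).right_inv h1
  rw [extChartAt_posReal_apply] at this
  exact Subtype.ext this

theorem tderiv_posReal_symm (r : PosReal) {y : ℝ} (hy : 0 < y) :
    tderiv 𝓘(ℝ, ℝ) 𝓘(ℝ, ℝ) (extChartAt 𝓘(ℝ, ℝ) r).symm y = ContinuousLinearMap.id ℝ ℝ := by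
  have h1 : y ∈ (extChartAt 𝓘(ℝ, ℝ) r).target := by rw [extChartAt_posReal_target]; exact hy
  ext
  have h2 := tderiv_extChartAt_symm h1 (1 : ℝ)
  have h3 : tderiv 𝓘(ℝ, ℝ) 𝓘(ℝ, ℝ) (extChartAt 𝓘(ℝ, ℝ) r) ((extChartAt 𝓘(ℝ, ℝ) r).symm y) =
      ContinuousLinearMap.id ℝ ℝ :=
    tderiv_extChartAt_self (I := 𝓘(ℝ, ℝ)) ((extChartAt 𝓘(ℝ, ℝ) r).symm y)
  rw [h3] at h2
  exact h2

end PosRealChart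

/-- The model space of a 7-manifold. -/
abbrev E7 := EuclideanSpace ℝ (Fin 7)

section ConeChart

variable {S : Type*} [TopologicalSpace S] [ChartedSpace E7 S] [IsManifold (𝓡 7) ∞ S]

theorem cone_symm_apply (x : S) (r : PosReal) (y : E7) {t : ℝ} (ht : 0 < t) :
    (extChartAt ConeModel ((x, r) : Cone S)).symm (y, t) =
      ((extChartAt (𝓡 7) x).symm y, (⟨t, ht⟩ : PosReal)) := by
  rw [extChartAt_prod]
  exact Prod.ext rfl (extChartAt_posReal_symm r ht)

theorem cone_mem_target (x : S) (r : PosReal) {y : E7} {t : ℝ} :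
    (y, t) ∈ (extChartAt ConeModel ((x, r) : Cone S)).target ↔
      y ∈ (extChartAt (𝓡 7) x).target ∧ 0 < t := by
  rw [extChartAt_prod, PartialEquiv.prod_target, extChartAt_posReal_target]
  rfl

theorem tderiv_cone_symm (x : S) (r : PosReal) {y : E7} {t : ℝ}
    (h : (y, t) ∈ (extChartAt ConeModel ((x, r) : Cone S)).target) (u : E7 × ℝ) :
    tderiv 𝓘(ℝ, E7 × ℝ) ConeModel (extChartAt ConeModel ((x, r) : Cone S)).symm (y, t) u =
      (tderiv 𝓘(ℝ, E7) (𝓡 7) (extChartAt (𝓡 7) x).symm y u.1, u.2) := by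
  rw [cone_mem_target] at h
  have h1 : MDifferentiableAt 𝓘(ℝ, E7) (𝓡 7) (extChartAt (𝓡 7) x).symm y :=
    (contMDiffAt_extChartAt_symm x h.1).mdifferentiableAt (by simp)
  have h2 : MDifferentiableAt 𝓘(ℝ, ℝ) 𝓘(ℝ, ℝ) (extChartAt 𝓘(ℝ, ℝ) r).symm t :=
    (contMDiffAt_extChartAt_symm r
      (by rw [extChartAt_posReal_target]; exact h.2)).mdifferentiableAt (by simp)
  have h3 : (extChartAt ConeModel ((x, r) : Cone S)).symm =
      fun q : E7 × ℝ => ((extChartAt (𝓡 7) x).symm q.1, (extChartAt 𝓘(ℝ, ℝ) r).symm q.2) := by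
    rw [extChartAt_prod]; rfl
  have hfst : MDifferentiableAt 𝓘(ℝ, E7 × ℝ) 𝓘(ℝ, E7) (Prod.fst : E7 × ℝ → E7) (y, t) :=
    differentiableAt_fst.mdifferentiableAt
  have hsnd : MDifferentiableAt 𝓘(ℝ, E7 × ℝ) 𝓘(ℝ, ℝ) (Prod.snd : E7 × ℝ → ℝ) (y, t) :=
    differentiableAt_snd.mdifferentiableAt
  have h6 := tderiv_prodMk (J := 𝓘(ℝ, E7 × ℝ)) (f := fun q : E7 × ℝ => (extChartAt (𝓡 7) x).symm q.1)
    (g := fun q : E7 × ℝ => (extChartAt 𝓘(ℝ, ℝ) r).symm q.2)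
    (MDifferentiableAt.comp (y, t) (f := Prod.fst) h1 hfst)
    (MDifferentiableAt.comp (y, t) (f := Prod.snd) h2 hsnd) u
  rw [h3]
  refine Eq.trans h6 ?_
  have h4 := tderiv_comp_apply (y, t) (f := (Prod.fst : E7 × ℝ → E7)) h1 hfst u
  have h5 := tderiv_comp_apply (y, t) (f := (Prod.snd : E7 × ℝ → ℝ)) h2 hsnd u
  rw [tderiv_eq_fderiv, fderiv_fst] at h4
  rw [tderiv_eq_fderiv, fderiv_snd, tderiv_posReal_symm r h.2] at h5
  exact Prod.ext h4 h5

end ConeChart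

/-! ### The structures of the cone in a chart, and `dη = 2Ω` on `S` -/

namespace SasakiEinstein

noncomputable section

variable {S : Type*} [TopologicalSpace S] [ChartedSpace E7 S] [IsManifold (𝓡 7) ∞ S]
  (s : SasakiEinstein S)

/-- The metric, on the model space. -/
def gAt (x : S) : E7 →L[ℝ] E7 →L[ℝ] ℝ := s.g.inner x

/-- The complex structure of the cone, on the model space. -/
def JAt (p : Cone S) : (E7 × ℝ) →L[ℝ] (E7 × ℝ) := s.J p

/-- The metric of the cone, on the model space. -/
def coneAt (p : Cone S) (u v : E7 × ℝ) : ℝ :=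
  (p.2 : ℝ) ^ 2 * s.gAt p.1 u.1 v.1 + u.2 * v.2

theorem JAt_sq (p : Cone S) (v : E7 × ℝ) : s.JAt p (s.JAt p v) = -v := s.J_sq p v

theorem JAt_isometry (p : Cone S) (u v : E7 × ℝ) :
    s.coneAt p (s.JAt p u) (s.JAt p v) = s.coneAt p u v := s.J_isometry p u v

theorem coneAt_neg_left (p : Cone S) (u v : E7 × ℝ) : s.coneAt p (-u) v = - s.coneAt p u v := by
  simp [coneAt]; ring

theorem coneAt_JAt_left (p : Cone S) (u v : E7 × ℝ) :
    s.coneAt p (s.JAt p u) v = - s.coneAt p u (s.JAt p v) := by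
  rw [← s.JAt_isometry p (s.JAt p u) v, JAt_sq, coneAt_neg_left]

theorem gAt_symm (x : S) (u v : E7) : s.gAt x u v = s.gAt x v u := s.g.symm x u v

theorem gAt_pos (x : S) {u : E7} (hu : u ≠ 0) : 0 < s.gAt x u u := s.g.pos x u hu

theorem kahlerForm_formAt (p : Cone S) (u v : E7 × ℝ) :
    formAt s.kahlerForm p ![u, v] = s.coneAt p (s.JAt p u) v := s.kahlerForm_apply p u v

/-- `J` is skew for the cone metric, so `J ∂_r` is orthogonal to `∂_r` and has no radial component.
-/
theorem JAt_radial (x : S) : s.JAt (x, PosReal.one) (0, 1) = (s.reeb x, 0) := by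
  refine Prod.ext rfl ?_
  have h := s.coneAt_JAt_left (x, PosReal.one) (0, 1) (0, 1)
  have h2 : ∀ w : E7 × ℝ, s.coneAt (x, PosReal.one) w (0, 1) = w.2 := by
    intro w; simp [coneAt]
  have h3 : ∀ w : E7 × ℝ, s.coneAt (x, PosReal.one) (0, 1) w = w.2 := by
    intro w; simp [coneAt]
  rw [h2, h3] at h
  change (s.JAt (x, PosReal.one) (0, 1)).2 = 0
  linarith

theorem contactForm_formAt (x : S) (u : E7) : formAt s.contactForm x ![u] =
    s.gAt x (s.reeb x) u := rfl

/-- The complex structure of the cone in the chart at `x`. -/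
def chartJ (x : S) (q : E7 × ℝ) : (E7 × ℝ) →L[ℝ] (E7 × ℝ) :=
  let C := extChartAt ConeModel ((x, PosReal.one) : Cone S)
  (tderiv ConeModel 𝓘(ℝ, E7 × ℝ) C (C.symm q)).comp
    ((s.JAt (C.symm q)).comp (tderiv 𝓘(ℝ, E7 × ℝ) ConeModel C.symm q))

theorem contDiffAt_chartJ (x : S) : ContDiffAt ℝ ∞ (s.chartJ x) (extChartAt (𝓡 7) x x, 1) := by
  set C := extChartAt ConeModel ((x, PosReal.one) : Cone S) with hC
  have hC0 : C (x, PosReal.one) = (extChartAt (𝓡 7) x x, 1) := by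
    rw [hC, extChartAt_prod]; rfl
  rw [← hC0]
  have hopen : IsOpen C.target := isOpen_extChartAt_target _
  have hmem : C (x, PosReal.one) ∈ C.target := mem_extChartAt_target _
  have hleft : C.symm (C (x, PosReal.one)) = (x, PosReal.one) := extChartAt_to_inv _
  refine contDiffAt_clm_of_apply fun b => ?_
  have h1 : ContMDiffAt 𝓘(ℝ, E7 × ℝ) ConeModel.tangent ∞ (fun q => (⟨C.symm q,
      (tderiv 𝓘(ℝ, E7 × ℝ) ConeModel C.symm q b : E7 × ℝ)⟩ : TangentBundle ConeModel (Cone S)))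
      (C (x, PosReal.one)) := by
    refine contMDiffAt_tderiv_apply ?_ b
    filter_upwards [hopen.mem_nhds hmem] with y hy
    exact contMDiffAt_extChartAt_symm _ hy
  have h2 := s.J_smooth.contMDiffAt.comp (C (x, PosReal.one))
    (contMDiffAt_extChartAt_symm _ hmem)
  have h3 := ContMDiffAt.clm_bundle_apply h2 h1
  have h4 := (contMDiffAt_tangentBundle_iff.1 h3).2
  rw [contMDiffAt_iff_contDiffAt, hleft] at h4
  exact h4

end

end SasakiEinstein

section PullbackApply

variable {E : Type*} [NormedAddCommGroup E] [NormedSpace ℝ E]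
  {H : Type*} [TopologicalSpace H] {I : ModelWithCorners ℝ E H}
  {M : Type*} [TopologicalSpace M] [ChartedSpace H M]
  {F : Type*} [NormedAddCommGroup F] [NormedSpace ℝ F]
  {V : Type*} [NormedAddCommGroup V] [NormedSpace ℝ V]

theorem pullbackForm_one (f : V → M) (α : DiffForm I M 1 F) (v a : V) :
    pullbackForm f α v ![a] = formAt α (f v) ![tderiv 𝓘(ℝ, V) I f v a] := by
  rw [pullbackForm, ContinuousAlternatingMap.compContinuousLinearMap_apply]
  congr 1
  ext i; fin_cases i; rfl

theorem pullbackForm_two (f : V → M) (α : DiffForm I M 2 F) (v a b : V) :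
    pullbackForm f α v ![a, b] =
      formAt α (f v) ![tderiv 𝓘(ℝ, V) I f v a, tderiv 𝓘(ℝ, V) I f v b] := by
  rw [pullbackForm, ContinuousAlternatingMap.compContinuousLinearMap_apply]
  congr 1
  ext i; fin_cases i <;> rfl

end PullbackApply

namespace SasakiEinstein

noncomputable section

variable {S : Type*} [TopologicalSpace S] [ChartedSpace E7 S] [IsManifold (𝓡 7) ∞ S]
  (s : SasakiEinstein S)

/-- The Kähler form of the cone in the chart at `x`. -/
def chartKahler (x : S) (q : E7 × ℝ) : (E7 × ℝ) [⋀^Fin 2]→L[ℝ] ℝ :=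
  formInChart s.kahlerForm ((x, PosReal.one) : Cone S) q

theorem chartKahler_apply (x : S) (q a b : E7 × ℝ) : s.chartKahler x q ![a, b] =
    s.coneAt ((extChartAt ConeModel ((x, PosReal.one) : Cone S)).symm q)
      (s.JAt ((extChartAt ConeModel ((x, PosReal.one) : Cone S)).symm q)
        (tderiv 𝓘(ℝ, E7 × ℝ) ConeModel (extChartAt ConeModel ((x, PosReal.one) : Cone S)).symm q a))
      (tderiv 𝓘(ℝ, E7 × ℝ) ConeModel
        (extChartAt ConeModel ((x, PosReal.one) : Cone S)).symm q b) := by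
  rw [← kahlerForm_formAt, chartKahler, formInChart_eq, pullbackForm_two]

theorem contDiffOn_chartKahler (x : S) : ContDiffOn ℝ ∞ (s.chartKahler x)
    (extChartAt ConeModel ((x, PosReal.one) : Cone S)).target := s.kahlerForm_smooth _

theorem tderiv_cone_symm_chartJ (x : S) {q : E7 × ℝ}
    (hq : q ∈ (extChartAt ConeModel ((x, PosReal.one) : Cone S)).target) (a : E7 × ℝ) :
    tderiv 𝓘(ℝ, E7 × ℝ) ConeModel (extChartAt ConeModel ((x, PosReal.one) : Cone S)).symm q
      (s.chartJ x q a) = s.JAt ((extChartAt ConeModel ((x, PosReal.one) : Cone S)).symm q)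
        (tderiv 𝓘(ℝ, E7 × ℝ) ConeModel
          (extChartAt ConeModel ((x, PosReal.one) : Cone S)).symm q a) := by
  have h := tderiv_symm_extChartAt (I := ConeModel)
    ((extChartAt ConeModel ((x, PosReal.one) : Cone S)).map_target hq)
    (s.JAt ((extChartAt ConeModel ((x, PosReal.one) : Cone S)).symm q)
        (tderiv 𝓘(ℝ, E7 × ℝ) ConeModel
          (extChartAt ConeModel ((x, PosReal.one) : Cone S)).symm q a))
  rw [(extChartAt ConeModel ((x, PosReal.one) : Cone S)).right_inv hq] at h
  exact h

theorem chartJ_sq (x : S) {q : E7 × ℝ}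
    (hq : q ∈ (extChartAt ConeModel ((x, PosReal.one) : Cone S)).target) (a : E7 × ℝ) :
    s.chartJ x q (s.chartJ x q a) = - a := by
  have h := s.tderiv_cone_symm_chartJ x hq a
  have h1 : s.chartJ x q (s.chartJ x q a) = tderiv ConeModel 𝓘(ℝ, E7 × ℝ)
    (extChartAt ConeModel ((x, PosReal.one) : Cone S))
      ((extChartAt ConeModel ((x, PosReal.one) : Cone S)).symm q)
    (s.JAt ((extChartAt ConeModel ((x, PosReal.one) : Cone S)).symm q)
      (tderiv 𝓘(ℝ, E7 × ℝ) ConeModel (extChartAt ConeModel ((x, PosReal.one) : Cone S)).symm q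
        (s.chartJ x q a))) := rfl
  rw [h1, h, JAt_sq, map_neg, tderiv_extChartAt_symm hq]

theorem contactForm_pullback (y : S) (u : E7) : formAt s.contactForm y ![u] =
    s.coneAt (y, PosReal.one) (s.JAt (y, PosReal.one) (0, 1)) (u, 0) := by
  rw [contactForm_formAt, JAt_radial]
  simp [coneAt]

/-- `η` is the restriction of `ι_{∂_r} κ` to `r = 1`. This yields smoothness of `η` from that of the
Kähler form, and puts `η` in the form needed for the computation on the cone. -/
theorem chartContact_apply (x : S) {y : E7} (hy : y ∈ (extChartAt (𝓡 7) x).target) (u : E7) :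
    pullbackForm (extChartAt (𝓡 7) x).symm s.contactForm y ![u] =
      s.chartKahler x (y, 1) ![(0, 1), (u, 0)] := by
  have hq : (y, (1 : ℝ)) ∈ (extChartAt ConeModel ((x, PosReal.one) : Cone S)).target :=
    (cone_mem_target x _).2 ⟨hy, one_pos⟩
  rw [chartKahler_apply, tderiv_cone_symm x _ hq, tderiv_cone_symm x _ hq,
    cone_symm_apply x _ y one_pos]
  rw [pullbackForm_one, s.contactForm_pullback]
  simp only [map_zero]

theorem contactForm_smooth : IsSmoothForm s.contactForm := by
  intro x
  rw [formInChart_eq]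
  refine contDiffOn_alternating fun v => ?_
  have h1 : ContDiffOn ℝ ∞ (fun y : E7 => s.chartKahler x (y, 1) ![(0, 1), (v 0, 0)])
      (extChartAt (𝓡 7) x).target := by
    have h2 : ContDiffOn ℝ ∞ (fun y : E7 => s.chartKahler x (y, 1)) (extChartAt (𝓡 7) x).target :=
      (s.contDiffOn_chartKahler x).comp (contDiff_id.prodMk contDiff_const).contDiffOn
        fun y hy => (cone_mem_target x _).2 ⟨hy, one_pos⟩
    exact (ContinuousAlternatingMap.apply ℝ (E7 × ℝ) ℝ ![(0, 1), (v 0, 0)]).contDiff.comp_contDiffOn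
      h2
  refine h1.congr fun y hy => ?_
  rw [← s.chartContact_apply x hy]
  congr 1
  ext i; fin_cases i; rfl

/-- The Nijenhuis tensor is evaluated on fields that are constant in the chart near the point. The
bracket of the two constant fields is zero, and the other three brackets are derivatives of the
matrix of `J`. -/
theorem chartJ_integrable [T2Space S] (x : S) (a b : E7 × ℝ) :
    let y := (extChartAt (𝓡 7) x x, (1 : ℝ))
    fderiv ℝ (s.chartJ x) y (s.chartJ x y a) b - fderiv ℝ (s.chartJ x) y (s.chartJ x y b) a
      + s.chartJ x y (fderiv ℝ (s.chartJ x) y b a)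
      - s.chartJ x y (fderiv ℝ (s.chartJ x) y a b) = 0 := by
  intro y
  have hC0 : extChartAt ConeModel ((x, PosReal.one) : Cone S) (x, PosReal.one) = y := by
    rw [extChartAt_prod]; rfl
  have hJd : HasFDerivAt (s.chartJ x) (fderiv ℝ (s.chartJ x) y) y :=
    ((s.contDiffAt_chartJ x).differentiableAt (by simp)).hasFDerivAt
  have hJapp : ∀ b, HasFDerivAt (fun q => s.chartJ x q b) ((fderiv ℝ (s.chartJ x) y).flip b) y :=
    fun b => by
      have := hJd.clm_apply (hasFDerivAt_const b y)
      refine this.congr_fderiv ?_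
      ext <;> simp
  obtain ⟨U, hU, hUa⟩ := exists_contMDiff_vectorField (I := ConeModel)
    ((x, PosReal.one) : Cone S) a
  obtain ⟨V, hV, hVb⟩ := exists_contMDiff_vectorField (I := ConeModel)
    ((x, PosReal.one) : Cone S) b
  have h := s.J_integrable U V hU hV (x, PosReal.one)
  set C := extChartAt ConeModel ((x, PosReal.one) : Cone S) with hC
  have hmem : y ∈ C.target := hC0 ▸ mem_extChartAt_target (I := ConeModel) _
  have hleft : C.symm y = (x, PosReal.one) := hC0 ▸ extChartAt_to_inv (I := ConeModel) _
  have hev : ∀ {P : Cone S → Prop}, (∀ᶠ p in 𝓝 ((x, PosReal.one) : Cone S), P p) →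
      ∀ᶠ q in 𝓝 y, P (C.symm q) ∧ q ∈ C.target := by
    intro P hP
    have hc : ContinuousAt C.symm y := (contMDiffAt_extChartAt_symm (I := ConeModel) _ hmem).continuousAt
    refine (hc.tendsto.eventually (hleft ▸ hP)).and ((isOpen_extChartAt_target _).mem_nhds hmem)
  have hconst : ∀ (U : ∀ p : Cone S, TangentSpace ConeModel p) (a : E7 × ℝ),
      (∀ᶠ p in 𝓝 ((x, PosReal.one) : Cone S), (U p : E7 × ℝ) =
        tderiv 𝓘(ℝ, E7 × ℝ) ConeModel C.symm (C p) a) →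
      ((fun q => tderiv ConeModel 𝓘(ℝ, E7 × ℝ) C (C.symm q) (U (C.symm q))) =ᶠ[𝓝 y] fun _ => a) ∧
      ((fun q => tderiv ConeModel 𝓘(ℝ, E7 × ℝ) C (C.symm q)
        (s.J (C.symm q) (U (C.symm q)))) =ᶠ[𝓝 y] fun q => s.chartJ x q a) := by
    intro U a hU
    constructor
    · filter_upwards [hev hU] with q hq
      have h1 := hq.1
      rw [C.right_inv hq.2] at h1
      rw [h1]
      exact tderiv_extChartAt_symm hq.2 a
    · filter_upwards [hev hU] with q hq
      have h1 := hq.1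
      rw [C.right_inv hq.2] at h1
      rw [h1]
      rfl
  have hU2 := hconst U a hUa
  have hV2 := hconst V b hVb
  have e1 : (VectorField.mlieBracket ConeModel (fun q => s.J q (U q)) (fun q => s.J q (V q))
      (x, PosReal.one) : E7 × ℝ) = fderiv ℝ (s.chartJ x) y (s.chartJ x y a) b
        - fderiv ℝ (s.chartJ x) y (s.chartJ x y b) a := by
    rw [mlieBracket_eq_lieBracket_chart, ← hC, hC0]
    refine (hU2.2.lieBracket_vectorField_eq hV2.2).trans ?_
    rw [VectorField.lieBracket, (hJapp _).fderiv, (hJapp _).fderiv]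
    rfl
  have e2 : (VectorField.mlieBracket ConeModel (fun q => s.J q (U q)) V
      (x, PosReal.one) : E7 × ℝ) = - fderiv ℝ (s.chartJ x) y b a := by
    rw [mlieBracket_eq_lieBracket_chart, ← hC, hC0]
    refine (hU2.2.lieBracket_vectorField_eq hV2.1).trans ?_
    rw [VectorField.lieBracket, (hJapp _).fderiv]
    simp
  have e3 : (VectorField.mlieBracket ConeModel U (fun q => s.J q (V q))
      (x, PosReal.one) : E7 × ℝ) = fderiv ℝ (s.chartJ x) y a b := by
    rw [mlieBracket_eq_lieBracket_chart, ← hC, hC0]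
    refine (hU2.1.lieBracket_vectorField_eq hV2.2).trans ?_
    rw [VectorField.lieBracket, (hJapp _).fderiv]
    simp
  have e4 : (VectorField.mlieBracket ConeModel U V (x, PosReal.one) : E7 × ℝ) = 0 := by
    rw [mlieBracket_eq_lieBracket_chart, ← hC, hC0]
    refine (hU2.1.lieBracket_vectorField_eq hV2.1).trans ?_
    rw [VectorField.lieBracket]
    simp
    rfl
  have hJy : ∀ a, s.chartJ x y a = s.JAt (x, PosReal.one) a := by
    intro a
    have h1 : tderiv ConeModel 𝓘(ℝ, E7 × ℝ) C (x, PosReal.one) = ContinuousLinearMap.id ℝ _ :=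
      tderiv_extChartAt_self (I := ConeModel) _
    have h2 : ∀ a, tderiv 𝓘(ℝ, E7 × ℝ) ConeModel C.symm y a = a := by
      intro a
      have := tderiv_extChartAt_symm (I := ConeModel) hmem a
      rw [← hC, hleft, h1] at this
      exact this
    have h3 : s.chartJ x y a = tderiv ConeModel 𝓘(ℝ, E7 × ℝ) C (C.symm y) (s.JAt (C.symm y)
      (tderiv 𝓘(ℝ, E7 × ℝ) ConeModel C.symm y a)) := rfl
    rw [h3, h2, hleft, h1]
    rfl
  have h' : ∀ w₁ w₂ w₃ w₄ : E7 × ℝ,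
      (VectorField.mlieBracket ConeModel (fun q => s.J q (U q)) (fun q => s.J q (V q))
        (x, PosReal.one) : E7 × ℝ) = w₁ →
      (VectorField.mlieBracket ConeModel (fun q => s.J q (U q)) V (x, PosReal.one) : E7 × ℝ)
        = w₂ →
      (VectorField.mlieBracket ConeModel U (fun q => s.J q (V q)) (x, PosReal.one) : E7 × ℝ)
        = w₃ →
      (VectorField.mlieBracket ConeModel U V (x, PosReal.one) : E7 × ℝ) = w₄ →
      w₁ - s.JAt (x, PosReal.one) w₂ - s.JAt (x, PosReal.one) w₃ - w₄ = 0 := by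
    rintro _ _ _ _ rfl rfl rfl rfl
    exact h
  have h' := h' _ _ _ (0 : E7 × ℝ) e1 e2 e3 e4
  rw [← hJy, ← hJy, map_neg, sub_zero, sub_neg_eq_add] at h'
  exact h'

theorem extDeriv_chartContact [T2Space S] (x : S) (u v : E7) :
    extDeriv (pullbackForm (extChartAt (𝓡 7) x).symm s.contactForm) (extChartAt (𝓡 7) x x) ![u, v] =
      2 * s.chartKahler x (extChartAt (𝓡 7) x x, 1) ![(u, 0), (v, 0)] := by
  set y := extChartAt (𝓡 7) x x with hy
  set C := extChartAt ConeModel ((x, PosReal.one) : Cone S) with hC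
  have hC0 : C (x, PosReal.one) = (y, 1) := by
    rw [hC, extChartAt_prod]; rfl
  have hyt : y ∈ (extChartAt (𝓡 7) x).target := mem_extChartAt_target x
  have hmem : (y, (1 : ℝ)) ∈ C.target := hC0 ▸ mem_extChartAt_target (I := ConeModel) _
  have hnhds : ∀ᶠ q in 𝓝 (y, (1 : ℝ)), q ∈ C.target :=
    (isOpen_extChartAt_target _).mem_nhds hmem
  let g : E7 → E7 →L[ℝ] E7 →L[ℝ] ℝ := fun z =>
    (s.gAt ((extChartAt (𝓡 7) x).symm z)).bilinearComp
      (tderiv 𝓘(ℝ, E7) (𝓡 7) (extChartAt (𝓡 7) x).symm z)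
      (tderiv 𝓘(ℝ, E7) (𝓡 7) (extChartAt (𝓡 7) x).symm z)
  have hcone : ∀ q ∈ C.target, ∀ a b, s.coneAt (C.symm q)
      (tderiv 𝓘(ℝ, E7 × ℝ) ConeModel C.symm q a) (tderiv 𝓘(ℝ, E7 × ℝ) ConeModel C.symm q b)
      = q.2 ^ 2 * g q.1 a.1 b.1 + a.2 * b.2 := by
    rintro ⟨z, t⟩ hq a b
    have ht := ((cone_mem_target x _).1 hq).2
    rw [tderiv_cone_symm x _ hq, tderiv_cone_symm x _ hq, hC, cone_symm_apply x _ z ht]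
    rfl
  have hκJ : ∀ q ∈ C.target, ∀ a b, s.chartKahler x q ![a, b] =
      q.2 ^ 2 * g q.1 (s.chartJ x q a).1 b.1 + (s.chartJ x q a).2 * b.2 := by
    intro q hq a b
    rw [chartKahler_apply, ← s.tderiv_cone_symm_chartJ x hq, ← hC, hcone q hq]
  refine extDeriv_contact_of_kahlerCone (J := s.chartJ x) (g := g)
    ((s.contDiffAt_chartJ x).differentiableAt (by simp)).hasFDerivAt
    (((s.contDiffOn_chartKahler x).contDiffAt hnhds).differentiableAt (by simp))
    (hnhds.mono hκJ) ?_ (hnhds.mono fun q hq a => s.chartJ_sq x hq a) ?_ (s.chartJ_integrable x)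
    ?_ ?_ ?_ u v
  · filter_upwards [hnhds] with q hq b
    rw [chartKahler_apply, coneAt_JAt_left, ← s.tderiv_cone_symm_chartJ x hq, ← hC, hcone q hq]
    simp
  · intro a b
    have h1 := s.JAt_isometry (C.symm (y, 1)) (tderiv 𝓘(ℝ, E7 × ℝ) ConeModel C.symm (y, 1) a)
      (tderiv 𝓘(ℝ, E7 × ℝ) ConeModel C.symm (y, 1) b)
    rw [← s.tderiv_cone_symm_chartJ x hmem, ← s.tderiv_cone_symm_chartJ x hmem, ← hC,
      hcone _ hmem, hcone _ hmem] at h1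
    simp only [one_pow, one_mul] at h1
    exact h1
  · have h1 : formAt (extDerivative s.kahlerForm) ((x, PosReal.one) : Cone S) =
        (extDeriv (s.chartKahler x) (C (x, PosReal.one))).compContinuousLinearMap
          (tderiv ConeModel 𝓘(ℝ, E7 × ℝ) C (x, PosReal.one)) := rfl
    have h2 : tderiv ConeModel 𝓘(ℝ, E7 × ℝ) C (x, PosReal.one) = ContinuousLinearMap.id ℝ _ :=
      tderiv_extChartAt_self (I := ConeModel) _
    rw [h2, hC0, s.kahlerForm_closed] at h1
    exact h1.symm
  · exact ((s.contactForm_smooth x).contDiffAt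
      ((isOpen_extChartAt_target x).mem_nhds hyt)).differentiableAt (by simp)
  · filter_upwards [(isOpen_extChartAt_target x).mem_nhds hyt] with z hz w
    exact s.chartContact_apply x hz w

/-- The exterior derivative of the contact form is twice the horizontal Kähler form. -/
theorem extDerivative_contactForm [T2Space S] (x : S) (u v : E7) :
    formAt (extDerivative s.contactForm) x ![u, v] = 2 * s.horizontalKahlerForm x u v := by
  set c := extChartAt (𝓡 7) x with hc
  have h1 : formAt (extDerivative s.contactForm) x =
        (extDeriv (pullbackForm c.symm s.contactForm) (c x)).compContinuousLinearMap
          (tderiv (𝓡 7) 𝓘(ℝ, E7) c x) := rfl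
  have h2 : tderiv (𝓡 7) 𝓘(ℝ, E7) c x = ContinuousLinearMap.id ℝ _ :=
      tderiv_extChartAt_self (I := 𝓡 7) _
  have h3 : formAt (extDerivative s.contactForm) x ![u, v] =
      extDeriv (pullbackForm c.symm s.contactForm) (c x) ![u, v] := by
    rw [h1, h2]; rfl
  rw [h3, hc, s.extDeriv_chartContact x u v, chartKahler_apply]
  have hmem : (c x, (1 : ℝ)) ∈ (extChartAt ConeModel ((x, PosReal.one) : Cone S)).target :=
    (cone_mem_target x _).2 ⟨mem_extChartAt_target x, one_pos⟩
  have h4 : ∀ u, tderiv 𝓘(ℝ, E7) (𝓡 7) c.symm (c x) u = u := by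
    intro u
    have := tderiv_symm_extChartAt (I := 𝓡 7) (mem_extChartAt_source (I := 𝓡 7) x) u
    rw [← hc, h2] at this
    exact this
  rw [tderiv_cone_symm x _ hmem, tderiv_cone_symm x _ hmem, cone_symm_apply x _ _ one_pos, ← hc, h4,
    h4, hc, extChartAt_to_inv, ← kahlerForm_formAt]
  rfl

end
end SasakiEinstein

/-! ### Tangent spaces of submanifolds in adapted charts -/

section AdaptedCharts

variable {V : Type*} [NormedAddCommGroup V] [NormedSpace ℝ V] [FiniteDimensional ℝ V]
  {M : Type*} [TopologicalSpace M] [ChartedSpace V M] [IsManifold 𝓘(ℝ, V) ∞ M]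

theorem tderiv_maximalAtlas_symm {e : OpenPartialHomeomorph M V}
    (he : e ∈ IsManifold.maximalAtlas 𝓘(ℝ, V) ∞ M) {y : M} (hy : y ∈ e.source) (u : V) :
    tderiv 𝓘(ℝ, V) 𝓘(ℝ, V) e.symm (e y) (tderiv 𝓘(ℝ, V) 𝓘(ℝ, V) e y u) = u := by
  have h1 := contMDiffAt_symm_of_mem_maximalAtlas he (e.map_source hy)
  have h2 := contMDiffAt_of_mem_maximalAtlas he hy
  rw [← tderiv_comp_apply y (h1.mdifferentiableAt (by simp)) (h2.mdifferentiableAt (by simp))]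
  rw [tderiv_congr (g := fun y => y), tderiv_id']; · rfl
  filter_upwards [e.open_source.mem_nhds hy] with w hw
  exact e.left_inv hw

theorem IsCurveIn.tderiv_eq {Y : Set M} {y : M} {v : V} {γ : ℝ → M}
    (hγ : IsCurveIn 𝓘(ℝ, V) Y y v γ) : tderiv 𝓘(ℝ, ℝ) 𝓘(ℝ, V) γ 0 1 = v := hγ.velocity_eq

/-- The derivative at a curve, in a chart. -/
theorem IsCurveIn.hasDerivAt {Y : Set M} {y : M} {v : V} {γ : ℝ → M}
    (hγ : IsCurveIn 𝓘(ℝ, V) Y y v γ) {F : Type*} [NormedAddCommGroup F] [NormedSpace ℝ F]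
    {f : M → F} (hf : MDifferentiableAt 𝓘(ℝ, V) 𝓘(ℝ, F) f y) :
    HasDerivAt (fun s => f (γ s)) (tderiv 𝓘(ℝ, V) 𝓘(ℝ, F) f y v) 0 := by
  have h0 := hγ.start
  subst h0
  have h1 : MDifferentiableAt 𝓘(ℝ, ℝ) 𝓘(ℝ, V) γ 0 :=
    (hγ.smooth 0).mdifferentiableAt (by simp)
  have h2 := tderiv_comp_apply (0 : ℝ) hf h1 1
  rw [hγ.tderiv_eq, tderiv_eq_fderiv] at h2
  rw [← h2]
  exact (MDifferentiableAt.comp (0 : ℝ) hf h1).differentiableAt.hasFDerivAt.hasDerivAt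

/-- In an adapted chart the tangent space is the given linear subspace. -/
theorem mem_tangentSubspace_iff {Y : Set M} {e : OpenPartialHomeomorph M V}
    (he : e ∈ IsManifold.maximalAtlas 𝓘(ℝ, V) ∞ M) {W : Submodule ℝ V}
    (hY : ∀ q ∈ e.source, (q ∈ Y ↔ e q ∈ W)) {y : M} (hy : y ∈ e.source) (hyY : y ∈ Y) (u : V) :
    u ∈ tangentSubspace 𝓘(ℝ, V) Y y ↔ tderiv 𝓘(ℝ, V) 𝓘(ℝ, V) e y u ∈ W := by
  have hd := (contMDiffAt_of_mem_maximalAtlas he hy).mdifferentiableAt (by simp)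
  constructor
  · intro hu
    -- A curve in `Y` runs inside `W` in the chart, so its difference quotients at `0` lie in `W`,
    -- which is closed.
    have hle : (tangentSubspace 𝓘(ℝ, V) Y y : Submodule ℝ V) ≤
        W.comap (tderiv 𝓘(ℝ, V) 𝓘(ℝ, V) e y : V →ₗ[ℝ] V) := by
      refine Submodule.span_le.2 ?_
      rintro v ⟨γ, hγ⟩
      change tderiv 𝓘(ℝ, V) 𝓘(ℝ, V) e y v ∈ W
      have h1 := hγ.hasDerivAt hd
      have h2 : ∀ᶠ s in 𝓝 (0 : ℝ), e (γ s) ∈ W := by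
        have h3 := hγ.smooth.continuous.continuousAt (x := 0)
        have h4 := h3.preimage_mem_nhds (e.open_source.mem_nhds (hγ.start.symm ▸ hy))
        filter_upwards [hγ.mem, h4] with s hs hs'
        exact (hY _ hs').1 hs
      have hcl : IsClosed (W : Set V) := W.closed_of_finiteDimensional
      have h5 := h1.tendsto_slope_zero
      refine hcl.mem_of_tendsto h5 ?_
      have h6 : ∀ᶠ s in 𝓝[≠] (0 : ℝ), e (γ s) ∈ W := h2.filter_mono nhdsWithin_le_nhds
      filter_upwards [h6] with s hs
      refine W.smul_mem _ (W.sub_mem (by simpa using hs) ?_)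
      exact h2.self_of_nhds
    exact hle hu
  · intro hu
    refine Submodule.subset_span ?_
    set w := tderiv 𝓘(ℝ, V) 𝓘(ℝ, V) e y u with hw
    have hyW : e y ∈ W := (hY y hy).1 hyY
    obtain ⟨δ, hδ, hball⟩ := Metric.isOpen_iff.1 e.open_target (e y) (e.map_source hy)
    obtain ⟨ε, hε, hεw⟩ : ∃ ε : ℝ, 0 < ε ∧ ε * ‖w‖ < δ := by
      refine ⟨δ / (2 * (‖w‖ + 1)), by positivity, ?_⟩
      have h1 : 0 ≤ ‖w‖ := norm_nonneg _
      rw [div_mul_eq_mul_div, div_lt_iff₀ (by positivity)]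
      nlinarith
    -- A straight line in `W` could leave the target of the chart, while a curve has to be smooth
    -- for all times. Replacing `s` by `ε sin (s / ε)` keeps the velocity at `0` and confines the
    -- curve to a ball inside the target.
    let b : ℝ → V := fun s => e y + (ε * Real.sin (s / ε)) • w
    have hb : ∀ s, b s ∈ e.target := by
      intro s
      refine hball ?_
      rw [Metric.mem_ball, dist_eq_norm, add_sub_cancel_left, norm_smul, norm_mul,
        Real.norm_of_nonneg hε.le]
      refine lt_of_le_of_lt ?_ hεw
      have := Real.abs_sin_le_one (s / ε)
      rw [← Real.norm_eq_abs] at this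
      have h1 : 0 ≤ ‖w‖ := norm_nonneg _
      calc ε * ‖Real.sin (s / ε)‖ * ‖w‖ ≤ ε * 1 * ‖w‖ := by gcongr
        _ = ε * ‖w‖ := by ring
    have hbs : ContDiff ℝ ∞ b := by
      refine contDiff_const.add (ContDiff.smul ?_ contDiff_const)
      exact contDiff_const.mul (Real.contDiff_sin.comp (contDiff_id.div_const ε))
    have hb0 : b 0 = e y := by simp [b]
    have hbd : HasDerivAt b w 0 := by
      have h1 : HasDerivAt (fun s : ℝ => ε * Real.sin (s / ε)) 1 0 := by
        have := ((Real.hasDerivAt_sin (0 / ε)).comp 0 ((hasDerivAt_id (0 : ℝ)).div_const ε)).const_mul ε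
        refine this.congr_deriv ?_
        simp [hε.ne']
      have h2 := (h1.smul_const w).const_add (e y)
      rwa [one_smul] at h2
    refine ⟨fun s => e.symm (b s), ?_, ?_, ?_, ?_⟩
    · intro s
      exact ContMDiffAt.comp s (contMDiffAt_symm_of_mem_maximalAtlas he (hb s)) hbs.contMDiff.contMDiffAt
    · refine Eventually.of_forall fun s => ?_
      rw [hY _ (e.map_target (hb s)), e.right_inv (hb s)]
      exact W.add_mem hyW (W.smul_mem _ hu)
    · rw [hb0, e.left_inv hy]
    · change tderiv 𝓘(ℝ, ℝ) 𝓘(ℝ, V) (fun s => e.symm (b s)) 0 1 = u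
      have h1 := (contMDiffAt_symm_of_mem_maximalAtlas he (hb 0)).mdifferentiableAt (by simp)
      rw [tderiv_comp_apply 0 h1 hbd.differentiableAt.mdifferentiableAt, tderiv_eq_fderiv,
        hbd.hasFDerivAt.fderiv, hb0]
      simp [hw, tderiv_maximalAtlas_symm he hy]

end AdaptedCharts

/-! ### Holomorphic maps as smooth maps with complex linear derivative -/

section ComplexCharts

variable {E : Type*} [NormedAddCommGroup E] [NormedSpace ℂ E]
  {X : Type*} [TopologicalSpace X] [ChartedSpace E X]
  {E' : Type*} [NormedAddCommGroup E'] [NormedSpace ℂ E']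
  {X' : Type*} [TopologicalSpace X'] [ChartedSpace E' X']

theorem contMDiffAt_real_of_complex {f : X → X'} {x : X}
    (h : ContMDiffAt 𝓘(ℂ, E) 𝓘(ℂ, E') ω f x) : ContMDiffAt 𝓘(ℝ, E) 𝓘(ℝ, E') ∞ f x := by
  rw [contMDiffAt_iff] at h ⊢
  refine ⟨h.1, ?_⟩
  have h2 := h.2
  have h3 := (h2.restrict_scalars ℝ).of_le (m := ∞) le_top
  simpa using h3

theorem mem_real_maximalAtlas [IsManifold 𝓘(ℂ, E) ω X] {e : OpenPartialHomeomorph X E}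
    (he : e ∈ IsManifold.maximalAtlas 𝓘(ℂ, E) ω X) :
    e ∈ IsManifold.maximalAtlas 𝓘(ℝ, E) ∞ X := by
  refine OpenPartialHomeomorph.mem_maximalAtlas_of_contMDiffOn _ ?_ ?_
  · exact fun q hq => (contMDiffAt_real_of_complex
      (contMDiffAt_of_mem_maximalAtlas he hq)).contMDiffWithinAt
  · exact fun q hq => (contMDiffAt_real_of_complex
      (contMDiffAt_symm_of_mem_maximalAtlas he hq)).contMDiffWithinAt

theorem tderiv_I_smul {f : X → X'} {x : X} (h : ContMDiffAt 𝓘(ℂ, E) 𝓘(ℂ, E') ω f x) (v : E) :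
    tderiv 𝓘(ℝ, E) 𝓘(ℝ, E') f x (Complex.I • v) =
      Complex.I • tderiv 𝓘(ℝ, E) 𝓘(ℝ, E') f x v := by
  have h1 : MDifferentiableAt 𝓘(ℂ, E) 𝓘(ℂ, E') f x := h.mdifferentiableAt (by simp)
  have h1' : MDifferentiableAt 𝓘(ℝ, E) 𝓘(ℝ, E') f x :=
    (contMDiffAt_real_of_complex h).mdifferentiableAt (by simp)
  have h2 : tderiv 𝓘(ℝ, E) 𝓘(ℝ, E') f x =
      fderiv ℝ (writtenInExtChartAt 𝓘(ℝ, E) 𝓘(ℝ, E') x f) (extChartAt 𝓘(ℝ, E) x x) := by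
    refine (h1'.mfderiv).trans ?_
    simp
    rfl
  have h3 : DifferentiableAt ℂ (writtenInExtChartAt 𝓘(ℝ, E) 𝓘(ℝ, E') x f)
      (extChartAt 𝓘(ℝ, E) x x) := by
    have := h1.differentiableWithinAt_writtenInExtChartAt
    simpa [differentiableWithinAt_univ] using this
  rw [h2, h3.fderiv_restrictScalars ℝ]
  simp

end ComplexCharts

/-! ### Algebra of `ξ`, `η`, `Φ` and `Ω` at a point -/

namespace SasakiEinstein

noncomputable section

variable {S : Type*} [TopologicalSpace S] [ChartedSpace E7 S] [IsManifold (𝓡 7) ∞ S]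
  (s : SasakiEinstein S)

/-- The Reeb field, on the model space. -/
def reebAt (x : S) : E7 := s.reeb x

/-- The structure tensor, on the model space. -/
def PhiAt (x : S) (u : E7) : E7 := s.structureTensor x u

/-- The horizontal Kähler form, on the model space. -/
def OmegaAt (x : S) (u v : E7) : ℝ := s.horizontalKahlerForm x u v

theorem coneAt_one (x : S) (u v : E7 × ℝ) : s.coneAt (x, PosReal.one) u v =
    s.gAt x u.1 v.1 + u.2 * v.2 := by simp [coneAt]

theorem JAt_radial' (x : S) : s.JAt (x, PosReal.one) (0, 1) = (s.reebAt x, 0) := s.JAt_radial x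

theorem gAt_reeb_reeb (x : S) : s.gAt x (s.reebAt x) (s.reebAt x) = 1 := by
  have h := s.JAt_isometry (x, PosReal.one) (0, 1) (0, 1)
  rw [JAt_radial', coneAt_one, coneAt_one] at h
  simpa using h

/-- The radial part comes from skewness of `J` against `∂_r` and `J ∂_r = ξ`. The later relations
between `g`, `ξ` and `Φ` are read off from this block form of `J`. -/
theorem JAt_horizontal (x : S) (u : E7) : s.JAt (x, PosReal.one) (u, 0) =
    (s.PhiAt x u, - s.gAt x (s.reebAt x) u) := by
  refine Prod.ext rfl ?_
  have h := s.coneAt_JAt_left (x, PosReal.one) (u, 0) (0, 1)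
  rw [JAt_radial', coneAt_one, coneAt_one] at h
  rw [s.gAt_symm x (s.reebAt x) u]
  simpa using h

theorem gAt_reeb_PhiAt (x : S) (u : E7) : s.gAt x (s.reebAt x) (s.PhiAt x u) = 0 := by
  have h := s.JAt_isometry (x, PosReal.one) (0, 1) (u, 0)
  rw [JAt_radial', JAt_horizontal, coneAt_one, coneAt_one] at h
  simpa using h

theorem OmegaAt_eq (x : S) (u v : E7) : s.OmegaAt x u v = s.gAt x (s.PhiAt x u) v := by
  have h : s.OmegaAt x u v = s.coneAt (x, PosReal.one) (s.JAt (x, PosReal.one) (u, 0)) (v, 0) :=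
    s.kahlerForm_formAt (x, PosReal.one) (u, 0) (v, 0)
  rw [h, JAt_horizontal, coneAt_one]
  simp

theorem gAt_PhiAt_PhiAt (x : S) (u v : E7) : s.gAt x (s.PhiAt x u) (s.PhiAt x v) =
    s.gAt x u v - s.gAt x (s.reebAt x) u * s.gAt x (s.reebAt x) v := by
  have h := s.JAt_isometry (x, PosReal.one) (u, 0) (v, 0)
  rw [JAt_horizontal, JAt_horizontal, coneAt_one, coneAt_one] at h
  simp only [mul_zero, add_zero] at h
  linarith

theorem gAt_PhiAt_left (x : S) (u v : E7) : s.gAt x (s.PhiAt x u) v = - s.gAt x u (s.PhiAt x v) := by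
  have h := s.coneAt_JAt_left (x, PosReal.one) (u, 0) (v, 0)
  rw [JAt_horizontal, JAt_horizontal, coneAt_one, coneAt_one] at h
  simpa using h

end

end SasakiEinstein

/-! ### The circle bundle as a submersion compatible with the complex structures -/

section Regular

noncomputable section

variable {S : Type*} [TopologicalSpace S] [ChartedSpace E7 S]
  [MulAction Circle S] {E : Type*} [NormedAddCommGroup E] [NormedSpace ℝ E]
  {X : Type*} [TopologicalSpace X] [ChartedSpace E X]
  {π : S → X}

theorem IsPrincipalCircleBundle.smul_proj (hb : IsPrincipalCircleBundle 𝓘(ℝ, E) π) (z : Circle)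
    (p : S) : π (z • p) = π p := ((hb.fibre _ _).2 ⟨z, rfl⟩).symm

theorem IsPrincipalCircleBundle.contMDiff_smul (hb : IsPrincipalCircleBundle 𝓘(ℝ, E) π)
    (z : Circle) : ContMDiff (𝓡 7) (𝓡 7) ∞ (fun p : S => z • p) := by
  have h : ContMDiff (𝓡 7) ((𝓡 1).prod (𝓡 7)) ∞ (fun p : S => (z, p)) :=
    contMDiff_const.prodMk contMDiff_id
  exact hb.smooth_action.comp h

/-- A smooth local section through a given point. -/
theorem IsPrincipalCircleBundle.exists_section (hb : IsPrincipalCircleBundle 𝓘(ℝ, E) π) (p : S) :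
    ∃ U : Set X, IsOpen U ∧ π p ∈ U ∧ ∃ σ : X → S, ContMDiffOn 𝓘(ℝ, E) (𝓡 7) ∞ σ U ∧
      (∀ y ∈ U, π (σ y) = y) ∧ σ (π p) = p := by
  obtain ⟨U, hU, hx, σ, τ, hσ, hτ, h1, h2⟩ := hb.locally_trivial (π p)
  refine ⟨U, hU, hx, fun y => τ p • σ y, ?_, ?_, h2 p hx⟩
  · exact (hb.contMDiff_smul (τ p)).comp_contMDiffOn hσ
  · intro y hy
    rw [hb.smul_proj, h1 y hy]

theorem IsPrincipalCircleBundle.mdifferentiableAt (hb : IsPrincipalCircleBundle 𝓘(ℝ, E) π) (p : S) :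
    MDifferentiableAt (𝓡 7) 𝓘(ℝ, E) π p := (hb.smooth p).mdifferentiableAt (by simp)

theorem IsPrincipalCircleBundle.tderiv_surjective (hb : IsPrincipalCircleBundle 𝓘(ℝ, E) π)
    (p : S) : Function.Surjective (tderiv (𝓡 7) 𝓘(ℝ, E) π p) := by
  obtain ⟨U, hU, hx, σ, hσ, h1, h2⟩ := hb.exists_section p
  intro w
  have hσd : MDifferentiableAt 𝓘(ℝ, E) (𝓡 7) σ (π p) :=
    (hσ.contMDiffAt (hU.mem_nhds hx)).mdifferentiableAt (by simp)
  refine ⟨tderiv 𝓘(ℝ, E) (𝓡 7) σ (π p) w, ?_⟩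
  have h3 := tderiv_comp_apply (π p) (hb.mdifferentiableAt (σ (π p))) hσd w
  rw [h2] at h3
  rw [← h3, tderiv_congr (g := fun y => y), tderiv_id']
  · rfl
  · filter_upwards [hU.mem_nhds hx] with y hy
    exact h1 y hy

end

end Regular

namespace IsRegularOver

noncomputable section

variable {S : Type*} [TopologicalSpace S] [ChartedSpace E7 S] [IsManifold (𝓡 7) ∞ S]
  [MulAction Circle S] {s : SasakiEinstein S}
  {E : Type*} [NormedAddCommGroup E] [NormedSpace ℂ E]
  {X : Type*} [TopologicalSpace X] [ChartedSpace E X] [IsManifold 𝓘(ℂ, E) ω X]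
  {h : KahlerMetric E X} {π : S → X}

/-- The Kähler metric of the base, on the model space. -/
def _root_.SasakiGeometry.KahlerMetric.gAt (h : KahlerMetric E X) (x : X) : E →L[ℝ] E →L[ℝ] ℝ :=
  h.g.inner x

theorem _root_.SasakiGeometry.KahlerMetric.gAt_pos (h : KahlerMetric E X) (x : X) {u : E}
    (hu : u ≠ 0) : 0 < h.gAt x u u := h.g.pos x u hu

theorem _root_.SasakiGeometry.KahlerMetric.eq_zero_of_gAt (h : KahlerMetric E X) (x : X) {u : E}
    (hu : h.gAt x u u = 0) : u = 0 := by
  by_contra h0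
  exact (h.gAt_pos x h0).ne' hu

theorem _root_.SasakiGeometry.KahlerMetric.hermitianAt (h : KahlerMetric E X) (x : X) (u v : E) :
    h.gAt x (Complex.I • u) (Complex.I • v) = h.gAt x u v := h.hermitian x u v

theorem _root_.SasakiGeometry.KahlerMetric.form_formAt (h : KahlerMetric E X) (x : X) (u v : E) :
    formAt h.form x ![u, v] = h.gAt x (Complex.I • u) v := h.form_apply x u v


theorem metricAt (hr : IsRegularOver s h π) (p : S) (u v : E7) : s.gAt p u v =
    h.gAt (π p) (tderiv (𝓡 7) 𝓘(ℝ, E) π p u) (tderiv (𝓡 7) 𝓘(ℝ, E) π p v)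
      + s.gAt p (s.reebAt p) u * s.gAt p (s.reebAt p) v := hr.metric p u v

/-- `g(ξ, ξ) = 1` is already accounted for by the summand `η ⊗ η`, so `dπ ξ` has length zero. -/
theorem tderiv_reeb (hr : IsRegularOver s h π) (p : S) : tderiv (𝓡 7) 𝓘(ℝ, E) π p (s.reebAt p) = 0 := by
  have h1 := hr.metricAt p (s.reebAt p) (s.reebAt p)
  rw [s.gAt_reeb_reeb] at h1
  exact h.eq_zero_of_gAt (π p) (by linarith)

/-- If `dπ u = 0`, the part of `u` orthogonal to `ξ` contributes to neither summand of `g = π^* g_X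
+ η ⊗ η`, hence is zero. -/
theorem tderiv_eq_zero_iff (hr : IsRegularOver s h π) (p : S) (u : E7) : tderiv (𝓡 7) 𝓘(ℝ, E) π p u = 0 ↔
    u = s.gAt p (s.reebAt p) u • s.reebAt p := by
  constructor
  · intro hu
    set w := u - s.gAt p (s.reebAt p) u • s.reebAt p with hw
    have h1 : tderiv (𝓡 7) 𝓘(ℝ, E) π p w = 0 := by
      rw [hw, map_sub, map_smul, hr.tderiv_reeb, hu]; simp
    have h2 : s.gAt p (s.reebAt p) w = 0 := by
      rw [hw, map_sub, map_smul, s.gAt_reeb_reeb]; simp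
    have h3 := hr.metricAt p w w
    rw [h1, h2] at h3
    simp only [map_zero, mul_zero, add_zero] at h3
    by_contra hne
    exact (s.gAt_pos p (u := w) (fun h0 => hne (sub_eq_zero.1 h0))).ne' h3
  · intro hu
    rw [hu, map_smul, hr.tderiv_reeb, smul_zero]

/-- Both sides are half of `dη(u, v)`: on the left by the identity on the cone, on the right by the
curvature hypothesis. -/
theorem OmegaAt_eq_base [T2Space S] (hr : IsRegularOver s h π) (p : S) (u v : E7) : s.OmegaAt p u v =
    h.gAt (π p) (Complex.I • tderiv (𝓡 7) 𝓘(ℝ, E) π p u) (tderiv (𝓡 7) 𝓘(ℝ, E) π p v) := by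
  have h1 : formAt (extDerivative s.contactForm) p ![u, v] = 2 * formAt h.form (π p)
      ![tderiv (𝓡 7) 𝓘(ℝ, E) π p u, tderiv (𝓡 7) 𝓘(ℝ, E) π p v] := hr.curvature p u v
  rw [s.extDerivative_contactForm, h.form_formAt] at h1
  exact mul_left_cancel₀ two_ne_zero h1

/-- By `Ω = g(Φ·, ·)` and `Ω = π^* ω_X`, the vectors `dπ (Φ u)` and `i dπ u` have the same inner
product with every `dπ v`. Surjectivity of `dπ` allows `v` to be chosen with `dπ v` equal to their
difference. -/
theorem tderiv_PhiAt [T2Space S] (hr : IsRegularOver s h π) (p : S) (u : E7) : tderiv (𝓡 7) 𝓘(ℝ, E) π p (s.PhiAt p u) =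
    Complex.I • tderiv (𝓡 7) 𝓘(ℝ, E) π p u := by
  rw [← sub_eq_zero]
  refine h.eq_zero_of_gAt (π p) ?_
  obtain ⟨v, hv⟩ := hr.bundle.tderiv_surjective p (tderiv (𝓡 7) 𝓘(ℝ, E) π p (s.PhiAt p u) -
    Complex.I • tderiv (𝓡 7) 𝓘(ℝ, E) π p u)
  rw [← hv]
  nth_rw 1 [hv]
  rw [map_sub, sub_apply, ← hr.OmegaAt_eq_base, s.OmegaAt_eq, hr.metricAt, s.gAt_reeb_PhiAt]
  ring

end

end IsRegularOver

theorem finrank_prod_top {E : Type*} [AddCommGroup E] [Module ℝ E] [FiniteDimensional ℝ E]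
    (W : Submodule ℝ E) : Module.finrank ℝ (W.prod (⊤ : Submodule ℝ ℝ)) =
      Module.finrank ℝ W + 1 := by
  have e : (W.prod (⊤ : Submodule ℝ ℝ)) ≃ₗ[ℝ] W × (⊤ : Submodule ℝ ℝ) :=
    { toFun := fun x => (⟨x.1.1, x.2.1⟩, ⟨x.1.2, x.2.2⟩)
      invFun := fun x => ⟨(x.1.1, x.2.1), x.1.2, x.2.2⟩
      map_add' := fun _ _ => rfl
      map_smul' := fun _ _ => rfl
      left_inv := fun _ => rfl
      right_inv := fun _ => rfl }
  rw [e.finrank_eq, Module.finrank_prod, finrank_top, Module.finrank_self]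

theorem tderiv_prodMk_space {E : Type*} [NormedAddCommGroup E] [NormedSpace ℝ E]
    {F : Type*} [NormedAddCommGroup F] [NormedSpace ℝ F] {G : Type*} [NormedAddCommGroup G]
    [NormedSpace ℝ G] {M : Type*} [TopologicalSpace M] [ChartedSpace E M] {f : M → F} {g : M → G}
    {x : M} (hf : MDifferentiableAt 𝓘(ℝ, E) 𝓘(ℝ, F) f x)
    (hg : MDifferentiableAt 𝓘(ℝ, E) 𝓘(ℝ, G) g x) (u : E) :
    tderiv 𝓘(ℝ, E) 𝓘(ℝ, F × G) (fun y => (f y, g y)) x u =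
      (tderiv 𝓘(ℝ, E) 𝓘(ℝ, F) f x u, tderiv 𝓘(ℝ, E) 𝓘(ℝ, G) g x u) := by
  have h := hf.prodMk_space hg
  have h1 : MDifferentiableAt 𝓘(ℝ, F × G) 𝓘(ℝ, F) (Prod.fst : F × G → F) (f x, g x) :=
    differentiableAt_fst.mdifferentiableAt
  have h2 : MDifferentiableAt 𝓘(ℝ, F × G) 𝓘(ℝ, G) (Prod.snd : F × G → G) (f x, g x) :=
    differentiableAt_snd.mdifferentiableAt
  have h3 := tderiv_comp_apply x h1 h u
  have h4 := tderiv_comp_apply x h2 h u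
  rw [tderiv_eq_fderiv, fderiv_fst] at h3
  rw [tderiv_eq_fderiv, fderiv_snd] at h4
  exact Prod.ext h3.symm h4.symm

/-- The tangent space of a subset of a manifold, in the model space. -/
noncomputable def tangentAt {V : Type*} [NormedAddCommGroup V] [NormedSpace ℝ V] {M : Type*}
    [TopologicalSpace M] [ChartedSpace V M] (Y : Set M) (p : M) : Submodule ℝ V :=
  tangentSubspace 𝓘(ℝ, V) Y p

/-! ### The preimage of a complex curve: adapted charts, tangent spaces, invariance -/

namespace IsRegularOver

noncomputable section

variable {S : Type*} [TopologicalSpace S] [ChartedSpace E7 S] [IsManifold (𝓡 7) ∞ S]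
  [MulAction Circle S] {s : SasakiEinstein S}
  {E : Type*} [NormedAddCommGroup E] [NormedSpace ℂ E] [FiniteDimensional ℂ E]
  {X : Type*} [TopologicalSpace X] [ChartedSpace E X] [IsManifold 𝓘(ℂ, E) ω X]
  {h : KahlerMetric E X} {π : S → X}

/-- The derivative at `p` of the projection, in the chart `e` of the base. -/
def proj (π : S → X) (e : OpenPartialHomeomorph X E) (p : S) : E7 →L[ℝ] E :=
  (tderiv 𝓘(ℝ, E) 𝓘(ℝ, E) e (π p)).comp (tderiv (𝓡 7) 𝓘(ℝ, E) π p)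

theorem proj_eq_tderiv (hr : IsRegularOver s h π) {e : OpenPartialHomeomorph X E}
    (he : e ∈ IsManifold.maximalAtlas 𝓘(ℂ, E) ω X) {p : S} (hp : π p ∈ e.source) :
    proj π e p = tderiv (𝓡 7) 𝓘(ℝ, E) (fun q => e (π q)) p := by
  have h1 := (contMDiffAt_of_mem_maximalAtlas (mem_real_maximalAtlas he) hp).mdifferentiableAt
    (by simp)
  exact (tderiv_comp p h1 (hr.bundle.mdifferentiableAt p)).symm

theorem proj_PhiAt [T2Space S] (hr : IsRegularOver s h π) {e : OpenPartialHomeomorph X E}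
    (he : e ∈ IsManifold.maximalAtlas 𝓘(ℂ, E) ω X) {p : S} (hp : π p ∈ e.source) (u : E7) :
    proj π e p (s.PhiAt p u) = Complex.I • proj π e p u := by
  have h1 : proj π e p (s.PhiAt p u) = tderiv 𝓘(ℝ, E) 𝓘(ℝ, E) e (π p)
    (tderiv (𝓡 7) 𝓘(ℝ, E) π p (s.PhiAt p u)) := rfl
  rw [h1, hr.tderiv_PhiAt, tderiv_I_smul (contMDiffAt_of_mem_maximalAtlas he hp)]
  rfl

theorem proj_reeb (hr : IsRegularOver s h π) (e : OpenPartialHomeomorph X E) (p : S) :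
    proj π e p (s.reebAt p) = 0 := by
  have h1 : proj π e p (s.reebAt p) = tderiv 𝓘(ℝ, E) 𝓘(ℝ, E) e (π p)
    (tderiv (𝓡 7) 𝓘(ℝ, E) π p (s.reebAt p)) := rfl
  rw [h1, hr.tderiv_reeb, map_zero]

theorem proj_eq_zero_iff (hr : IsRegularOver s h π) {e : OpenPartialHomeomorph X E}
    (he : e ∈ IsManifold.maximalAtlas 𝓘(ℂ, E) ω X) {p : S} (hp : π p ∈ e.source) (u : E7) :
    proj π e p u = 0 ↔ u = s.gAt p (s.reebAt p) u • s.reebAt p := by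
  rw [← hr.tderiv_eq_zero_iff]
  constructor
  · intro hu
    have h1 := tderiv_maximalAtlas_symm (mem_real_maximalAtlas he) hp
      (tderiv (𝓡 7) 𝓘(ℝ, E) π p u)
    have h2 : tderiv 𝓘(ℝ, E) 𝓘(ℝ, E) e (π p) (tderiv (𝓡 7) 𝓘(ℝ, E) π p u) = 0 := hu
    rw [h2, map_zero] at h1
    exact h1.symm
  · intro hu
    have h1 : proj π e p u = tderiv 𝓘(ℝ, E) 𝓘(ℝ, E) e (π p)
      (tderiv (𝓡 7) 𝓘(ℝ, E) π p u) := rfl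
    rw [h1, hu, map_zero]

/-- The splitting of the tangent space of `S` into a horizontal and a vertical part. -/
theorem exists_splitting (hr : IsRegularOver s h π) (hdim : Module.finrank ℂ E = 3)
    {e : OpenPartialHomeomorph X E}
    (he : e ∈ IsManifold.maximalAtlas 𝓘(ℂ, E) ω X) {p : S} (hp : π p ∈ e.source) :
    ∃ T : E7 ≃L[ℝ] E × ℝ, ∀ u, T u = (proj π e p u, s.gAt p (s.reebAt p) u) := by
  let G : E7 →ₗ[ℝ] E × ℝ := ((proj π e p).prod (s.gAt p (s.reebAt p)) : E7 →L[ℝ] E × ℝ)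
  have hG : Function.Injective G := by
    rw [injective_iff_map_eq_zero]
    intro u hu
    have h1 : proj π e p u = 0 := congrArg Prod.fst hu
    have h2 : s.gAt p (s.reebAt p) u = 0 := congrArg Prod.snd hu
    rw [hr.proj_eq_zero_iff he hp, h2, zero_smul] at h1
    exact h1
  have hfin : Module.finrank ℝ E7 = Module.finrank ℝ (E × ℝ) := by
    rw [Module.finrank_prod, Module.finrank_self, finrank_real_of_complex, hdim]
    simp
  refine ⟨(LinearEquiv.ofInjectiveOfFinrankEq G hG hfin).toContinuousLinearEquiv, fun u => rfl⟩

/-- The chart is `q ↦ T⁻¹ (e (π q), η_p (q))`, where `η_p` is the contact form at `p` applied to the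
coordinates of `q`. In it the preimage of the curve becomes `T⁻¹ (W × ℝ)`, of real dimension `2 +
1`. Composing with `T⁻¹` makes its derivative at `p` the identity, so that this subspace is also the
tangent space at `p`. -/
theorem exists_adapted_chart (hr : IsRegularOver s h π) (hdim : Module.finrank ℂ E = 3)
    {Y : Set X} {e : OpenPartialHomeomorph X E}
    (he : e ∈ IsManifold.maximalAtlas 𝓘(ℂ, E) ω X) {W : Submodule ℂ E}
    (hW : Module.finrank ℂ W = 1) (hY : ∀ q ∈ e.source, (q ∈ Y ↔ e q ∈ W))
    {p : S} (hp : π p ∈ e.source) :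
    ∃ c ∈ IsManifold.maximalAtlas (𝓡 7) ∞ S, p ∈ c.source ∧ ∃ W' : Submodule ℝ E7,
      Module.finrank ℝ W' = 3 ∧ (∀ q ∈ c.source, (q ∈ π ⁻¹' Y ↔ c q ∈ W')) ∧
      (∀ u, u ∈ W' ↔ proj π e p u ∈ W) ∧ ∀ u, tderiv (𝓡 7) 𝓘(ℝ, E7) c p u = u := by
  obtain ⟨T, hT⟩ := hr.exists_splitting hdim he hp
  have her := mem_real_maximalAtlas he
  let ℓ := s.gAt p (s.reebAt p)
  let F : S → E7 := fun q => T.symm (e (π q), ℓ (extChartAt (𝓡 7) p q))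
  let U : Set S := π ⁻¹' e.source ∩ (extChartAt (𝓡 7) p).source
  have hU : IsOpen U := (e.open_source.preimage hr.bundle.smooth.continuous).inter
    (isOpen_extChartAt_source p)
  have hpU : p ∈ U := ⟨hp, mem_extChartAt_source p⟩
  have hF1 : ∀ q ∈ U, ContMDiffAt (𝓡 7) 𝓘(ℝ, E) ∞ (fun q => e (π q)) q := fun q hq =>
    (contMDiffAt_of_mem_maximalAtlas her hq.1).comp q (hr.bundle.smooth q)
  have hF2 : ∀ q ∈ U, ContMDiffAt (𝓡 7) 𝓘(ℝ, ℝ) ∞ (fun q => ℓ (extChartAt (𝓡 7) p q)) q :=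
    fun q hq => ℓ.contDiff.contMDiff.contMDiffAt.comp q
      (contMDiffAt_extChartAt' (by rw [← extChartAt_source (𝓡 7)]; exact hq.2))
  have hF : ContMDiffOn (𝓡 7) (𝓡 7) ∞ F U := by
    intro q hq
    have h1 : ContMDiffAt (𝓡 7) 𝓘(ℝ, E × ℝ) ∞ (fun q => (e (π q), ℓ (extChartAt (𝓡 7) p q))) q :=
      (hF1 q hq).prodMk_space (hF2 q hq)
    have h2 : ContMDiffAt 𝓘(ℝ, E × ℝ) (𝓡 7) ∞ T.symm (e (π q), ℓ (extChartAt (𝓡 7) p q)) :=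
      T.symm.contDiff.contMDiff.contMDiffAt
    exact (h2.comp q h1).contMDiffWithinAt
  have hTF : ∀ q, T (F q) = (e (π q), ℓ (extChartAt (𝓡 7) p q)) := fun q => T.apply_symm_apply _
  have hdF : ∀ u, tderiv (𝓡 7) 𝓘(ℝ, E7) F p u = u := by
    intro u
    have hFd : MDifferentiableAt (𝓡 7) 𝓘(ℝ, E7) F p :=
      (hF.contMDiffAt (hU.mem_nhds hpU)).mdifferentiableAt (by simp)
    have hTd : MDifferentiableAt 𝓘(ℝ, E7) 𝓘(ℝ, E × ℝ) T (F p) :=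
      (T.contDiff (n := ∞)).differentiable (by simp) |>.differentiableAt.mdifferentiableAt
    have h1 := tderiv_comp_apply p hTd hFd u
    rw [tderiv_eq_fderiv, T.fderiv] at h1
    have h2 : (fun q => T (F q)) = fun q => (e (π q), ℓ (extChartAt (𝓡 7) p q)) := funext hTF
    have hd1 := (hF1 p hpU).mdifferentiableAt (by simp)
    have hd2 := (hF2 p hpU).mdifferentiableAt (by simp)
    have h3 : tderiv (𝓡 7) 𝓘(ℝ, E × ℝ) (fun q => (e (π q), ℓ (extChartAt (𝓡 7) p q))) p u =
        (tderiv (𝓡 7) 𝓘(ℝ, E) (fun q => e (π q)) p u,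
          tderiv (𝓡 7) 𝓘(ℝ, ℝ) (fun q => ℓ (extChartAt (𝓡 7) p q)) p u) :=
      tderiv_prodMk_space hd1 hd2 u
    have h4 : tderiv (𝓡 7) 𝓘(ℝ, ℝ) (fun q => ℓ (extChartAt (𝓡 7) p q)) p u = ℓ u := by
      have hc : MDifferentiableAt (𝓡 7) 𝓘(ℝ, E7) (extChartAt (𝓡 7) p) p :=
        mdifferentiableAt_extChartAt (mem_chart_source _ p)
      have hl : MDifferentiableAt 𝓘(ℝ, E7) 𝓘(ℝ, ℝ) ℓ (extChartAt (𝓡 7) p p) :=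
        ℓ.differentiableAt.mdifferentiableAt
      rw [tderiv_comp_apply p hl hc, tderiv_eq_fderiv, ℓ.fderiv,
        tderiv_extChartAt_self (I := 𝓡 7)]
      rfl
    rw [h2, h3, h4, ← hr.proj_eq_tderiv he hp, ← hT u] at h1
    exact (T.injective h1).symm
  have hA : tderiv (𝓡 7) (𝓡 7) F p = (ContinuousLinearEquiv.refl ℝ E7 : E7 →L[ℝ] E7) :=
    ContinuousLinearMap.ext hdF
  obtain ⟨c, hc, hpc, hcU, hcF⟩ := exists_chart_eqOn hU hpU hF _ hA
  let WT : Submodule ℝ (E × ℝ) := (W.restrictScalars ℝ).prod ⊤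
  refine ⟨c, hc, hpc, WT.comap (T : E7 →ₗ[ℝ] E × ℝ), ?_, ?_, ?_, ?_⟩
  · have h1 : WT.comap (T : E7 →ₗ[ℝ] E × ℝ) = WT.map (T.symm : E × ℝ →ₗ[ℝ] E7) :=
      Submodule.comap_equiv_eq_map_symm T.toLinearEquiv WT
    have h2 : Module.finrank ℝ (WT.map (T.symm : E × ℝ →ₗ[ℝ] E7)) = Module.finrank ℝ WT :=
      T.symm.toLinearEquiv.finrank_map_eq WT
    rw [h1, h2, finrank_prod_top]
    have h3 : Module.finrank ℝ (W.restrictScalars ℝ) = 2 * Module.finrank ℂ W :=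
      finrank_real_of_complex W
    rw [h3, hW]
  · intro q hq
    have h1 : c q ∈ WT.comap (T : E7 →ₗ[ℝ] E × ℝ) ↔ T (c q) ∈ WT := Iff.rfl
    rw [h1, hcF q hq, hTF, mem_preimage, hY _ (hcU hq).1]
    simp [WT]
  · intro u
    have h1 : u ∈ WT.comap (T : E7 →ₗ[ℝ] E × ℝ) ↔ T u ∈ WT := Iff.rfl
    rw [h1, hT]
    simp [WT]
  · intro u
    rw [tderiv_congr (g := F), hdF]
    filter_upwards [c.open_source.mem_nhds hpc] with q hq using hcF q hq

theorem isSubmanifold_preimage (hr : IsRegularOver s h π) (hdim : Module.finrank ℂ E = 3)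
    {Y : Set X} (hY : IsSubmanifold 𝓘(ℂ, E) ω 1 Y) : IsSubmanifold (𝓡 7) ∞ 3 (π ⁻¹' Y) := by
  intro p hp
  obtain ⟨e, he, hpe, W, hW, hYe⟩ := hY (π p) hp
  obtain ⟨c, hc, hpc, W', hW', hcY, -, -⟩ := hr.exists_adapted_chart hdim he hW hYe hpe
  exact ⟨c, hc, hpc, W', hW', hcY⟩

/-- The tangent space of the preimage of a complex curve. -/
theorem mem_tangentAt_preimage (hr : IsRegularOver s h π) (hdim : Module.finrank ℂ E = 3)
    {Y : Set X} {e : OpenPartialHomeomorph X E}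
    (he : e ∈ IsManifold.maximalAtlas 𝓘(ℂ, E) ω X) {W : Submodule ℂ E}
    (hW : Module.finrank ℂ W = 1) (hY : ∀ q ∈ e.source, (q ∈ Y ↔ e q ∈ W))
    {p : S} (hp : π p ∈ e.source) (hpY : π p ∈ Y) (u : E7) :
    u ∈ tangentAt (V := E7) (π ⁻¹' Y) p ↔ proj π e p u ∈ W := by
  obtain ⟨c, hc, hpc, W', hW', hcY, h1, h2⟩ := hr.exists_adapted_chart hdim he hW hY hp
  have h3 := mem_tangentSubspace_iff hc hcY hpc hpY u
  exact h3.trans ((h2 u).symm ▸ h1 u)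

theorem finrank_tangentAt_preimage (hr : IsRegularOver s h π)
    (hdim : Module.finrank ℂ E = 3) {Y : Set X} (hY : IsSubmanifold 𝓘(ℂ, E) ω 1 Y)
    {p : S} (hpY : π p ∈ Y) :
    Module.finrank ℝ (tangentAt (V := E7) (π ⁻¹' Y) p) = 3 := by
  obtain ⟨e, he, hpe, W, hW, hYe⟩ := hY (π p) hpY
  obtain ⟨c, hc, hpc, W', hW', hcY, h1, h2⟩ := hr.exists_adapted_chart hdim he hW hYe hpe
  have : tangentAt (V := E7) (π ⁻¹' Y) p = W' := by
    ext u
    rw [hr.mem_tangentAt_preimage hdim he hW hYe hpe hpY, h1]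
  rw [this, hW']

/-- The projection kills `ξ` and turns `Φ` into multiplication by `i`, and `W` is a complex
subspace. -/
theorem isInvariant_preimage [T2Space S] (hr : IsRegularOver s h π)
    (hdim : Module.finrank ℂ E = 3)
    {Y : Set X} (hY : IsSubmanifold 𝓘(ℂ, E) ω 1 Y) : s.IsInvariant (π ⁻¹' Y) := by
  intro p hp
  obtain ⟨e, he, hpe, W, hW, hYe⟩ := hY (π p) hp
  have h1 := hr.mem_tangentAt_preimage hdim he hW hYe hpe hp
  constructor
  · refine (h1 (s.reebAt p)).2 ?_
    rw [hr.proj_reeb]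
    exact W.zero_mem
  · intro u hu
    refine (h1 (s.PhiAt p u)).2 ?_
    have h2 := hr.proj_PhiAt he hpe (u : E7)
    exact h2 ▸ W.smul_mem Complex.I ((h1 u).1 hu)

end

end IsRegularOver

/-! ### Acceleration for the metric of a circle bundle; orthonormal expansions -/

section Calculus

variable {V : Type*} [NormedAddCommGroup V] [NormedSpace ℝ V]
  {E : Type*} [NormedAddCommGroup E] [NormedSpace ℝ E]

theorem deriv_mem_of_eventually_mem [FiniteDimensional ℝ E] {W : Submodule ℝ E} {f : ℝ → E} {t : ℝ}
    (h : ∀ᶠ s in 𝓝 t, f s ∈ W) : deriv f t ∈ W := by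
  by_cases hf : DifferentiableAt ℝ f t
  · have hcl : IsClosed (W : Set E) := W.closed_of_finiteDimensional
    refine hcl.mem_of_tendsto hf.hasDerivAt.tendsto_slope ?_
    filter_upwards [h.filter_mono nhdsWithin_le_nhds] with s hs
    rw [slope_def_module]
    exact W.smul_mem _ (W.sub_mem hs h.self_of_nhds)
  · rw [deriv_zero_of_not_differentiableAt hf]
    exact W.zero_mem

/-- The covariant acceleration of a curve, for a metric that is the sum of the pullback of a
metric under `k` and the square of a 1-form. -/
theorem acceleration_identity {y₀ : V} {k : V → E} (hk : ContDiffAt ℝ ∞ k y₀)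
    {B : E → E →L[ℝ] E →L[ℝ] ℝ} {D : E →L[ℝ] E →L[ℝ] E →L[ℝ] ℝ} (hB : HasFDerivAt B D (k y₀))
    (hsymm : ∀ a b, B (k y₀) a b = B (k y₀) b a)
    {θ : V → V →L[ℝ] ℝ} {θ' : V →L[ℝ] V →L[ℝ] ℝ} (hθ : HasFDerivAt θ θ' y₀)
    {c : ℝ → V} (hc : ContDiffAt ℝ ∞ c 0) (hc0 : c 0 = y₀) {n : V} (hn : θ y₀ n = 0)
    {G : V → V → V → ℝ} (hG : ∀ᶠ y in 𝓝 y₀, ∀ a b, G y a b =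
      B (k y) (fderiv ℝ k y a) (fderiv ℝ k y b) + θ y a * θ y b) {v : V} (hv : deriv c 0 = v) :
    G y₀ (deriv (deriv c) 0) n + fderiv ℝ (fun y => G y v n) y₀ v
      - fderiv ℝ (fun y => G y v v) y₀ n / 2 =
    B (k y₀) (deriv (deriv (fun s => k (c s))) 0) (fderiv ℝ k y₀ n)
      + (D (fderiv ℝ k y₀ v) (fderiv ℝ k y₀ v) (fderiv ℝ k y₀ n)
        - D (fderiv ℝ k y₀ n) (fderiv ℝ k y₀ v) (fderiv ℝ k y₀ v) / 2)
      + θ y₀ v * (θ' v n - θ' n v) := by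
  set K := fderiv ℝ k y₀ with hK
  have hkd : HasFDerivAt k K y₀ := (hk.differentiableAt (by simp)).hasFDerivAt
  have hk2 : HasFDerivAt (fderiv ℝ k) (fderiv ℝ (fderiv ℝ k) y₀) y₀ :=
    ((hk.fderiv_right (m := ∞) (by simp)).differentiableAt (by simp)).hasFDerivAt
  set K' := fderiv ℝ (fderiv ℝ k) y₀ with hK'
  have hsym : ∀ a b, K' a b = K' b a :=
    hk.isSymmSndFDerivAt two_le_infty
  have hKapp : ∀ a, HasFDerivAt (fun y => fderiv ℝ k y a) (K'.flip a) y₀ := fun a => by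
    have := hk2.clm_apply (hasFDerivAt_const a y₀)
    refine this.congr_fderiv ?_
    ext; simp
  have hθapp : ∀ a, HasFDerivAt (fun y => θ y a) (θ'.flip a) y₀ := fun a => by
    have := hθ.clm_apply (hasFDerivAt_const a y₀)
    refine this.congr_fderiv ?_
    ext; simp
  have hBk : HasFDerivAt (fun y => B (k y)) (D.comp K) y₀ := by
    refine HasFDerivAt.comp (g := B) y₀ ?_ hkd
    exact hB
  have hder : ∀ a b w, fderiv ℝ (fun y => G y a b) y₀ w =
      D (K w) (K a) (K b) + B (k y₀) (K' w a) (K b) + B (k y₀) (K a) (K' w b)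
        + (θ' w a * θ y₀ b + θ y₀ a * θ' w b) := by
    intro a b w
    have h1 : (fun y => G y a b) =ᶠ[𝓝 y₀] fun y =>
      B (k y) (fderiv ℝ k y a) (fderiv ℝ k y b) + θ y a * θ y b := hG.mono fun y hy => hy a b
    have h2 := ((hBk.clm_apply (hKapp a)).clm_apply (hKapp b)).add ((hθapp a).mul (hθapp b))
    have h3 := (h2.congr_of_eventuallyEq h1).fderiv
    rw [h3]
    simp
    ring
  have hcev : ∀ᶠ s in 𝓝 (0 : ℝ), ContDiffAt ℝ 2 c s ∧ ContDiffAt ℝ 2 k (c s) := by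
    have h1 : ContDiffAt ℝ 2 c 0 := hc.of_le (by exact WithTop.coe_le_coe.2 (le_top : (2 : ℕ∞) ≤ ⊤))
    have h2 : ContDiffAt ℝ 2 k (c 0) := hc0 ▸ hk.of_le (by exact WithTop.coe_le_coe.2 (le_top : (2 : ℕ∞) ≤ ⊤))
    exact (h1.eventually (by simp)).and (h1.continuousAt.eventually (h2.eventually (by simp)))
  have hdc : deriv (fun s => k (c s)) =ᶠ[𝓝 0] fun s => fderiv ℝ k (c s) (deriv c s) := by
    filter_upwards [hcev] with s hs
    exact ((hs.2.differentiableAt (by simp)).hasFDerivAt.comp_hasDerivAt s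
      (hs.1.differentiableAt (by simp)).hasDerivAt).deriv
  have hc1 : HasDerivAt c v 0 := hv ▸ (hc.differentiableAt (by simp)).hasDerivAt
  have hc2 : HasDerivAt (deriv c) (deriv (deriv c) 0) 0 := by
    have h1 : ContDiffAt ℝ ∞ (deriv c) 0 :=
      (hc.fderiv_right (m := ∞) (by simp)).clm_apply (contDiffAt_const (c := (1 : ℝ)))
    exact (h1.differentiableAt (by simp)).hasDerivAt
  have hacc : deriv (deriv (fun s => k (c s))) 0 = K' v v + K (deriv (deriv c) 0) := by
    rw [hdc.deriv_eq]
    have h1 : HasDerivAt (fun s => fderiv ℝ k (c s)) (K' v) 0 :=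
      HasFDerivAt.comp_hasDerivAt (0 : ℝ) (by rw [hc0]; exact hk2) hc1
    have h2 := (h1.clm_apply hc2).deriv
    rw [hv, hc0] at h2
    exact h2
  -- The term `B (K' v v) (K n)` combines with `B (K c'') (K n)` into the second derivative of `k ∘
  -- c`. The remaining second derivatives of `k` cancel by symmetry of `K'` and of `B`, and `θ n =
  -- 0` leaves only the skew part of `θ'`.
  rw [hG.self_of_nhds, hder, hder, hacc, hn, hsym n v, ← hK]
  simp only [map_add, add_apply]
  rw [hsymm (K v) (K' v n)]
  ring

/-- Expansion in an orthonormal basis of a subspace. -/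
theorem eq_sum_of_orthonormal [FiniteDimensional ℝ V] (g : V →L[ℝ] V →L[ℝ] ℝ) {k : ℕ}
    {T : Submodule ℝ V}
    (hT : Module.finrank ℝ T = k) {e : Fin k → V} (he : ∀ i, e i ∈ T)
    (hor : ∀ i j, g (e i) (e j) = if i = j then 1 else 0) {u : V} (hu : u ∈ T) :
    u = ∑ i, g (e i) u • e i := by
  have hcoef : ∀ c : Fin k → ℝ, ∀ i, g (e i) (∑ j, c j • e j) = c i := by
    intro c i
    simp [map_sum, hor]
  have hli : LinearIndependent ℝ (fun i => (⟨e i, he i⟩ : T)) := by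
    rw [Fintype.linearIndependent_iff]
    intro c hc i
    have h1 : ∑ j, c j • e j = 0 := by
      have := congrArg (T.subtype) hc
      simpa using this
    rw [← hcoef c i, h1, map_zero]
  have hspan : (⟨u, hu⟩ : T) ∈ Submodule.span ℝ (range fun i => (⟨e i, he i⟩ : T)) := by
    rw [hli.span_eq_top_of_card_eq_finrank' (by simp [hT])]
    trivial
  rw [Submodule.mem_span_range_iff_exists_fun] at hspan
  obtain ⟨c, hc⟩ := hspan
  have h1 : ∑ j, c j • e j = u := by
    have := congrArg (T.subtype) hc
    simpa using this
  rw [← h1]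
  simp only [hcoef]

/-- Parseval's identity; it suffices that one of the two vectors lies in `T`. -/
theorem sum_mul_of_orthonormal [FiniteDimensional ℝ V] (g : V →L[ℝ] V →L[ℝ] ℝ) {k : ℕ}
    {T : Submodule ℝ V}
    (hT : Module.finrank ℝ T = k) {e : Fin k → V} (he : ∀ i, e i ∈ T)
    (hor : ∀ i j, g (e i) (e j) = if i = j then 1 else 0) {u : V} (hu : u ∈ T) (v : V) :
    ∑ i, g (e i) u * g (e i) v = g u v := by
  conv_rhs => rw [eq_sum_of_orthonormal g hT he hor hu]
  simp

end Calculus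

/-! ### Riemannian metrics in charts -/

section MetricSmooth

variable {E : Type*} [NormedAddCommGroup E] [NormedSpace ℝ E] [FiniteDimensional ℝ E]
  {H : Type*} [TopologicalSpace H] {I : ModelWithCorners ℝ E H}
  {M : Type*} [TopologicalSpace M] [ChartedSpace H M] [IsManifold I ∞ M] [I.Boundaryless]
  {V : Type*} [NormedAddCommGroup V] [NormedSpace ℝ V] [FiniteDimensional ℝ V]

/-- A metric, on the model space. -/
def metricAt (g : Metric I M) (x : M) : E →L[ℝ] E →L[ℝ] ℝ := g.inner x

/-- The pullback of a metric under a map from a vector space, as a bilinear form. -/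
noncomputable def pullbackMetric (g : Metric I M) (f : V → M) (v : V) : V →L[ℝ] V →L[ℝ] ℝ :=
  (metricAt g (f v)).bilinearComp (tderiv 𝓘(ℝ, V) I f v)
    (tderiv 𝓘(ℝ, V) I f v)

theorem contDiffAt_pullbackMetric (g : Metric I M) {f : V → M} {v : V}
    (hf : ∀ᶠ w in 𝓝 v, ContMDiffAt 𝓘(ℝ, V) I ∞ f w) :
    ContDiffAt ℝ ∞ (pullbackMetric g f) v := by
  refine contDiffAt_clm_of_apply fun a => contDiffAt_clm_of_apply fun b => ?_
  have h1 := contMDiffAt_tderiv_apply hf a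
  have h2 := contMDiffAt_tderiv_apply hf b
  have h3 : ContMDiffAt 𝓘(ℝ, V) (I.prod 𝓘(ℝ, E →L[ℝ] E →L[ℝ] ℝ)) ∞ (fun w =>
      Bundle.TotalSpace.mk' (E →L[ℝ] E →L[ℝ] ℝ)
        (E := fun x : M => TangentSpace I x →L[ℝ] TangentSpace I x →L[ℝ] ℝ)
        (f w) (g.inner (f w))) v :=
    g.contMDiff.contMDiffAt.comp v hf.self_of_nhds
  have h4 : ContMDiffAt 𝓘(ℝ, V) (I.prod 𝓘(ℝ, ℝ)) ∞ (fun w =>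
      Bundle.TotalSpace.mk' ℝ (E := Bundle.Trivial M ℝ) (f w)
        (metricAt g (f w) (tderiv 𝓘(ℝ, V) I f w a) (tderiv 𝓘(ℝ, V) I f w b))) v :=
    ContMDiffAt.clm_bundle_apply₂ (F₁ := E) (F₂ := E) (F₃ := ℝ) h3 h1 h2
  simp only [Bundle.contMDiffAt_totalSpace] at h4
  exact h4.2.contDiffAt

/-- The definition is anchored at `γ 0`. Here it is moved to `p`, and the expression of `n` in the
chart at `p` is `n` itself. -/
theorem covariantAcceleration_eq (g : Metric I M) {γ : ℝ → M} {p : M} (hγ : γ 0 = p) (n : E) :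
    covariantAcceleration g γ (n : E) =
      pullbackMetric g (extChartAt I p).symm (extChartAt I p p)
          (deriv (deriv fun s => extChartAt I p (γ s)) 0) n
        + fderiv ℝ (fun y => pullbackMetric g (extChartAt I p).symm y
            (deriv (fun s => extChartAt I p (γ s)) 0) n) (extChartAt I p p)
            (deriv (fun s => extChartAt I p (γ s)) 0)
        - fderiv ℝ (fun y => pullbackMetric g (extChartAt I p).symm y
            (deriv (fun s => extChartAt I p (γ s)) 0)
            (deriv (fun s => extChartAt I p (γ s)) 0)) (extChartAt I p p) n / 2 := by
  subst hγ
  have h1 : (tderiv I 𝓘(ℝ, E) (extChartAt I (γ 0)) (γ 0) n : E) = n := by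
    rw [tderiv_extChartAt_self]; rfl
  have h2 : ∀ m : E, tderiv I 𝓘(ℝ, E) (extChartAt I (γ 0)) (γ 0) n = m →
      covariantAcceleration g γ (n : E) =
      pullbackMetric g (extChartAt I (γ 0)).symm (extChartAt I (γ 0) (γ 0))
          (deriv (deriv fun s => extChartAt I (γ 0) (γ s)) 0) m
        + fderiv ℝ (fun y => pullbackMetric g (extChartAt I (γ 0)).symm y
            (deriv (fun s => extChartAt I (γ 0) (γ s)) 0) m) (extChartAt I (γ 0) (γ 0))
            (deriv (fun s => extChartAt I (γ 0) (γ s)) 0)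
        - fderiv ℝ (fun y => pullbackMetric g (extChartAt I (γ 0)).symm y
            (deriv (fun s => extChartAt I (γ 0) (γ s)) 0)
            (deriv (fun s => extChartAt I (γ 0) (γ s)) 0)) (extChartAt I (γ 0) (γ 0)) m / 2 := by
    rintro m rfl
    rfl
  exact h2 n h1

end MetricSmooth

/-! ### The first-order consequence of the Kähler condition -/

namespace KahlerMetric

variable {E : Type*} [NormedAddCommGroup E] [NormedSpace ℂ E] [FiniteDimensional ℂ E]
  {X : Type*} [TopologicalSpace X] [ChartedSpace E X] [IsManifold 𝓘(ℂ, E) ω X]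
  (h : KahlerMetric E X)

/-- In a complex chart a Kähler metric is harmonic for complex lines, to first order. -/
theorem first_order_identity {e : OpenPartialHomeomorph X E}
    (he : e ∈ IsManifold.maximalAtlas 𝓘(ℂ, E) ω X) {z : E} (hz : z ∈ e.target)
    {D : E →L[ℝ] E →L[ℝ] E →L[ℝ] ℝ} (hD : HasFDerivAt (pullbackMetric h.g e.symm) D z) (w n : E) :
    (D w w n - D n w w / 2) + (D (Complex.I • w) (Complex.I • w) n
      - D n (Complex.I • w) (Complex.I • w) / 2) = 0 := by
  have hev : ∀ᶠ y in 𝓝 z, y ∈ e.target := e.open_target.mem_nhds hz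
  have hsm : ∀ᶠ y in 𝓝 z, ContMDiffAt 𝓘(ℝ, E) 𝓘(ℝ, E) ∞ e.symm y := hev.mono fun y hy =>
    contMDiffAt_symm_of_mem_maximalAtlas (mem_real_maximalAtlas he) hy
  have h1 := extDeriv_pullbackForm h.form_smooth hsm
  have hI : ∀ y ∈ e.target, ∀ a, tderiv 𝓘(ℝ, E) 𝓘(ℝ, E) e.symm y (Complex.I • a) =
      Complex.I • tderiv 𝓘(ℝ, E) 𝓘(ℝ, E) e.symm y a := fun y hy a =>
    tderiv_I_smul (contMDiffAt_symm_of_mem_maximalAtlas he hy) a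
  have hform : ∀ y ∈ e.target, ∀ a b, pullbackForm e.symm h.form y ![a, b] =
      pullbackMetric h.g e.symm y (Complex.I • a) b := by
    intro y hy a b
    rw [pullbackForm_two, h.form_formAt, ← hI y hy]
    rfl
  have hherm : ∀ y ∈ e.target, ∀ a b, pullbackMetric h.g e.symm y (Complex.I • a) (Complex.I • b) =
      pullbackMetric h.g e.symm y a b := by
    intro y hy a b
    have h2 := h.hermitianAt (e.symm y) (tderiv 𝓘(ℝ, E) 𝓘(ℝ, E) e.symm y a)
      (tderiv 𝓘(ℝ, E) 𝓘(ℝ, E) e.symm y b)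
    rw [← hI y hy, ← hI y hy] at h2
    exact h2
  have hder : ∀ a b, HasFDerivAt (fun y => pullbackMetric h.g e.symm y a b)
      ((D.flip a).flip b) z := by
    intro a b
    have h2 : HasFDerivAt (fun y => pullbackMetric h.g e.symm y a) (D.flip a) z := by
      have := hD.clm_apply (hasFDerivAt_const a z)
      refine this.congr_fderiv ?_
      ext; simp
    have := h2.clm_apply (hasFDerivAt_const b z)
    refine this.congr_fderiv ?_
    ext; simp
  have hsd : DifferentiableAt ℝ (pullbackForm e.symm h.form) z := by
    have h3 : ContDiffAt ℝ ∞ (pullbackForm e.symm h.form) z := by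
      refine ContDiffOn.contDiffAt (s := e.target) (contDiffOn_alternating fun v => ?_) hev
      intro y hy
      refine ContDiffAt.contDiffWithinAt ?_
      have hev' : ∀ᶠ y' in 𝓝 y, y' ∈ e.target := e.open_target.mem_nhds hy
      have h4 := contDiffAt_pullbackMetric h.g (f := e.symm) (v := y) (hev'.mono fun y hy =>
        contMDiffAt_symm_of_mem_maximalAtlas (mem_real_maximalAtlas he) hy)
      have h5 : ContDiffAt ℝ ∞ (fun y => pullbackMetric h.g e.symm y (Complex.I • v 0) (v 1)) y :=
        (h4.clm_apply contDiffAt_const).clm_apply contDiffAt_const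
      refine h5.congr_of_eventuallyEq (hev'.mono fun y' hy' => ?_)
      have h6 : v = ![v 0, v 1] := by
        ext i; fin_cases i <;> rfl
      have h7 := hform y' hy' (v 0) (v 1)
      rwa [← h6] at h7
    exact h3.differentiableAt (by simp)
  have hfd : ∀ a b v, fderiv ℝ (fun y => pullbackForm e.symm h.form y ![a, b]) z v =
      D v (Complex.I • a) b := by
    intro a b v
    have h2 : (fun y => pullbackForm e.symm h.form y ![a, b]) =ᶠ[𝓝 z]
      fun y => pullbackMetric h.g e.symm y (Complex.I • a) b := hev.mono fun y hy => hform y hy a b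
    rw [h2.fderiv_eq, (hder _ _).fderiv]
    rfl
  have hDherm : ∀ v a b, D v (Complex.I • a) (Complex.I • b) = D v a b := by
    intro v a b
    have h2 : (fun y => pullbackMetric h.g e.symm y (Complex.I • a) (Complex.I • b)) =ᶠ[𝓝 z]
      fun y => pullbackMetric h.g e.symm y a b := hev.mono fun y hy => hherm y hy a b
    have h3 := h2.fderiv_eq (𝕜 := ℝ)
    rw [(hder _ _).fderiv, (hder _ _).fderiv] at h3
    exact DFunLike.congr_fun h3 v
  -- Closedness of `ω = B(i·, ·)` is applied to `w`, `iw`, `n`. It reads `-D w w n - D (iw) (iw) n +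
  -- D n w w = 0`, and `D n (iw) (iw) = D n w w` because the metric is hermitian at every point of
  -- the chart.
  have h2 := extDeriv_two_apply hsd w (Complex.I • w) n
  rw [h1, h.form_closed, hfd, hfd, hfd] at h2
  have h3 : pullbackForm e.symm (0 : DiffForm 𝓘(ℝ, E) X 3 ℝ) z ![w, Complex.I • w, n] = 0 := rfl
  have h4 : Complex.I • Complex.I • w = -w := by
    rw [smul_smul, Complex.I_mul_I, neg_one_smul]
  rw [h3, hDherm, h4, map_neg, neg_apply] at h2
  rw [hDherm]
  linarith

end KahlerMetric

/-! ### The metric and the contact form of `S` in charts -/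

namespace IsRegularOver

noncomputable section

variable {S : Type*} [TopologicalSpace S] [ChartedSpace E7 S] [IsManifold (𝓡 7) ∞ S]
  [MulAction Circle S] {s : SasakiEinstein S}
  {E : Type*} [NormedAddCommGroup E] [NormedSpace ℂ E] [FiniteDimensional ℂ E]
  {X : Type*} [TopologicalSpace X] [ChartedSpace E X] [IsManifold 𝓘(ℂ, E) ω X]
  {h : KahlerMetric E X} {π : S → X}

theorem gAt_eq_pullbackMetric (hr : IsRegularOver s h π) {e : OpenPartialHomeomorph X E}
    (he : e ∈ IsManifold.maximalAtlas 𝓘(ℂ, E) ω X) {p : S} (hp : π p ∈ e.source) (u v : E7) :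
    s.gAt p u v = pullbackMetric h.g e.symm (e (π p)) (proj π e p u) (proj π e p v)
      + s.gAt p (s.reebAt p) u * s.gAt p (s.reebAt p) v := by
  have her := mem_real_maximalAtlas he
  have h1 : ∀ q, q = π p → SasakiGeometry.metricAt h.g q (tderiv (𝓡 7) 𝓘(ℝ, E) π p u)
      (tderiv (𝓡 7) 𝓘(ℝ, E) π p v) = h.gAt (π p) (tderiv (𝓡 7) 𝓘(ℝ, E) π p u)
      (tderiv (𝓡 7) 𝓘(ℝ, E) π p v) := by
    rintro _ rfl; rfl
  have h2 : pullbackMetric h.g e.symm (e (π p)) (proj π e p u) (proj π e p v) =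
      SasakiGeometry.metricAt h.g (e.symm (e (π p)))
        (tderiv 𝓘(ℝ, E) 𝓘(ℝ, E) e.symm (e (π p)) (tderiv 𝓘(ℝ, E) 𝓘(ℝ, E) e (π p)
          (tderiv (𝓡 7) 𝓘(ℝ, E) π p u)))
        (tderiv 𝓘(ℝ, E) 𝓘(ℝ, E) e.symm (e (π p)) (tderiv 𝓘(ℝ, E) 𝓘(ℝ, E) e (π p)
          (tderiv (𝓡 7) 𝓘(ℝ, E) π p v))) := rfl
  rw [h2, tderiv_maximalAtlas_symm her hp, tderiv_maximalAtlas_symm her hp,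
    h1 _ (e.left_inv hp), hr.metricAt]

/-- The contact form in the chart at `p`. -/
def chartContact (s : SasakiEinstein S) (p : S) (y : E7) : E7 →L[ℝ] ℝ :=
  (s.gAt ((extChartAt (𝓡 7) p).symm y) (s.reebAt ((extChartAt (𝓡 7) p).symm y))).comp
    (tderiv 𝓘(ℝ, E7) (𝓡 7) (extChartAt (𝓡 7) p).symm y)

theorem chartContact_eq (s : SasakiEinstein S) (p : S) (y v : E7) : chartContact s p y v =
    pullbackForm (extChartAt (𝓡 7) p).symm s.contactForm y ![v] := by
  rw [pullbackForm_one]; rfl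

theorem contDiffAt_chartContact (s : SasakiEinstein S) (p : S) :
    ContDiffAt ℝ ∞ (chartContact s p) (extChartAt (𝓡 7) p p) := by
  refine contDiffAt_clm_of_apply fun b => ?_
  simp only [chartContact_eq]
  exact ((ContinuousAlternatingMap.apply ℝ E7 ℝ ![b]).contDiff.contDiffAt).comp _
    ((s.contactForm_smooth p).contDiffAt
      ((isOpen_extChartAt_target p).mem_nhds (mem_extChartAt_target p)))

theorem tderiv_extChartAt_symm_self (p : S) (u : E7) :
    tderiv 𝓘(ℝ, E7) (𝓡 7) (extChartAt (𝓡 7) p).symm (extChartAt (𝓡 7) p p) u = u := by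
  have := tderiv_symm_extChartAt (I := 𝓡 7) (mem_extChartAt_source (I := 𝓡 7) p) u
  rw [tderiv_extChartAt_self (I := 𝓡 7)] at this
  exact this

/-- The identity `dη = 2Ω` in the chart at `p`; it evaluates the skew part of `θ'` in
`acceleration_identity`. -/
theorem fderiv_chartContact [T2Space S] (s : SasakiEinstein S) (p : S) (u v : E7) :
    fderiv ℝ (chartContact s p) (extChartAt (𝓡 7) p p) u v
      - fderiv ℝ (chartContact s p) (extChartAt (𝓡 7) p p) v u = 2 * s.OmegaAt p u v := by
  have hd := ((contDiffAt_chartContact s p).differentiableAt (by simp)).hasFDerivAt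
  have happ : ∀ a b, fderiv ℝ (fun y => pullbackForm (extChartAt (𝓡 7) p).symm s.contactForm y ![b])
      (extChartAt (𝓡 7) p p) a = fderiv ℝ (chartContact s p) (extChartAt (𝓡 7) p p) a b := by
    intro a b
    simp only [← chartContact_eq]
    have := (hd.clm_apply (hasFDerivAt_const b _)).fderiv
    rw [this]
    simp
  have h1 : DifferentiableAt ℝ (pullbackForm (extChartAt (𝓡 7) p).symm s.contactForm)
      (extChartAt (𝓡 7) p p) := ((s.contactForm_smooth p).contDiffAt
      ((isOpen_extChartAt_target p).mem_nhds (mem_extChartAt_target p))).differentiableAt (by simp)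
  have h2 := extDeriv_one_apply h1 u v
  rw [happ, happ] at h2
  rw [← h2]
  have h3 : ∀ᶠ y in 𝓝 (extChartAt (𝓡 7) p p),
      ContMDiffAt 𝓘(ℝ, E7) (𝓡 7) ∞ (extChartAt (𝓡 7) p).symm y := by
    filter_upwards [(isOpen_extChartAt_target p).mem_nhds (mem_extChartAt_target p)] with y hy
    exact contMDiffAt_extChartAt_symm p hy
  rw [extDeriv_pullbackForm s.contactForm_smooth h3, pullbackForm_two,
    tderiv_extChartAt_symm_self, tderiv_extChartAt_symm_self, extChartAt_to_inv]
  exact s.extDerivative_contactForm p u v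

end

end IsRegularOver

theorem IsCurveIn.mem_tangentAt {V : Type*} [NormedAddCommGroup V] [NormedSpace ℝ V] {M : Type*}
    [TopologicalSpace M] [ChartedSpace V M] {Y : Set M} {p : M} {v : V} {γ : ℝ → M}
    (hγ : IsCurveIn 𝓘(ℝ, V) Y p v γ) : v ∈ tangentAt (V := V) Y p := by
  have h : (v : TangentSpace 𝓘(ℝ, V) p) ∈ tangentSubspace 𝓘(ℝ, V) Y p :=
    Submodule.subset_span ⟨γ, hγ⟩
  exact h

/-! ### Traces over complex lines -/

section HermitianLine

variable {E : Type*} [NormedAddCommGroup E] [NormedSpace ℂ E] {B : E →L[ℝ] E →L[ℝ] ℝ}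
  {W : Submodule ℂ E}

/-- A complex line has an orthonormal basis `w`, `iw` for a hermitian metric. -/
theorem exists_hermitian_basis (hW : Module.finrank ℂ W = 1) (hBpos : ∀ w, w ≠ 0 → 0 < B w w)
    (hBI : ∀ a b, B (Complex.I • a) (Complex.I • b) = B a b) (hBsymm : ∀ a b, B a b = B b a) :
    ∃ w ∈ W, B w w = 1 ∧ B w (Complex.I • w) = 0 ∧
      ∀ a ∈ W, a = B a w • w + B a (Complex.I • w) • (Complex.I • w) := by
  obtain ⟨w₁, hw₁W, hw₁⟩ : ∃ w ∈ W, w ≠ 0 := by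
    refine W.exists_mem_ne_zero_of_ne_bot ?_
    rintro rfl
    simp at hW
  obtain ⟨w, hwW, hw1⟩ : ∃ w ∈ W, B w w = 1 := by
    refine ⟨(1 / √(B w₁ w₁)) • w₁, (W.restrictScalars ℝ).smul_mem _ hw₁W, ?_⟩
    have h1 := hBpos w₁ hw₁
    have h2 := Real.mul_self_sqrt h1.le
    have h3 : √(B w₁ w₁) ≠ 0 := (Real.sqrt_pos.2 h1).ne'
    simp only [map_smul, smul_apply, smul_eq_mul]
    field_simp
    nlinarith
  have hw0 : w ≠ 0 := by rintro rfl; simp at hw1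
  have hIw1 : B (Complex.I • w) (Complex.I • w) = 1 := by rw [hBI, hw1]
  have hII : ∀ a : E, Complex.I • Complex.I • a = -a := fun a => by
    rw [smul_smul, Complex.I_mul_I, neg_one_smul]
  have hwIw : B w (Complex.I • w) = 0 := by
    have h1 := hBI w (Complex.I • w)
    rw [hII, map_neg, hBsymm (Complex.I • w) w] at h1
    linarith
  refine ⟨w, hwW, hw1, hwIw, fun a ha => ?_⟩
  obtain ⟨z, hz⟩ : ∃ z : ℂ, z • w = a := by
    have h1 := (finrank_eq_one_iff_of_nonzero' (⟨w, hwW⟩ : W)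
      (fun h0 => hw0 (congrArg Subtype.val h0))).1 hW ⟨a, ha⟩
    obtain ⟨z, hz⟩ := h1
    exact ⟨z, congrArg Subtype.val hz⟩
  have h2 : a = z.re • w + z.im • (Complex.I • w) := by
    rw [← hz]
    nth_rw 1 [← Complex.re_add_im z]
    rw [add_smul, mul_smul]
    rfl
  have h3 : B a w = z.re := by
    rw [h2]
    simp [hw1, hBsymm (Complex.I • w) w, hwIw]
  have h4 : B a (Complex.I • w) = z.im := by
    rw [h2]
    simp [hIw1, hwIw]
  rw [h3, h4, ← h2]

/-- The trace over a Riemannian submersion onto a hermitian line of a form that is harmonic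
there. -/
theorem sum_eq_zero_of_hermitian {V : Type*} [NormedAddCommGroup V] [NormedSpace ℝ V]
    [FiniteDimensional ℝ V] (hW : Module.finrank ℂ W = 1) (hBpos : ∀ w, w ≠ 0 → 0 < B w w)
    (hBI : ∀ a b, B (Complex.I • a) (Complex.I • b) = B a b) (hBsymm : ∀ a b, B a b = B b a)
    (g : V →L[ℝ] V →L[ℝ] ℝ) {k : ℕ} {T : Submodule ℝ V}
    (hT : Module.finrank ℝ T = k) {f : Fin k → V} (hf : ∀ i, f i ∈ T)
    (hor : ∀ i j, g (f i) (f j) = if i = j then 1 else 0) (K : V →L[ℝ] E)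
    (hK : ∀ u ∈ T, K u ∈ W) (hlift : ∀ w ∈ W, ∃ u ∈ T, K u = w ∧ ∀ v, g v u = B (K v) w)
    (q : E →L[ℝ] E →L[ℝ] ℝ) (hq : ∀ w, q w w + q (Complex.I • w) (Complex.I • w) = 0) :
    ∑ i, q (K (f i)) (K (f i)) = 0 := by
  obtain ⟨w, hwW, hw1, hwIw, hexp⟩ := exists_hermitian_basis hW hBpos hBI hBsymm
  have hIwW : Complex.I • w ∈ W := W.smul_mem _ hwW
  obtain ⟨u₀, hu₀, hK₀, hg₀⟩ := hlift w hwW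
  obtain ⟨u₁, hu₁, hK₁, hg₁⟩ := hlift _ hIwW
  -- With `u₀`, `u₁` the lifts of `w`, `iw`, Parseval's identity says that the coordinates of the `K
  -- (f i)` with respect to `w` and `iw` have square sums one and mixed sum zero. The trace over the
  -- `f i` is thus `q w w + q (iw) (iw)`, and vectors in the kernel of `K` do not contribute.
  have p1 := sum_mul_of_orthonormal g hT hf hor hu₀ u₀
  have p2 := sum_mul_of_orthonormal g hT hf hor hu₁ u₁
  have p3 := sum_mul_of_orthonormal g hT hf hor hu₀ u₁
  simp only [hg₀, hg₁, hK₀, hK₁, hBI, hw1, hwIw] at p1 p2 p3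
  have hterm : ∀ i, q (K (f i)) (K (f i)) = (B (K (f i)) w * B (K (f i)) w) * q w w
      + (B (K (f i)) (Complex.I • w) * B (K (f i)) (Complex.I • w))
        * q (Complex.I • w) (Complex.I • w)
      + (B (K (f i)) w * B (K (f i)) (Complex.I • w))
        * (q w (Complex.I • w) + q (Complex.I • w) w) := by
    intro i
    have h1 := hexp _ (hK _ (hf i))
    generalize B (K (f i)) w = a at *
    generalize B (K (f i)) (Complex.I • w) = b at *
    rw [h1]
    simp only [map_add, map_smul, add_apply, smul_apply, smul_eq_mul]
    ring
  rw [Finset.sum_congr rfl fun i _ => hterm i, Finset.sum_add_distrib, Finset.sum_add_distrib,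
    ← Finset.sum_mul, ← Finset.sum_mul, ← Finset.sum_mul, p1, p2, p3]
  linarith [hq w]

end HermitianLine

/-! ### Minimality of the preimage -/

namespace IsRegularOver

noncomputable section

variable {S : Type*} [TopologicalSpace S] [ChartedSpace E7 S] [IsManifold (𝓡 7) ∞ S]
  [MulAction Circle S] {s : SasakiEinstein S}
  {E : Type*} [NormedAddCommGroup E] [NormedSpace ℂ E] [FiniteDimensional ℂ E]
  {X : Type*} [TopologicalSpace X] [ChartedSpace E X] [IsManifold 𝓘(ℂ, E) ω X]
  {h : KahlerMetric E X} {π : S → X}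

/-- The covariant acceleration of a curve in the preimage of a complex curve, in normal
directions, depends only on its velocity. -/
theorem covariantAcceleration_preimage [T2Space S] (hr : IsRegularOver s h π)
    (hdim : Module.finrank ℂ E = 3) {Y : Set X} {e : OpenPartialHomeomorph X E}
    (he : e ∈ IsManifold.maximalAtlas 𝓘(ℂ, E) ω X) {W : Submodule ℂ E}
    (hW : Module.finrank ℂ W = 1) (hY : ∀ q ∈ e.source, (q ∈ Y ↔ e q ∈ W))
    {p : S} (hp : π p ∈ e.source) (hpY : π p ∈ Y)
    {D : E →L[ℝ] E →L[ℝ] E →L[ℝ] ℝ} (hD : HasFDerivAt (pullbackMetric h.g e.symm) D (e (π p)))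
    {γ : ℝ → S} {v : E7} (hγ : IsCurveIn (𝓡 7) (π ⁻¹' Y) p v γ)
    {n : E7} (hn : ∀ u ∈ tangentAt (V := E7) (π ⁻¹' Y) p, s.gAt p u n = 0) :
    covariantAcceleration s.g γ (n : E7) =
      D (proj π e p v) (proj π e p v) (proj π e p n)
        - D (proj π e p n) (proj π e p v) (proj π e p v) / 2 := by
  have her := mem_real_maximalAtlas he
  have hT := hr.mem_tangentAt_preimage hdim he hW hY hp hpY
  set c := extChartAt (𝓡 7) p with hc
  have hyt : c p ∈ c.target := mem_extChartAt_target p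
  have hcp : c.symm (c p) = p := extChartAt_to_inv p
  -- In the chart at `p` the metric of `S` is the pullback under `k`, the coordinate form of `π`, of
  -- the base metric, plus the square of the contact form. This is the shape that
  -- `acceleration_identity` treats.
  let k : E7 → E := fun y => e (π (c.symm y))
  have hksm : ∀ y ∈ c.target, π (c.symm y) ∈ e.source → ContDiffAt ℝ ∞ k y := by
    intro y hy hy'
    rw [← contMDiffAt_iff_contDiffAt]
    exact (contMDiffAt_of_mem_maximalAtlas her hy').comp y
      ((hr.bundle.smooth (c.symm y)).comp y (contMDiffAt_extChartAt_symm p hy))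
  have hkd : ∀ y ∈ c.target, π (c.symm y) ∈ e.source → ∀ u, fderiv ℝ k y u =
      proj π e (c.symm y) (tderiv 𝓘(ℝ, E7) (𝓡 7) c.symm y u) := by
    intro y hy hy' u
    have h1 := (contMDiffAt_of_mem_maximalAtlas her hy').comp (c.symm y)
      (hr.bundle.smooth (c.symm y))
    rw [hr.proj_eq_tderiv he hy', ← tderiv_eq_fderiv]
    exact tderiv_comp_apply y (h1.mdifferentiableAt (by simp))
      ((contMDiffAt_extChartAt_symm p hy).mdifferentiableAt (by simp)) u
  have hev : ∀ᶠ y in 𝓝 (c p), y ∈ c.target ∧ π (c.symm y) ∈ e.source := by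
    have h1 : ContinuousAt (fun y => π (c.symm y)) (c p) :=
      hr.bundle.smooth.continuous.continuousAt.comp
        (contMDiffAt_extChartAt_symm p hyt).continuousAt
    refine ((isOpen_extChartAt_target p).eventually_mem hyt).and
      (h1.preimage_mem_nhds (e.open_source.mem_nhds ?_))
    simp only [hcp]
    exact hp
  have hkp : k (c p) = e (π p) := by simp only [k, hcp]
  have hkdp : ∀ u, fderiv ℝ k (c p) u = proj π e p u := by
    intro u
    rw [hkd (c p) hyt (by rwa [hcp]), tderiv_extChartAt_symm_self, hcp]
  have hcγ : ContDiffAt ℝ ∞ (fun t => c (γ t)) 0 := by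
    refine contDiffAt_extChartAt_comp (hγ.smooth 0) ?_
    rw [hγ.start]
    exact mem_extChartAt_source p
  have hcv : deriv (fun t => c (γ t)) 0 = v := by
    have hcd : MDifferentiableAt (𝓡 7) 𝓘(ℝ, E7) c p :=
      mdifferentiableAt_extChartAt (mem_chart_source _ p)
    rw [(hγ.hasDerivAt hcd).deriv, hc, tderiv_extChartAt_self (I := 𝓡 7)]
    rfl
  have hvT : v ∈ tangentAt (V := E7) (π ⁻¹' Y) p := hγ.mem_tangentAt
  have hreebT : s.reebAt p ∈ tangentAt (V := E7) (π ⁻¹' Y) p := by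
    rw [hT, hr.proj_reeb]
    exact W.zero_mem
  have hθn : s.gAt p (s.reebAt p) n = 0 := hn _ hreebT
  have hθp : ∀ u, chartContact s p (c p) u = s.gAt p (s.reebAt p) u := by
    intro u
    have h1 : chartContact s p (c p) u = s.gAt (c.symm (c p)) (s.reebAt (c.symm (c p)))
      (tderiv 𝓘(ℝ, E7) (𝓡 7) c.symm (c p) u) := rfl
    rw [h1, tderiv_extChartAt_symm_self, hcp]
  -- The skew part is `2 Ω(v, n) = 2 g(Φ v, n)`, which vanishes since `Φ v` is again tangent to the
  -- preimage.
  have hdθ : fderiv ℝ (chartContact s p) (c p) v n - fderiv ℝ (chartContact s p) (c p) n v = 0 := by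
    rw [fderiv_chartContact, s.OmegaAt_eq, hn _ ?_, mul_zero]
    rw [hT, hr.proj_PhiAt he hp]
    exact W.smul_mem _ ((hT v).1 hvT)
  have hsymm : ∀ a b, pullbackMetric h.g e.symm (k (c p)) a b =
      pullbackMetric h.g e.symm (k (c p)) b a := fun a b => h.g.symm _ _ _
  have key := acceleration_identity (k := k) (hksm _ hyt (by rwa [hcp]))
    (B := pullbackMetric h.g e.symm) (D := D) (by rw [hkp]; exact hD) hsymm
    ((contDiffAt_chartContact s p).differentiableAt (by simp)).hasFDerivAt hcγ
    (by simp only [hγ.start]) (n := n) (by rw [hθp, hθn])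
    (G := fun y a b => pullbackMetric s.g c.symm y a b) ?_ hcv
  · rw [covariantAcceleration_eq s.g hγ.start n, ← hc, hcv]
    refine key.trans ?_
    rw [hdθ, mul_zero, add_zero, hkdp, hkdp, hkp]
    -- The projected curve runs in the linear subspace `W`, and so do its first and second
    -- derivatives.
    have hacc : deriv (deriv fun t => k (c (γ t))) 0 ∈ W.restrictScalars ℝ := by
      refine deriv_mem_of_eventually_mem ?_
      have h1 : ∀ᶠ t in 𝓝 (0 : ℝ), k (c (γ t)) ∈ W.restrictScalars ℝ := by
        have h2 : ∀ᶠ q in 𝓝 p, q ∈ c.source ∧ π q ∈ e.source :=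
          ((isOpen_extChartAt_source p).eventually_mem (mem_extChartAt_source p)).and
            (hr.bundle.smooth.continuous.continuousAt.preimage_mem_nhds
              (e.open_source.mem_nhds hp))
        have h3 : ContinuousAt γ 0 := hγ.smooth.continuous.continuousAt
        rw [← hγ.start] at h2
        filter_upwards [hγ.mem, h3.eventually h2] with t ht ht'
        have h4 : k (c (γ t)) = e (π (γ t)) := by simp only [k, c.left_inv ht'.1]
        rw [h4]
        exact (hY _ ht'.2).1 ht
      filter_upwards [h1.eventually_nhds] with t ht
      exact deriv_mem_of_eventually_mem ht
    -- The horizontal lift `T⁻¹ (w, 0)` of `w` is tangent to the preimage, hence orthogonal to `n`.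
    have hperp : ∀ w ∈ W, pullbackMetric h.g e.symm (e (π p)) w (proj π e p n) = 0 := by
      intro w hw
      obtain ⟨T, hTs⟩ := hr.exists_splitting hdim he hp
      have h1 := hTs (T.symm (w, 0))
      rw [T.apply_symm_apply] at h1
      have h2 : proj π e p (T.symm (w, 0)) = w := (congrArg Prod.fst h1).symm
      have h3 := hn (T.symm (w, 0)) (by rw [hT, h2]; exact hw)
      rw [hr.gAt_eq_pullbackMetric he hp, h2, hθn, mul_zero, add_zero] at h3
      exact h3
    rw [hperp _ hacc, zero_add]
  · filter_upwards [hev] with y hy a b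
    have h1 : pullbackMetric s.g c.symm y a b = s.gAt (c.symm y)
      (tderiv 𝓘(ℝ, E7) (𝓡 7) c.symm y a) (tderiv 𝓘(ℝ, E7) (𝓡 7) c.symm y b) := rfl
    rw [h1, hr.gAt_eq_pullbackMetric he hy.2, hkd y hy.1 hy.2, hkd y hy.1 hy.2]
    rfl

/-- The preimage of a complex curve is a minimal submanifold. -/
theorem isMinimalSubmanifold_preimage [T2Space S] (hr : IsRegularOver s h π)
    (hdim : Module.finrank ℂ E = 3) {Y : Set X} (hY : IsSubmanifold 𝓘(ℂ, E) ω 1 Y) :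
    IsMinimalSubmanifold s.g 3 (π ⁻¹' Y) := by
  refine ⟨hr.isSubmanifold_preimage hdim hY, ?_⟩
  intro p hp f hf γ hγ n hn
  have hTdim := hr.finrank_tangentAt_preimage hdim hY hp
  obtain ⟨e, he, hpe, W, hW, hYe⟩ := hY (π p) hp
  have her := mem_real_maximalAtlas he
  have hT := hr.mem_tangentAt_preimage hdim he hW hYe hpe hp
  have hsm : ∀ᶠ y in 𝓝 (e (π p)), ContMDiffAt 𝓘(ℝ, E) 𝓘(ℝ, E) ∞ e.symm y := by
    filter_upwards [e.open_target.mem_nhds (e.map_source hpe)] with y hy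
    exact contMDiffAt_symm_of_mem_maximalAtlas her hy
  have hD := ((contDiffAt_pullbackMetric h.g hsm).differentiableAt (by simp)).hasFDerivAt
  set D := fderiv ℝ (pullbackMetric h.g e.symm) (e (π p)) with hDdef
  have hacc : ∀ i, covariantAcceleration s.g (γ i) (n : E7) = _ := fun i =>
    hr.covariantAcceleration_preimage hdim he hW hYe hpe hp hD (hγ i) hn
  have hsum : ∀ i ∈ Finset.univ, covariantAcceleration s.g (γ i) (n : E7) = _ := fun i _ => hacc i
  refine (Finset.sum_congr rfl hsum).trans ?_
  set B := pullbackMetric h.g e.symm (e (π p)) with hB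
  have hgB := hr.gAt_eq_pullbackMetric he hpe
  obtain ⟨T, hTs⟩ := hr.exists_splitting hdim he hpe
  have hTs1 : ∀ w, proj π e p (T.symm (w, 0)) = w := fun w => by
    have h1 := hTs (T.symm (w, 0))
    rw [T.apply_symm_apply] at h1
    exact (congrArg Prod.fst h1).symm
  have hTs2 : ∀ w, s.gAt p (s.reebAt p) (T.symm (w, 0)) = 0 := fun w => by
    have h1 := hTs (T.symm (w, 0))
    rw [T.apply_symm_apply] at h1
    exact (congrArg Prod.snd h1).symm
  -- `T⁻¹ (w, 0)` is the horizontal lift of `w`; pairing with it in `g` is pairing with `w` in `B`.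
  -- These are the lifts required by `sum_eq_zero_of_hermitian`.
  have hlift : ∀ u w, s.gAt p u (T.symm (w, 0)) = B (proj π e p u) w := fun u w => by
    rw [hgB, hTs1, hTs2, mul_zero, add_zero]
  have hBpos : ∀ w, w ≠ 0 → 0 < B w w := by
    intro w hw
    have h1 := hlift (T.symm (w, 0)) w
    rw [hTs1] at h1
    rw [← h1]
    refine s.gAt_pos p fun h0 => hw ?_
    rw [← hTs1 w, h0, map_zero]
  have hBI : ∀ a b, B (Complex.I • a) (Complex.I • b) = B a b := by
    intro a b
    have hz := e.map_source hpe
    have h1 := fun a => tderiv_I_smul (contMDiffAt_symm_of_mem_maximalAtlas he hz) a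
    have h2 := h.hermitianAt (e.symm (e (π p))) (tderiv 𝓘(ℝ, E) 𝓘(ℝ, E) e.symm (e (π p)) a)
      (tderiv 𝓘(ℝ, E) 𝓘(ℝ, E) e.symm (e (π p)) b)
    rw [← h1, ← h1] at h2
    exact h2
  have hBsymm : ∀ a b, B a b = B b a := fun a b => h.g.symm _ _ _
  -- What is left of the acceleration in the direction `n`, as a bilinear form in the projected
  -- velocity; its trace over `w`, `iw` vanishes by the Kähler condition.
  let q : E →L[ℝ] E →L[ℝ] ℝ :=
    ((ContinuousLinearMap.apply ℝ ℝ (proj π e p n)).compL ℝ E (E →L[ℝ] ℝ) ℝ) ∘L D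
      - (2⁻¹ : ℝ) • D (proj π e p n)
  have hq : ∀ a b, q a b = D a b (proj π e p n) - D (proj π e p n) a b / 2 := by
    intro a b
    simp [q]
    ring
  have hQ := sum_eq_zero_of_hermitian hW hBpos hBI hBsymm (s.gAt p) hTdim (f := f) hf.mem
    hf.orthonormal (proj π e p) (fun u hu => (hT u).1 hu)
    (fun w hw => ⟨T.symm (w, 0), (hT _).2 (by rw [hTs1]; exact hw), hTs1 w, fun v => hlift v w⟩)
    q (fun w => by rw [hq, hq]; exact h.first_order_identity he (e.map_source hpe) hD w _)
  simp only [hq] at hQ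
  exact hQ

end

end IsRegularOver

/-! ### Wedge products and orthonormal frames -/

section Wedge

variable {V : Type*} [NormedAddCommGroup V] [NormedSpace ℝ V]

theorem alternating_two_add_right (α : V [⋀^Fin 2]→L[ℝ] ℝ) (u v v' : V) :
    α ![u, v + v'] = α ![u, v] + α ![u, v'] := by
  rw [alternating_two_swap, alternating_two_add_left, alternating_two_swap α u v,
    alternating_two_swap α u v']
  ring

theorem alternating_two_smul_right (α : V [⋀^Fin 2]→L[ℝ] ℝ) (c : ℝ) (u v : V) :
    α ![u, c • v] = c * α ![u, v] := by
  rw [alternating_two_swap, alternating_two_smul_left, alternating_two_swap α u v]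
  ring

theorem alternating_two_self (α : V [⋀^Fin 2]→L[ℝ] ℝ) (u : V) : α ![u, u] = 0 := by
  have := alternating_two_swap α u u
  linarith

/-- The wedge product of a 2-form and a 1-form. -/
def wedgeTwoOne (α : V [⋀^Fin 2]→L[ℝ] ℝ) (β : V →L[ℝ] ℝ) : V [⋀^Fin 3]→L[ℝ] ℝ where
  toFun e := α ![e 0, e 1] * β (e 2) + α ![e 1, e 2] * β (e 0) + α ![e 2, e 0] * β (e 1)
  map_update_add' := by
    intro inst m i x y
    obtain rfl : inst = instDecidableEqFin 3 := Subsingleton.elim _ _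
    fin_cases i <;>
      simp [Function.update, alternating_two_add_left, alternating_two_add_right] <;> ring
  map_update_smul' := by
    intro inst m i c x
    obtain rfl : inst = instDecidableEqFin 3 := Subsingleton.elim _ _
    fin_cases i <;>
      simp [Function.update, alternating_two_smul_left, alternating_two_smul_right] <;> ring
  map_eq_zero_of_eq' := by
    intro v i j hij hne
    fin_cases i <;> fin_cases j <;> simp at hij hne <;>
      simp only [hij, alternating_two_self, alternating_two_swap α (v 1) (v 0),
        alternating_two_swap α (v 2) (v 0), alternating_two_swap α (v 2) (v 1)] <;> ring
  cont := by
    have h : ∀ i j : Fin 3, Continuous fun e : Fin 3 → V => α ![e i, e j] := by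
      intro i j
      refine α.cont.comp (continuous_pi fun l => ?_)
      fin_cases l
      · exact continuous_apply i
      · exact continuous_apply j
    have h' : ∀ i : Fin 3, Continuous fun e : Fin 3 → V => β (e i) := fun i =>
      β.continuous.comp (continuous_apply i)
    exact (((h 0 1).mul (h' 2)).add ((h 1 2).mul (h' 0))).add ((h 2 0).mul (h' 1))

theorem wedgeTwoOne_apply (α : V [⋀^Fin 2]→L[ℝ] ℝ) (β : V →L[ℝ] ℝ) (e : Fin 3 → V) :
    wedgeTwoOne α β e =
      α ![e 0, e 1] * β (e 2) + α ![e 1, e 2] * β (e 0) + α ![e 2, e 0] * β (e 1) := rfl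

/-- Two orthonormal bases of a subspace differ by a matrix of determinant `±1`. -/
theorem exists_det_of_orthonormal [FiniteDimensional ℝ V] (g : V →L[ℝ] V →L[ℝ] ℝ) {k : ℕ}
    {T : Submodule ℝ V} (hT : Module.finrank ℝ T = k) {e f : Fin k → V}
    (he : ∀ i, e i ∈ T) (heo : ∀ i j, g (e i) (e j) = if i = j then 1 else 0)
    (hf : ∀ i, f i ∈ T) (hfo : ∀ i j, g (f i) (f j) = if i = j then 1 else 0) :
    ∃ d : ℝ, d * d = 1 ∧ ∀ A : V [⋀^Fin k]→ₗ[ℝ] ℝ, A e = d * A f := by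
  classical
  have hcoef : ∀ c : Fin k → ℝ, ∀ i, g (f i) (∑ j, c j • f j) = c i := by
    intro c i
    simp [map_sum, hfo]
  have hli : LinearIndependent ℝ (fun i => (⟨f i, hf i⟩ : T)) := by
    rw [Fintype.linearIndependent_iff]
    intro c hc i
    have h1 : ∑ j, c j • f j = 0 := by
      have := congrArg (T.subtype) hc
      simpa using this
    rw [← hcoef c i, h1, map_zero]
  let b := basisOfLinearIndependentOfCardEqFinrank' _ hli (by simp [hT])
  have hb : ∀ i, b i = ⟨f i, hf i⟩ := fun i => by simp [b]
  have hrepr : ∀ (u : T) i, b.repr u i = g (f i) u := by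
    intro u i
    have h1 := b.sum_repr u
    have h2 : ∑ j, b.repr u j • f j = u := by
      have := congrArg (T.subtype) h1
      simpa [hb] using this
    conv_rhs => rw [← h2]
    rw [hcoef]
  let e' : Fin k → T := fun i => ⟨e i, he i⟩
  refine ⟨b.det e', ?_, fun A => ?_⟩
  · rw [Module.Basis.det_apply, ← Matrix.det_transpose]
    nth_rw 2 [← Matrix.det_transpose]
    rw [Matrix.transpose_transpose, ← Matrix.det_mul]
    -- The matrix of one orthonormal basis in another is orthogonal, by Parseval's identity; hence
    -- its determinant has square one.
    have h1 : (b.toMatrix e').transpose * b.toMatrix e' = 1 := by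
      ext i j
      rw [Matrix.mul_apply, Matrix.one_apply, ← heo,
        ← sum_mul_of_orthonormal g hT hf hfo (he i) (e j)]
      refine Finset.sum_congr rfl fun l _ => ?_
      simp [Matrix.transpose_apply, Module.Basis.toMatrix_apply, hrepr, e']
    rw [h1, Matrix.det_one]
  · have h1 := (A.compLinearMap T.subtype).eq_smul_basis_det b
    have h2 := congrArg (fun F : T [⋀^Fin k]→ₗ[ℝ] ℝ => F e') h1
    have h3 : (T.subtype ∘ b) = f := by
      funext i; simp [hb]
    have h4 : (T.subtype ∘ e') = e := rfl
    simp only [AlternatingMap.compLinearMap_apply, AlternatingMap.smul_apply, smul_eq_mul] at h2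
    have h5 : A e = A f * b.det e' := by
      rw [← h3, ← h4]; exact h2
    rw [h5, mul_comm]

end Wedge

/-! ### The forms `Ω ∧ η` and `Ψ` -/

namespace SasakiEinstein

noncomputable section

variable {S : Type*} [TopologicalSpace S] [ChartedSpace E7 S] [IsManifold (𝓡 7) ∞ S]
  (s : SasakiEinstein S)

/-- The 3-form `Ω ∧ η`, on the model space. -/
def OmegaEtaAt (x : S) : E7 [⋀^Fin 3]→L[ℝ] ℝ :=
  wedgeTwoOne ((formAt s.kahlerForm ((x, PosReal.one) : Cone S)).compContinuousLinearMap
    (ContinuousLinearMap.inl ℝ E7 ℝ)) (s.gAt x (s.reebAt x))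

/-- The 3-form `Ω ∧ η`. -/
def OmegaEta : DiffForm (𝓡 7) S 3 ℝ := fun x => s.OmegaEtaAt x

theorem OmegaEtaAt_apply (x : S) (e : Fin 3 → E7) : s.OmegaEtaAt x e =
    s.OmegaAt x (e 0) (e 1) * s.gAt x (s.reebAt x) (e 2)
      + s.OmegaAt x (e 1) (e 2) * s.gAt x (s.reebAt x) (e 0)
      + s.OmegaAt x (e 2) (e 0) * s.gAt x (s.reebAt x) (e 1) := by
  have h : ∀ u v : E7, (formAt s.kahlerForm ((x, PosReal.one) : Cone S)).compContinuousLinearMap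
      (ContinuousLinearMap.inl ℝ E7 ℝ) ![u, v] = s.OmegaAt x u v := by
    intro u v
    rw [ContinuousAlternatingMap.compContinuousLinearMap_apply]
    have h1 : (⇑(ContinuousLinearMap.inl ℝ E7 ℝ) ∘ ![u, v]) = ![(u, 0), (v, 0)] := by
      funext i; fin_cases i <;> rfl
    rw [h1]
    rfl
  rw [OmegaEtaAt, wedgeTwoOne_apply, h, h, h]

/-- `Ω` and `η` are both components of the Kähler form of the cone along `r = 1`, so the chart
expression is a polynomial in smooth functions. -/
theorem OmegaEta_smooth : IsSmoothForm s.OmegaEta := by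
  intro x
  rw [formInChart_eq]
  refine contDiffOn_alternating fun v => ?_
  have hmem : ∀ y ∈ (extChartAt (𝓡 7) x).target, (y, (1 : ℝ)) ∈
      (extChartAt ConeModel ((x, PosReal.one) : Cone S)).target := fun y hy =>
    (cone_mem_target x _).2 ⟨hy, one_pos⟩
  have h2 : ContDiffOn ℝ ∞ (fun y : E7 => s.chartKahler x (y, 1)) (extChartAt (𝓡 7) x).target :=
      (s.contDiffOn_chartKahler x).comp (contDiff_id.prodMk contDiff_const).contDiffOn hmem
  have h3 : ∀ a b : E7 × ℝ, ContDiffOn ℝ ∞ (fun y : E7 => s.chartKahler x (y, 1) ![a, b])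
      (extChartAt (𝓡 7) x).target := fun a b =>
    (ContinuousAlternatingMap.apply ℝ (E7 × ℝ) ℝ ![a, b]).contDiff.comp_contDiffOn h2
  have h4 := (((h3 (v 0, 0) (v 1, 0)).mul (h3 (0, 1) (v 2, 0))).add
    ((h3 (v 1, 0) (v 2, 0)).mul (h3 (0, 1) (v 0, 0)))).add
    ((h3 (v 2, 0) (v 0, 0)).mul (h3 (0, 1) (v 1, 0)))
  refine h4.congr fun y hy => ?_
  have h5 : ∀ a b : E7, s.chartKahler x (y, 1) ![(a, 0), (b, 0)] =
      s.OmegaAt ((extChartAt (𝓡 7) x).symm y)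
        (tderiv 𝓘(ℝ, E7) (𝓡 7) (extChartAt (𝓡 7) x).symm y a)
        (tderiv 𝓘(ℝ, E7) (𝓡 7) (extChartAt (𝓡 7) x).symm y b) := by
    intro a b
    rw [chartKahler_apply, tderiv_cone_symm x _ (hmem y hy), tderiv_cone_symm x _ (hmem y hy),
      cone_symm_apply x _ y one_pos, ← kahlerForm_formAt]
    rfl
  have h6 : ∀ a : E7, s.chartKahler x (y, 1) ![(0, 1), (a, 0)] =
      s.gAt ((extChartAt (𝓡 7) x).symm y) (s.reebAt ((extChartAt (𝓡 7) x).symm y))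
        (tderiv 𝓘(ℝ, E7) (𝓡 7) (extChartAt (𝓡 7) x).symm y a) := by
    intro a
    rw [← s.chartContact_apply x hy, pullbackForm_one]
    rfl
  simp only [h5, h6]
  exact s.OmegaEtaAt_apply ((extChartAt (𝓡 7) x).symm y)
    (fun i => tderiv 𝓘(ℝ, E7) (𝓡 7) (extChartAt (𝓡 7) x).symm y (v i))

/-- The horizontal volume form, as an alternating map. -/
def PsiAt (x : S) : E7 [⋀^Fin 3]→ₗ[ℝ] ℂ :=
  ((formAt s.volumeForm ((x, PosReal.one) : Cone S)).toAlternatingMap.curryLeft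
    ((0, 1) : E7 × ℝ)).compLinearMap (LinearMap.inl ℝ E7 ℝ)

theorem PsiAt_apply (x : S) (e : Fin 3 → E7) : s.PsiAt x e =
    formAt s.volumeForm ((x, PosReal.one) : Cone S) ![(0, 1), (e 0, 0), (e 1, 0), (e 2, 0)] := by
  have h1 : (Matrix.vecCons ((0, 1) : E7 × ℝ) (fun i => LinearMap.inl ℝ E7 ℝ (e i))) =
      ![(0, 1), (e 0, 0), (e 1, 0), (e 2, 0)] := by
    funext i; fin_cases i <;> rfl
  rw [← h1]
  rfl

theorem horizontalVolumeForm_eq (x : S) (e : Fin 3 → E7) :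
    s.horizontalVolumeForm x e = s.PsiAt x e := by
  rw [PsiAt_apply]; rfl

/-- `ξ = J ∂_r`, and a form of type `(4, 0)` gives `Υ(J ∂_r, ∂_r, ·, ·) = i Υ(∂_r, ∂_r, ·, ·) = 0`.
-/
theorem PsiAt_reeb (x : S) (u v : E7) : s.PsiAt x ![s.reebAt x, u, v] = 0 := by
  rw [PsiAt_apply]
  set Υ := formAt s.volumeForm ((x, PosReal.one) : Cone S) with hΥ
  have h1 : Υ ![s.JAt (x, PosReal.one) (0, 1), (0, 1), (u, 0), (v, 0)] =
      Complex.I * Υ ![(0, 1), (0, 1), (u, 0), (v, 0)] :=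
    s.volumeForm_type (x, PosReal.one) (0, 1) (0, 1) (u, 0) (v, 0)
  have h2 : Υ ![((0, 1) : E7 × ℝ), (0, 1), (u, 0), (v, 0)] = 0 :=
    Υ.map_eq_zero_of_eq _ (i := 0) (j := 1) rfl (by decide)
  rw [h2, mul_zero, JAt_radial'] at h1
  have h3 := Υ.toAlternatingMap.map_swap ![(s.reebAt x, 0), (0, 1), (u, 0), (v, 0)]
    (i := 0) (j := 1) (by decide)
  have h4 : ![((s.reebAt x, 0) : E7 × ℝ), (0, 1), (u, 0), (v, 0)] ∘ Equiv.swap (0 : Fin 4) 1 =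
      ![(0, 1), (s.reebAt x, 0), (u, 0), (v, 0)] := by
    funext i; fin_cases i <;> rfl
  rw [h4] at h3
  have h5 : Υ ![(0, 1), (s.reebAt x, 0), (u, 0), (v, 0)] =
    - Υ ![(s.reebAt x, 0), (0, 1), (u, 0), (v, 0)] := h3
  rw [h1, neg_zero] at h5
  exact h5

theorem g2Form_eq (t : ℝ) (x : S) (e : Fin 3 → E7) : s.g2Form t x e =
    s.OmegaEtaAt x e + Real.cos t * (s.PsiAt x e).re + Real.sin t * (s.PsiAt x e).im := by
  rw [OmegaEtaAt_apply, ← horizontalVolumeForm_eq]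
  rfl

end

end SasakiEinstein

/-! ### Associativity of the preimage -/

namespace IsRegularOver

noncomputable section

variable {S : Type*} [TopologicalSpace S] [ChartedSpace E7 S] [IsManifold (𝓡 7) ∞ S]
  [MulAction Circle S] {s : SasakiEinstein S}
  {E : Type*} [NormedAddCommGroup E] [NormedSpace ℂ E] [FiniteDimensional ℂ E]
  {X : Type*} [TopologicalSpace X] [ChartedSpace E X] [IsManifold 𝓘(ℂ, E) ω X]
  {h : KahlerMetric E X} {π : S → X}

/-- The tangent space of the preimage of a complex curve has an orthonormal basis `ξ`, `u`,
`Φ u`. -/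
theorem exists_frame [T2Space S] (hr : IsRegularOver s h π)
    (hdim : Module.finrank ℂ E = 3) {Y : Set X} (hY : IsSubmanifold 𝓘(ℂ, E) ω 1 Y)
    {p : S} (hp : π p ∈ Y) : ∃ u : E7,
      (∀ i, ![s.reebAt p, u, s.PhiAt p u] i ∈ tangentAt (V := E7) (π ⁻¹' Y) p) ∧
      s.gAt p (s.reebAt p) u = 0 ∧ s.gAt p u u = 1 := by
  obtain ⟨e, he, hpe, W, hW, hYe⟩ := hY (π p) hp
  have hT := hr.mem_tangentAt_preimage hdim he hW hYe hpe hp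
  obtain ⟨T, hTs⟩ := hr.exists_splitting hdim he hpe
  obtain ⟨w, hwW, hw0⟩ : ∃ w ∈ W, w ≠ 0 := by
    refine W.exists_mem_ne_zero_of_ne_bot ?_
    rintro rfl
    simp at hW
  have h1 := hTs (T.symm (w, 0))
  rw [T.apply_symm_apply] at h1
  have h2 : proj π e p (T.symm (w, 0)) = w := (congrArg Prod.fst h1).symm
  have h3 : s.gAt p (s.reebAt p) (T.symm (w, 0)) = 0 := (congrArg Prod.snd h1).symm
  set u₁ := T.symm (w, 0) with hu₁
  have hpos : 0 < s.gAt p u₁ u₁ := s.gAt_pos p fun h0 => hw0 (by rw [← h2, h0, map_zero])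
  have hu : (1 / √(s.gAt p u₁ u₁)) • u₁ ∈ tangentAt (V := E7) (π ⁻¹' Y) p :=
    Submodule.smul_mem _ _ ((hT _).2 (by rw [h2]; exact hwW))
  refine ⟨(1 / √(s.gAt p u₁ u₁)) • u₁, ?_, ?_, ?_⟩
  · intro i
    fin_cases i
    · refine (hT _).2 ?_
      exact (hr.proj_reeb e p).symm ▸ W.zero_mem
    · exact hu
    · refine (hT _).2 ?_
      exact (hr.proj_PhiAt he hpe _).symm ▸ W.smul_mem Complex.I ((hT _).1 hu)
  · rw [map_smul, h3, smul_zero]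
  · have h4 := Real.mul_self_sqrt hpos.le
    have h5 : √(s.gAt p u₁ u₁) ≠ 0 := (Real.sqrt_pos.2 hpos).ne'
    simp only [map_smul, smul_apply, smul_eq_mul]
    field_simp
    nlinarith

/-- On orthonormal frames of the preimage of a complex curve, `Ω ∧ η` is `±1` and the horizontal
volume form vanishes. -/
theorem forms_on_frame [T2Space S] (hr : IsRegularOver s h π)
    (hdim : Module.finrank ℂ E = 3) {Y : Set X} (hY : IsSubmanifold 𝓘(ℂ, E) ω 1 Y)
    {p : S} (hp : π p ∈ Y) {e : Fin 3 → E7}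
    (he : ∀ i, e i ∈ tangentAt (V := E7) (π ⁻¹' Y) p)
    (heo : ∀ i j, s.gAt p (e i) (e j) = if i = j then 1 else 0) :
    s.OmegaEtaAt p e * s.OmegaEtaAt p e = 1 ∧ s.PsiAt p e = 0 := by
  obtain ⟨u, hf, hu1, hu2⟩ := hr.exists_frame hdim hY hp
  have hT := hr.finrank_tangentAt_preimage hdim hY hp
  have hPu := s.gAt_reeb_PhiAt p u
  have hPP := s.gAt_PhiAt_PhiAt p u u
  rw [hu1, hu2, mul_zero, sub_zero] at hPP
  have hPl := s.gAt_PhiAt_left p u u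
  have hsy1 := s.gAt_symm p u (s.PhiAt p u)
  have hsy2 := s.gAt_symm p u (s.reebAt p)
  have hsy3 := s.gAt_symm p (s.PhiAt p u) (s.reebAt p)
  have hrr := s.gAt_reeb_reeb p
  have hfo : ∀ i j, s.gAt p (![s.reebAt p, u, s.PhiAt p u] i) (![s.reebAt p, u, s.PhiAt p u] j) =
      if i = j then 1 else 0 := by
    intro i j
    fin_cases i <;> fin_cases j <;> simp <;> linarith [hu1, hu2]
  -- The tangent space has dimension three, so on orthonormal frames a 3-form is determined up to
  -- sign by its value on the adapted frame `ξ`, `u`, `Φ u`.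
  obtain ⟨d, hd, hA⟩ := exists_det_of_orthonormal (s.gAt p) hT he heo hf hfo
  have hν : s.OmegaEtaAt p ![s.reebAt p, u, s.PhiAt p u] = 1 := by
    rw [s.OmegaEtaAt_apply]
    simp [s.OmegaAt_eq, hu1, hrr, hPu, hPP]
  have hre := hA (Complex.reLm.compAlternatingMap (s.PsiAt p))
  have him := hA (Complex.imLm.compAlternatingMap (s.PsiAt p))
  have hν' : s.OmegaEtaAt p e = d * s.OmegaEtaAt p ![s.reebAt p, u, s.PhiAt p u] :=
    hA (s.OmegaEtaAt p).toAlternatingMap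
  simp only [LinearMap.compAlternatingMap_apply, s.PsiAt_reeb, map_zero, mul_zero] at hre him
  refine ⟨by rw [hν', hν, mul_one, hd], Complex.ext hre him⟩

/-- The preimage of a complex curve is associative. -/
theorem isAssociative_preimage [T2Space S] (hr : IsRegularOver s h π)
    (hdim : Module.finrank ℂ E = 3) {Y : Set X} (hY : IsSubmanifold 𝓘(ℂ, E) ω 1 Y) (t : ℝ) :
    IsAssociative s.g (s.g2Form t) s.OmegaEta (π ⁻¹' Y) where
  submanifold := hr.isSubmanifold_preimage hdim hY
  smooth := s.OmegaEta_smooth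
  orients p hp e he h0 := by
    have h1 := (hr.forms_on_frame hdim hY hp he.mem he.orthonormal).1
    have h2 : s.OmegaEtaAt p e = 0 := h0
    rw [h2] at h1
    simp at h1
  calibrated p hp e he h0 := by
    have h1 := hr.forms_on_frame hdim hY hp he.mem he.orthonormal
    have h2 : 0 < s.OmegaEtaAt p e := h0
    have h3 := s.g2Form_eq t p e
    -- `Ψ` vanishes on the frame, so `t` drops out; `Ω ∧ η` is positive with square one, hence equal
    -- to one.
    rw [h1.2] at h3
    refine h3.trans ?_
    simp only [Complex.zero_re, Complex.zero_im, mul_zero, add_zero]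
    nlinarith [h1.1]

end

end IsRegularOver

/-! ### The projective line and the curves `ℂP¹ × {p}` -/

section ProjectiveLine

noncomputable section

open RiemannSphere

/-- The affine coordinate of the projective line (with the value `0` at infinity). -/
def affineCoord (x : CP1) : ℂ := x.elim 0 id

@[simp] theorem affineCoord_coe (z : ℂ) : affineCoord (z : CP1) = z := rfl

theorem affineChart_mem_maximalAtlas :
    affineChart ∈ IsManifold.maximalAtlas 𝓘(ℝ, ℂ) ∞ CP1 :=
  IsManifold.subset_maximalAtlas (Or.inl rfl)

theorem inftyChart_mem_maximalAtlas :
    inftyChart ∈ IsManifold.maximalAtlas 𝓘(ℝ, ℂ) ∞ CP1 :=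
  IsManifold.subset_maximalAtlas (Or.inr rfl)

theorem contMDiff_coe_CP1 : ContMDiff 𝓘(ℝ, ℂ) 𝓘(ℝ, ℂ) ∞ (fun z : ℂ => (z : CP1)) := fun z =>
  contMDiffAt_symm_of_mem_maximalAtlas affineChart_mem_maximalAtlas (by simp [affineChart])

theorem contMDiff_inv_coe_CP1 : ContMDiff 𝓘(ℝ, ℂ) 𝓘(ℝ, ℂ) ∞ (fun z : ℂ => inv (z : CP1)) :=
  fun z => contMDiffAt_symm_of_mem_maximalAtlas inftyChart_mem_maximalAtlas
    (by simp [inftyChart, affineChart])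

theorem contMDiffAt_affineCoord (z : ℂ) :
    ContMDiffAt 𝓘(ℝ, ℂ) 𝓘(ℝ, ℂ) ∞ affineCoord (z : CP1) := by
  have hz : (z : CP1) ∈ affineChart.source := by simp [affineChart_source]
  refine (contMDiffAt_of_mem_maximalAtlas affineChart_mem_maximalAtlas hz).congr_of_eventuallyEq ?_
  filter_upwards [affineChart.open_source.mem_nhds hz] with x hx
  rw [affineChart_source] at hx
  obtain ⟨w, rfl⟩ := hx
  rw [affineChart_coe, affineCoord_coe]

theorem contMDiffAt_affineCoord_inv (z : ℂ) :
    ContMDiffAt 𝓘(ℝ, ℂ) 𝓘(ℝ, ℂ) ∞ (fun x => affineCoord (inv x)) (inv (z : CP1)) := by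
  have hz : inv (z : CP1) ∈ inftyChart.source := by
    simp [inftyChart, affineChart_source, inv_inv, invHomeomorph]
  refine (contMDiffAt_of_mem_maximalAtlas inftyChart_mem_maximalAtlas hz).congr_of_eventuallyEq ?_
  filter_upwards [inftyChart.open_source.mem_nhds hz] with x hx
  have : inv x ∈ affineChart.source := by simpa [inftyChart, invHomeomorph] using hx
  rw [affineChart_source] at this
  obtain ⟨w, hw⟩ := this
  rw [inftyChart_apply, ← hw, affineChart_coe, affineCoord_coe]

variable {E : Type*} [NormedAddCommGroup E] [NormedSpace ℂ E]
  {P : Type*} [TopologicalSpace P] [ChartedSpace E P]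

/-- The affine parametrisation of `ℂP¹ × {p}`. -/
def affineLine (p : P) (z : ℂ) : CP1 × P := ((z : CP1), p)

/-- The parametrisation of `ℂP¹ × {p}` around infinity. -/
def affineLineInfty (p : P) (z : ℂ) : CP1 × P := (inv (z : CP1), p)

theorem affineLine_eq (p : P) {z : ℂ} (hz : z ≠ 0) : affineLine p z = affineLineInfty p z⁻¹ := by
  have : z⁻¹ ≠ 0 := inv_ne_zero hz
  simp [affineLine, affineLineInfty, inv_coe, hz]

theorem contMDiff_affineLine (p : P) : ContMDiff 𝓘(ℝ, ℂ) 𝓘(ℝ, ℂ × E) ∞ (affineLine p) := by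
  have h : ContMDiff 𝓘(ℝ, ℂ) (𝓘(ℝ, ℂ).prod 𝓘(ℝ, E)) ∞ (affineLine p) :=
    contMDiff_coe_CP1.prodMk contMDiff_const
  rw [modelWithCornersSelf_prod]
  exact h

theorem contMDiff_affineLineInfty (p : P) :
    ContMDiff 𝓘(ℝ, ℂ) 𝓘(ℝ, ℂ × E) ∞ (affineLineInfty p) := by
  have h : ContMDiff 𝓘(ℝ, ℂ) (𝓘(ℝ, ℂ).prod 𝓘(ℝ, E)) ∞ (affineLineInfty p) :=
    contMDiff_inv_coe_CP1.prodMk contMDiff_const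
  rw [modelWithCornersSelf_prod]
  exact h

theorem contMDiffAt_affineCoord_fst (p : P) (z : ℂ) : ContMDiffAt 𝓘(ℝ, ℂ × E) 𝓘(ℝ, ℂ) ∞
    (fun x : CP1 × P => affineCoord x.1) (affineLine p z) := by
  have h : ContMDiffAt (𝓘(ℝ, ℂ).prod 𝓘(ℝ, E)) 𝓘(ℝ, ℂ) ∞
    (fun x : CP1 × P => affineCoord x.1) (affineLine p z) :=
      (contMDiffAt_affineCoord z).comp (affineLine p z) contMDiffAt_fst
  rw [modelWithCornersSelf_prod]
  exact h

theorem contMDiffAt_affineCoord_inv_fst (p : P) (z : ℂ) : ContMDiffAt 𝓘(ℝ, ℂ × E) 𝓘(ℝ, ℂ) ∞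
    (fun x : CP1 × P => affineCoord (inv x.1)) (affineLineInfty p z) := by
  have h : ContMDiffAt (𝓘(ℝ, ℂ).prod 𝓘(ℝ, E)) 𝓘(ℝ, ℂ) ∞
    (fun x : CP1 × P => affineCoord (inv x.1)) (affineLineInfty p z) :=
      (contMDiffAt_affineCoord_inv z).comp (affineLineInfty p z) contMDiffAt_fst
  rw [modelWithCornersSelf_prod]
  exact h

/-- `ℂP¹ × {p}` is a complex curve. -/
theorem isSubmanifold_line [IsManifold 𝓘(ℂ, E) ω P] (p : P) :
    IsSubmanifold 𝓘(ℂ, ℂ × E) ω 1 {x : CP1 × P | x.2 = p} := by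
  rintro ⟨a, q⟩ hq
  obtain rfl : q = p := hq
  let c : OpenPartialHomeomorph (CP1 × P) (ℂ × E) := chartAt (ℂ × E) (a, q)
  have hc : c = (chartAt ℂ a).prod (chartAt E q) := rfl
  -- A translation moves the second coordinate of the base point to `0`, so that the slice becomes a
  -- linear subspace.
  let T : ℂ × E ≃ₜ ℂ × E := Homeomorph.addRight (0, -(chartAt E q q))
  have hcm : c ∈ IsManifold.maximalAtlas 𝓘(ℂ, ℂ × E) ω (CP1 × P) :=
    IsManifold.chart_mem_maximalAtlas _
  refine ⟨c ≫ₕ T.toOpenPartialHomeomorph, ?_, ?_, LinearMap.ker (LinearMap.snd ℂ ℂ E), ?_, ?_⟩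
  · refine OpenPartialHomeomorph.mem_maximalAtlas_of_contMDiffOn _ ?_ ?_
    · intro x hx
      rw [OpenPartialHomeomorph.trans_source] at hx
      have h1 := contMDiffAt_of_mem_maximalAtlas hcm hx.1
      have h2 : ContMDiff 𝓘(ℂ, ℂ × E) 𝓘(ℂ, ℂ × E) ω T := by
        rw [contMDiff_iff_contDiff]
        exact contDiff_id.add contDiff_const
      exact (h2.contMDiffAt.comp x h1).contMDiffWithinAt
    · intro z hz
      rw [OpenPartialHomeomorph.trans_target] at hz
      have h2 := contMDiffAt_symm_of_mem_maximalAtlas hcm hz.2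
      have h1 : ContMDiff 𝓘(ℂ, ℂ × E) 𝓘(ℂ, ℂ × E) ω T.symm := by
        rw [contMDiff_iff_contDiff]
        exact contDiff_id.add contDiff_const
      exact (h2.comp z h1.contMDiffAt).contMDiffWithinAt
  · rw [OpenPartialHomeomorph.trans_source]
    exact ⟨mem_chart_source _ _, mem_univ _⟩
  · have h1 : LinearMap.ker (LinearMap.snd ℂ ℂ E) = LinearMap.range (LinearMap.inl ℂ ℂ E) :=
      (LinearMap.range_inl ℂ ℂ E).symm
    rw [h1, LinearMap.finrank_range_of_inj LinearMap.inl_injective, Module.finrank_self]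
  · rintro ⟨x, y⟩ hx
    have hx' : (x, y) ∈ c.source := by
      rw [OpenPartialHomeomorph.trans_source] at hx
      exact hx.1
    have hy : y ∈ (chartAt E q).source := by
      rw [hc, OpenPartialHomeomorph.prod_source] at hx'
      exact hx'.2
    have h2 : ((c ≫ₕ T.toOpenPartialHomeomorph) (x, y)).2 = chartAt E q y + -(chartAt E q q) := rfl
    have h3 : 𝓘(ℂ, ℂ × E) ((c ≫ₕ T.toOpenPartialHomeomorph) (x, y)) ∈
        LinearMap.ker (LinearMap.snd ℂ ℂ E) ↔ chartAt E q y + -(chartAt E q q) = 0 := by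
      rw [LinearMap.mem_ker, ← h2]; rfl
    rw [h3, ← sub_eq_add_neg, sub_eq_zero]
    constructor
    · intro h
      obtain rfl : y = q := h
      rfl
    · intro h
      exact (chartAt E q).injOn hy (mem_chart_source _ _) h

end

end ProjectiveLine

/-! ### Smooth logarithms of circle valued functions -/

section CircleValued

noncomputable section

variable {V : Type*} [NormedAddCommGroup V] [NormedSpace ℝ V]

theorem contDiffAt_arg_coe {D : V → Circle} {v : V} (hD : ContMDiffAt 𝓘(ℝ, V) (𝓡 1) ∞ D v)
    (h1 : D v = 1) : ContDiffAt ℝ ∞ (fun w => Complex.arg (D w)) v := by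
  have h2 : ContMDiffAt 𝓘(ℝ, V) 𝓘(ℝ, ℂ) ∞ (fun w => (D w : ℂ)) v :=
    have : Fact (Module.finrank ℝ ℂ = 1 + 1) := ⟨Complex.finrank_real_complex⟩
    (contMDiff_coe_sphere (m := ∞) (n := 1) (E := ℂ)).contMDiffAt.comp v hD
  rw [contMDiffAt_iff_contDiffAt] at h2
  have h3 : ContDiffAt ℝ ∞ Complex.log (D v : ℂ) :=
    (Complex.contDiffAt_log (by simp [h1])).restrict_scalars ℝ
  refine (Complex.imCLM.contDiff.contDiffAt.comp v (h3.comp v h2)).congr_of_eventuallyEq ?_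
  exact Eventually.of_forall fun w => (Complex.log_im _).symm

/-- A continuous logarithm is automatically smooth: by continuity `H - H v` stays in `(-π, π)` near
`v`, where it is the principal argument of `D / D v`. -/
theorem contDiffAt_of_circleExp {D : V → Circle} {H : V → ℝ} {v : V}
    (hD : ContMDiffAt 𝓘(ℝ, V) (𝓡 1) ∞ D v) (hH : ContinuousAt H v)
    (h : ∀ᶠ w in 𝓝 v, D w = Circle.exp (H w)) : ContDiffAt ℝ ∞ H v := by
  have h1 : ContMDiffAt 𝓘(ℝ, V) (𝓡 1) ∞ (fun w => D w * (D v)⁻¹) v := hD.mul contMDiffAt_const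
  have h2 := contDiffAt_const (c := H v) |>.add (contDiffAt_arg_coe h1 (mul_inv_cancel _))
  refine h2.congr_of_eventuallyEq ?_
  have h3 : ∀ᶠ w in 𝓝 v, |H w - H v| < Real.pi := by
    have := hH.eventually (Metric.ball_mem_nhds (H v) Real.pi_pos)
    simpa [Real.dist_eq] using this
  filter_upwards [h, h3] with w hw1 hw2
  rw [hw1, h.self_of_nhds, ← Circle.exp_neg, ← Circle.exp_add, ← sub_eq_add_neg]
  rw [abs_lt] at hw2
  rw [Circle.arg_exp hw2.1 hw2.2.le]
  ring

/-- A smooth circle valued function on a convex open set has a smooth logarithm. -/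
theorem exists_smooth_log {D : V → Circle} {U : Set V} (hU : IsOpen U) (hconv : Convex ℝ U)
    (hD : ContMDiffOn 𝓘(ℝ, V) (𝓡 1) ∞ D U) :
    ∃ H : V → ℝ, ContDiffOn ℝ ∞ H U ∧ ∀ v ∈ U, D v = Circle.exp (H v) := by
  classical
  rcases U.eq_empty_or_nonempty with rfl | ⟨v₀, hv₀⟩
  · exact ⟨fun _ => 0, by simp⟩
  -- A convex set is simply connected, so `D` lifts through the covering `exp : ℝ → S¹`.
  have : ContractibleSpace U := hconv.contractibleSpace ⟨v₀, hv₀⟩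
  have : LocallyPathConnectedSpace U := hU.locallyPathConnectedSpace
  have : SimplyConnectedSpace U := SimplyConnectedSpace.ofContractible U
  let f : C(U, Circle) := ⟨fun v => D v, hD.continuousOn.domRestrict⟩
  obtain ⟨θ, hθ⟩ := Circle.exp_surjective (f ⟨v₀, hv₀⟩)
  obtain ⟨F, ⟨-, hF⟩, -⟩ := Circle.isCoveringMap_exp.existsUnique_continuousMap_lifts f
    ⟨v₀, hv₀⟩ θ hθ
  let H : V → ℝ := fun v => if hv : v ∈ U then F ⟨v, hv⟩ else 0
  have hH1 : ∀ v ∈ U, D v = Circle.exp (H v) := by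
    intro v hv
    have := congrFun hF ⟨v, hv⟩
    simp only [H, dif_pos hv]
    exact this.symm
  have hH2 : ContinuousOn H U := by
    rw [continuousOn_iff_continuous_domRestrict]
    have : U.domRestrict H = F := by
      ext v
      simp [H]
    rw [this]
    exact F.continuous
  refine ⟨H, fun v hv => ?_, hH1⟩
  refine (contDiffAt_of_circleExp (hD.contMDiffAt (hU.mem_nhds hv))
    (hH2.continuousAt (hU.mem_nhds hv)) ?_).contDiffWithinAt
  filter_upwards [hU.mem_nhds hv] with w hw
  exact hH1 w hw

/-- The phase `z / |z|` of a non-zero complex number. -/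
def phase (z : ℂ) : Circle := Circle.exp (Complex.arg z)

theorem norm_mul_phase (z : ℂ) : (‖z‖ : ℂ) * phase z = z := by
  simp [phase, Circle.coe_exp]

theorem phase_mul {z w : ℂ} (hz : z ≠ 0) (hw : w ≠ 0) : phase (z * w) = phase z * phase w := by
  rw [Circle.ext_iff]
  have h : ((‖z * w‖ : ℝ) : ℂ) ≠ 0 := by simp [hz, hw]
  apply mul_left_cancel₀ h
  rw [norm_mul_phase, norm_mul]
  push_cast
  calc z * w = ((‖z‖ : ℂ) * phase z) * ((‖w‖ : ℂ) * phase w) := by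
        rw [norm_mul_phase, norm_mul_phase]
    _ = _ := by ring

theorem phase_coe (z : Circle) : phase z = z := Circle.exp_arg z

theorem phase_real_mul {r : ℝ} (hr : 0 < r) (z : ℂ) : phase (r * z) = phase z := by
  rw [phase, phase, Complex.arg_real_mul z hr]

/-- A branch of the argument around a non-zero complex number. -/
theorem exists_branch_arg {z₀ : ℂ} (h₀ : z₀ ≠ 0) : ∃ A : ℂ → ℝ, ContDiffAt ℝ ∞ A z₀ ∧
    A z₀ = Complex.arg z₀ ∧ ∀ z, z ≠ 0 → phase z = Circle.exp (A z) := by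
  refine ⟨fun z => Complex.arg z₀ + (Complex.log (z / z₀)).im, ?_, by simp [h₀], ?_⟩
  · have h1 : ContDiffAt ℝ ∞ (fun z : ℂ => z / z₀) z₀ := by
      simp only [div_eq_mul_inv]
      exact contDiffAt_id.mul contDiffAt_const
    have h3 : ContDiffAt ℝ ∞ Complex.log (z₀ / z₀) :=
      (Complex.contDiffAt_log (by simp [h₀])).restrict_scalars ℝ
    exact contDiffAt_const.add (Complex.imCLM.contDiff.contDiffAt.comp z₀
      (ContDiffAt.comp (g := Complex.log) (f := fun z => z / z₀) z₀ h3 h1))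
  · intro z hz
    have h1 : phase z = phase z₀ * phase (z / z₀) := by
      rw [← phase_mul h₀ (div_ne_zero hz h₀), mul_div_cancel₀ _ h₀]
    rw [h1, Circle.exp_add, Complex.log_im]
    rfl

theorem contMDiffAt_circleExp_comp {V : Type*} [NormedAddCommGroup V] [NormedSpace ℝ V]
    {H : V → ℝ} {v : V} (hH : ContDiffAt ℝ ∞ H v) :
    ContMDiffAt 𝓘(ℝ, V) (𝓡 1) ∞ (fun w => Circle.exp (H w)) v :=
  contMDiff_circleExp.contMDiffAt.comp v hH.contMDiffAt

theorem contMDiffAt_phase {z : ℂ} (hz : z ≠ 0) : ContMDiffAt 𝓘(ℝ, ℂ) (𝓡 1) ∞ phase z := by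
  obtain ⟨A, h1, -, h2⟩ := exists_branch_arg hz
  refine (contMDiffAt_circleExp_comp h1).congr_of_eventuallyEq ?_
  filter_upwards [isOpen_ne.mem_nhds hz] with w hw
  exact h2 w hw

end

end CircleValued

/-! ### Local lifts to a circle bundle and their gluing -/

section Lifts

noncomputable section

variable {S : Type*} [TopologicalSpace S] [ChartedSpace E7 S]
  [MulAction Circle S] {E : Type*} [NormedAddCommGroup E] [NormedSpace ℝ E]
  {X : Type*} [TopologicalSpace X] [ChartedSpace E X]
  {π : S → X} {V : Type*} [NormedAddCommGroup V] [NormedSpace ℝ V]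

theorem IsPrincipalCircleBundle.contMDiffAt_smul (hb : IsPrincipalCircleBundle 𝓘(ℝ, E) π)
    {D : V → Circle} {a : V → S} {v : V} (hD : ContMDiffAt 𝓘(ℝ, V) (𝓡 1) ∞ D v)
    (ha : ContMDiffAt 𝓘(ℝ, V) (𝓡 7) ∞ a v) :
    ContMDiffAt 𝓘(ℝ, V) (𝓡 7) ∞ (fun w => D w • a w) v :=
  hb.smooth_action.contMDiffAt.comp v (hD.prodMk ha)

theorem IsPrincipalCircleBundle.smul_right_cancel (hb : IsPrincipalCircleBundle 𝓘(ℝ, E) π)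
    {z w : Circle} {p : S} (h : z • p = w • p) : z = w := by
  have h1 : (w⁻¹ * z) • p = p := by rw [mul_smul, h, inv_smul_smul]
  have h2 := hb.free _ _ h1
  rw [inv_mul_eq_one] at h2
  exact h2.symm

/-- Around each fibre there is a smooth equivariant circle valued function. -/
theorem IsPrincipalCircleBundle.exists_equivariant (hb : IsPrincipalCircleBundle 𝓘(ℝ, E) π)
    (x : X) : ∃ U : Set X, IsOpen U ∧ x ∈ U ∧ ∃ τ : S → Circle,
      ContMDiffOn (𝓡 7) (𝓡 1) ∞ τ (π ⁻¹' U) ∧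
      ∀ (z : Circle) (p : S), π p ∈ U → τ (z • p) = z * τ p := by
  obtain ⟨U, hU, hx, σ, τ, hσ, hτ, h1, h2⟩ := hb.locally_trivial x
  refine ⟨U, hU, hx, τ, hτ, fun z p hp => ?_⟩
  have h3 := h2 (z • p) (by rwa [mem_preimage, hb.smul_proj])
  rw [hb.smul_proj] at h3
  apply hb.smul_right_cancel (p := σ (π p))
  rw [h3, mul_smul, h2 p hp]

/-- Two smooth lifts of the same map differ by a smooth circle valued function. -/
theorem IsPrincipalCircleBundle.exists_transition (hb : IsPrincipalCircleBundle 𝓘(ℝ, E) π)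
    {a b : V → S} {U : Set V} (hU : IsOpen U) (ha : ContMDiffOn 𝓘(ℝ, V) (𝓡 7) ∞ a U)
    (hb' : ContMDiffOn 𝓘(ℝ, V) (𝓡 7) ∞ b U) (h : ∀ v ∈ U, π (a v) = π (b v)) :
    ∃ D : V → Circle, ContMDiffOn 𝓘(ℝ, V) (𝓡 1) ∞ D U ∧ ∀ v ∈ U, b v = D v • a v := by
  classical
  have h1 : ∀ v, ∃ z : Circle, v ∈ U → b v = z • a v := by
    intro v
    by_cases hv : v ∈ U
    · obtain ⟨z, hz⟩ := (hb.fibre _ _).1 (h v hv)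
      exact ⟨z, fun _ => hz⟩
    · exact ⟨1, fun h => absurd h hv⟩
  choose D hD using h1
  refine ⟨D, fun v hv => ContMDiffAt.contMDiffWithinAt ?_, hD⟩
  -- A local equivariant function `τ` exhibits `D` as `τ(b) / τ(a)`, which is smooth.
  obtain ⟨W, hW, hvW, τ, hτ, h2⟩ := hb.exists_equivariant (π (a v))
  have ha' := ha.contMDiffAt (hU.mem_nhds hv)
  have hb'' := hb'.contMDiffAt (hU.mem_nhds hv)
  have hWS : IsOpen (π ⁻¹' W) := hW.preimage hb.smooth.continuous
  have h3 : ContMDiffAt 𝓘(ℝ, V) (𝓡 1) ∞ (fun w => τ (a w)) v :=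
    (hτ.contMDiffAt (hWS.mem_nhds hvW)).comp v ha'
  have h4 : ContMDiffAt 𝓘(ℝ, V) (𝓡 1) ∞ (fun w => τ (b w)) v :=
    ContMDiffAt.comp v (hτ.contMDiffAt (hWS.mem_nhds (by rwa [mem_preimage, ← h v hv]))) hb''
  refine (h4.mul h3.inv).congr_of_eventuallyEq ?_
  filter_upwards [hU.mem_nhds hv, ha'.continuousAt.preimage_mem_nhds (hWS.mem_nhds hvW)]
    with w hw hw2
  change D w = τ (b w) * (τ (a w))⁻¹
  rw [hD w hw, h2 _ _ hw2, mul_inv_cancel_right]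

variable (π) in
/-- `s` is a smooth lift of `β` over `U`. -/
structure IsLiftOn (β : V → X) (s : V → S) (U : Set V) : Prop where
  smooth : ContMDiffOn 𝓘(ℝ, V) (𝓡 7) ∞ s U
  proj : ∀ v ∈ U, π (s v) = β v

theorem IsLiftOn.mono {β : V → X} {s : V → S} {U U' : Set V} (h : IsLiftOn π β s U)
    (hU : U' ⊆ U) : IsLiftOn π β s U' := ⟨h.smooth.mono hU, fun v hv => h.proj v (hU hv)⟩

theorem IsLiftOn.contMDiffAt {β : V → X} {s : V → S} {U : Set V} (h : IsLiftOn π β s U)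
    (hU : IsOpen U) {v : V} (hv : v ∈ U) : ContMDiffAt 𝓘(ℝ, V) (𝓡 7) ∞ s v :=
  h.smooth.contMDiffAt (hU.mem_nhds hv)

/-- Two lifts that differ by `exp (i H)` are glued by cutting off `H`. -/
theorem IsPrincipalCircleBundle.exists_glue (hb : IsPrincipalCircleBundle 𝓘(ℝ, E) π)
    {β : V → X} {s₁ s₂ : V → S} {U₁ U₂ : Set V} (hU₁ : IsOpen U₁) (hU₂ : IsOpen U₂)
    (h₁ : IsLiftOn π β s₁ U₁) (h₂ : IsLiftOn π β s₂ U₂) {H : V → ℝ}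
    (hH : ContDiffOn ℝ ∞ H (U₁ ∩ U₂)) (h : ∀ v ∈ U₁ ∩ U₂, s₂ v = Circle.exp (H v) • s₁ v)
    {l : V → ℝ} (hl : ContDiff ℝ ∞ l) {c d : ℝ} (hcd : c < d) :
    ∃ s : V → S, IsLiftOn π β s ((U₁ ∩ {v | l v < c}) ∪ (U₁ ∩ U₂) ∪ (U₂ ∩ {v | d < l v})) ∧
      (∀ v, l v < c → s v = s₁ v) ∧ ∀ v, d < l v → s v = s₂ v := by
  classical
  -- `exp (i χ H) • s₁` interpolates between `s₁`, where `χ = 0`, and `s₂`, where `χ = 1`.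
  let χ : V → ℝ := fun v => Real.smoothTransition ((l v - c) / (d - c))
  have hχ : ContDiff ℝ ∞ χ := Real.smoothTransition.contDiff.comp
    ((hl.sub contDiff_const).div_const _)
  have hχ0 : ∀ v, l v ≤ c → χ v = 0 := fun v hv =>
    Real.smoothTransition.zero_of_nonpos (div_nonpos_of_nonpos_of_nonneg (by linarith) (by linarith))
  have hχ1 : ∀ v, d ≤ l v → χ v = 1 := fun v hv =>
    Real.smoothTransition.one_of_one_le ((one_le_div (by linarith)).2 (by linarith))
  let s : V → S := fun v => if l v < c then s₁ v else if d < l v then s₂ v else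
    Circle.exp (χ v * H v) • s₁ v
  have hs1 : ∀ v, l v < c → s v = s₁ v := fun v hv => if_pos hv
  have hs2 : ∀ v, d < l v → s v = s₂ v := fun v hv => by
    simp only [s, if_neg (show ¬ l v < c by linarith), if_pos hv]
  have hs3 : ∀ v ∈ U₁ ∩ U₂, s v = Circle.exp (χ v * H v) • s₁ v := by
    intro v hv
    simp only [s]
    split_ifs with h3 h4
    · rw [hχ0 v h3.le]; simp
    · rw [hχ1 v h4.le, h v hv, one_mul]
    · rfl
  refine ⟨s, ⟨?_, ?_⟩, hs1, hs2⟩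
  · rintro v ((⟨hv, hv'⟩ | hv) | ⟨hv, hv'⟩)
    · refine ContMDiffAt.contMDiffWithinAt ((h₁.contMDiffAt hU₁ hv).congr_of_eventuallyEq ?_)
      filter_upwards [(isOpen_lt hl.continuous continuous_const).mem_nhds hv'] with w hw
      exact hs1 w hw
    · have h12 := hU₁.inter hU₂
      have h3 : ContDiffAt ℝ ∞ (fun v => χ v * H v) v :=
        hχ.contDiffAt.mul (hH.contDiffAt (h12.mem_nhds hv))
      refine ContMDiffAt.contMDiffWithinAt (ContMDiffAt.congr_of_eventuallyEq
        (hb.contMDiffAt_smul (contMDiffAt_circleExp_comp h3) (h₁.contMDiffAt hU₁ hv.1)) ?_)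
      filter_upwards [h12.mem_nhds hv] with w hw
      exact hs3 w hw
    · refine ContMDiffAt.contMDiffWithinAt ((h₂.contMDiffAt hU₂ hv).congr_of_eventuallyEq ?_)
      filter_upwards [(isOpen_lt continuous_const hl.continuous).mem_nhds hv'] with w hw
      exact hs2 w hw
  · rintro v ((⟨hv, hv'⟩ | hv) | ⟨hv, hv'⟩)
    · rw [hs1 v hv', h₁.proj v hv]
    · rw [hs3 v hv, hb.smul_proj, h₁.proj v hv.1]
    · rw [hs2 v hv', h₂.proj v hv]

end

end Lifts

/-- A property of intervals that holds locally and can be glued holds for all intervals. -/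
theorem interval_gluing {p : ℝ → ℝ → Prop}
    (mono : ∀ {a b a' b'}, a ≤ a' → b' ≤ b → p a b → p a' b')
    (glue : ∀ {a a' b b'}, a < a' → a' < b → b < b' → p a b → p a' b' → p a b')
    (loc : ∀ x, ∃ ε > 0, p (x - ε) (x + ε)) (c d : ℝ) : p c d := by
  obtain ⟨ε, hε, h0⟩ := loc c
  have hne : c + ε ∈ {t | p c t} := mono (by linarith) le_rfl h0
  have hub : ¬ BddAbove {t | p c t} := by
    intro hbd
    set m := sSup {t | p c t} with hm
    have hcm : c + ε ≤ m := le_csSup hbd hne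
    obtain ⟨δ, hδ, h1⟩ := loc m
    -- An interval that reaches beyond `m - δ` overlaps the local one around `m`, and the glued
    -- interval passes the supremum. The midpoint `(c + m) / 2` keeps the left end of the second
    -- interval to the right of `c`, as gluing demands.
    obtain ⟨t, ht, hlt⟩ := exists_lt_of_lt_csSup ⟨_, hne⟩
      (show max (m - δ) ((c + m) / 2) < m from max_lt (by linarith) (by linarith))
    have htm : t ≤ m := le_csSup hbd ht
    have h2 : p c (m + δ) := glue (lt_of_lt_of_le (by linarith) (le_max_right (m - δ) ((c + m) / 2)))
      hlt (by linarith) ht (mono (le_max_left _ _) le_rfl h1)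
    have := le_csSup hbd (show m + δ ∈ {t | p c t} from h2)
    linarith
  rw [not_bddAbove_iff] at hub
  obtain ⟨t, ht, hdt⟩ := hub d
  exact mono le_rfl hdt.le ht

/-! ### Lifts over rectangles and discs -/

section Sections

noncomputable section

variable {S : Type*} [TopologicalSpace S] [ChartedSpace E7 S]
  [MulAction Circle S] {E : Type*} [NormedAddCommGroup E] [NormedSpace ℝ E]
  {X : Type*} [TopologicalSpace X] [ChartedSpace E X]
  {π : S → X}

/-- On a convex overlap the transition function has a smooth logarithm, which can be cut off. -/
theorem IsPrincipalCircleBundle.exists_glue_of_convex {V : Type*} [NormedAddCommGroup V]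
    [NormedSpace ℝ V] (hb : IsPrincipalCircleBundle 𝓘(ℝ, E) π)
    {β : V → X} {s₁ s₂ : V → S} {U₁ U₂ U : Set V} (hU₁ : IsOpen U₁) (hU₂ : IsOpen U₂)
    (h₁ : IsLiftOn π β s₁ U₁) (h₂ : IsLiftOn π β s₂ U₂) (hconv : Convex ℝ (U₁ ∩ U₂))
    {l : V → ℝ} (hl : ContDiff ℝ ∞ l) {c d : ℝ} (hcd : c < d)
    (hU : U ⊆ (U₁ ∩ {v | l v < c}) ∪ (U₁ ∩ U₂) ∪ (U₂ ∩ {v | d < l v})) :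
    ∃ s : V → S, IsLiftOn π β s U := by
  have h12 := hU₁.inter hU₂
  obtain ⟨D, hD, hD'⟩ := hb.exists_transition h12 (h₁.smooth.mono inter_subset_left)
    (h₂.smooth.mono inter_subset_right) fun v hv => by rw [h₁.proj v hv.1, h₂.proj v hv.2]
  obtain ⟨H, hH, hH'⟩ := exists_smooth_log h12 hconv hD
  obtain ⟨s, hs, -, -⟩ := hb.exists_glue hU₁ hU₂ h₁ h₂ hH
    (fun v hv => by rw [← hH' v hv, hD' v hv]) hl hcd
  exact ⟨s, hs.mono hU⟩

/-- A smooth map from the complex plane to the base lifts over every rectangle. -/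
theorem IsPrincipalCircleBundle.exists_lift_rectangle (hb : IsPrincipalCircleBundle 𝓘(ℝ, E) π)
    {β : ℂ → X} (hβ : ContMDiff 𝓘(ℝ, ℂ) 𝓘(ℝ, E) ∞ β) (a b c d : ℝ) :
    ∃ s : ℂ → S, IsLiftOn π β s (Ioo a b ×ℂ Ioo c d) := by
  have hopen : ∀ a b c d : ℝ, IsOpen (Ioo a b ×ℂ Ioo c d) := fun a b c d =>
    isOpen_Ioo.reProdIm isOpen_Ioo
  have hconv : ∀ a b c d : ℝ, Convex ℝ (Ioo a b ×ℂ Ioo c d) := fun a b c d =>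
    ((convex_Ioo a b).linear_preimage Complex.reLm).inter
      ((convex_Ioo c d).linear_preimage Complex.imLm)
  have hloc : ∀ z : ℂ, ∃ ε > 0, ∃ s : ℂ → S,
      IsLiftOn π β s (Ioo (z.re - ε) (z.re + ε) ×ℂ Ioo (z.im - ε) (z.im + ε)) := by
    intro z
    obtain ⟨U, hU, hx, σ, τ, hσ, hτ, h1, h2⟩ := hb.locally_trivial (β z)
    have hUo : IsOpen (β ⁻¹' U) := hU.preimage hβ.continuous
    obtain ⟨ε, hε, hball⟩ := Metric.isOpen_iff.1 hUo z hx
    refine ⟨ε / 2, by positivity, fun w => σ (β w), ?_⟩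
    have hsub : (Ioo (z.re - ε / 2) (z.re + ε / 2) ×ℂ Ioo (z.im - ε / 2) (z.im + ε / 2)) ⊆
        β ⁻¹' U := by
      intro w hw
      apply hball
      rw [Complex.mem_reProdIm] at hw
      rw [Metric.mem_ball, Complex.dist_eq]
      refine (Complex.norm_le_abs_re_add_abs_im _).trans_lt ?_
      have h3 : |(w - z).re| < ε / 2 := by
        rw [Complex.sub_re, abs_lt]; constructor <;> linarith [hw.1.1, hw.1.2]
      have h4 : |(w - z).im| < ε / 2 := by
        rw [Complex.sub_im, abs_lt]; constructor <;> linarith [hw.2.1, hw.2.2]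
      linarith
    exact ⟨hσ.comp hβ.contMDiffOn hsub, fun w hw => h1 _ (hsub hw)⟩
  -- Small squares are glued vertically to a thin strip around `x`, whose width shrinks to a minimum
  -- at each gluing; the strips are then glued horizontally.
  have hstrip : ∀ x : ℝ, ∃ ε > 0, ∃ s : ℂ → S,
      IsLiftOn π β s (Ioo (x - ε) (x + ε) ×ℂ Ioo c d) := by
    intro x
    refine interval_gluing (p := fun c d => ∃ ε > 0, ∃ s : ℂ → S,
      IsLiftOn π β s (Ioo (x - ε) (x + ε) ×ℂ Ioo c d)) ?_ ?_ ?_ c d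
    · rintro a b a' b' h1 h2 ⟨ε, hε, s, hs⟩
      exact ⟨ε, hε, s, hs.mono (Complex.reProdIm_subset_iff.2
        (prod_mono le_rfl (Ioo_subset_Ioo h1 h2)))⟩
    · rintro a a' b b' h1 h2 h3 ⟨ε₁, hε₁, s₁, hs₁⟩ ⟨ε₂, hε₂, s₂, hs₂⟩
      refine ⟨min ε₁ ε₂, lt_min hε₁ hε₂, ?_⟩
      set I := Ioo (x - min ε₁ ε₂) (x + min ε₁ ε₂) with hI
      have hs₁' : IsLiftOn π β s₁ (I ×ℂ Ioo a b) := hs₁.mono (Complex.reProdIm_subset_iff.2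
        (prod_mono (Ioo_subset_Ioo (by linarith [min_le_left ε₁ ε₂])
          (by linarith [min_le_left ε₁ ε₂])) le_rfl))
      have hs₂' : IsLiftOn π β s₂ (I ×ℂ Ioo a' b') := hs₂.mono (Complex.reProdIm_subset_iff.2
        (prod_mono (Ioo_subset_Ioo (by linarith [min_le_right ε₁ ε₂])
          (by linarith [min_le_right ε₁ ε₂])) le_rfl))
      -- The logarithm is cut off in the middle third of the overlap `(a', b)`, so each point lies
      -- in one of the three regions of the glued lift.
      refine hb.exists_glue_of_convex (hopen _ _ _ _) (hopen _ _ _ _) hs₁' hs₂'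
        ((hconv _ _ _ _).inter (hconv _ _ _ _)) (l := Complex.im) Complex.imCLM.contDiff
        (c := (2 * a' + b) / 3) (d := (a' + 2 * b) / 3) (by linarith) ?_
      rintro z ⟨hz1, hz2, hz3⟩
      by_cases hza : z.im < (2 * a' + b) / 3
      · exact Or.inl (Or.inl ⟨⟨hz1, hz2, by linarith⟩, hza⟩)
      by_cases hzb : (a' + 2 * b) / 3 < z.im
      · exact Or.inr ⟨⟨hz1, by linarith, hz3⟩, hzb⟩
      · exact Or.inl (Or.inr ⟨⟨hz1, hz2, by linarith⟩, hz1, by linarith, hz3⟩)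
    · intro y
      obtain ⟨ε, hε, h⟩ := hloc ⟨x, y⟩
      exact ⟨ε, hε, ε, hε, h⟩
  refine interval_gluing (p := fun a b => ∃ s : ℂ → S,
    IsLiftOn π β s (Ioo a b ×ℂ Ioo c d)) ?_ ?_ hstrip a b
  · rintro a b a' b' h1 h2 ⟨s, hs⟩
    exact ⟨s, hs.mono (Complex.reProdIm_subset_iff.2 (prod_mono (Ioo_subset_Ioo h1 h2) le_rfl))⟩
  · rintro a a' b b' h1 h2 h3 ⟨s₁, hs₁⟩ ⟨s₂, hs₂⟩
    refine hb.exists_glue_of_convex (hopen _ _ _ _) (hopen _ _ _ _) hs₁ hs₂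
      ((hconv _ _ _ _).inter (hconv _ _ _ _)) (l := Complex.re) Complex.reCLM.contDiff
      (c := (2 * a' + b) / 3) (d := (a' + 2 * b) / 3) (by linarith) ?_
    rintro z ⟨⟨hz2, hz3⟩, hz1⟩
    by_cases hza : z.re < (2 * a' + b) / 3
    · exact Or.inl (Or.inl ⟨⟨⟨hz2, by linarith⟩, hz1⟩, hza⟩)
    by_cases hzb : (a' + 2 * b) / 3 < z.re
    · exact Or.inr ⟨⟨⟨by linarith, hz3⟩, hz1⟩, hzb⟩
    · exact Or.inl (Or.inr ⟨⟨⟨hz2, by linarith⟩, hz1⟩, ⟨by linarith, hz3⟩, hz1⟩)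

/-- A smooth map from the complex plane to the base lifts over every disc. -/
theorem IsPrincipalCircleBundle.exists_lift_ball (hb : IsPrincipalCircleBundle 𝓘(ℝ, E) π)
    {β : ℂ → X} (hβ : ContMDiff 𝓘(ℝ, ℂ) 𝓘(ℝ, E) ∞ β) (R : ℝ) :
    ∃ s : ℂ → S, IsLiftOn π β s (Metric.ball 0 R) := by
  obtain ⟨s, hs⟩ := hb.exists_lift_rectangle hβ (-R) R (-R) R
  refine ⟨s, hs.mono fun z hz => ?_⟩
  rw [Metric.mem_ball, dist_zero_right] at hz
  have h1 := abs_lt.1 ((Complex.abs_re_le_norm z).trans_lt hz)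
  have h2 := abs_lt.1 ((Complex.abs_im_le_norm z).trans_lt hz)
  exact ⟨h1, h2⟩

end

end Sections

/-! ### Winding number of the transition function and the section over the plane -/

section Clutching

noncomputable section

/-- Polar coordinates. -/
def polarMap (q : ℝ × ℝ) : ℂ := (q.1 : ℂ) * Complex.exp (q.2 * Complex.I)

theorem contDiff_polarMap : ContDiff ℝ ∞ polarMap := by
  have h1 : ContDiff ℝ ∞ (fun q : ℝ × ℝ => (q.1 : ℂ)) := Complex.ofRealCLM.contDiff.comp contDiff_fst
  have h2 : ContDiff ℝ ∞ (fun q : ℝ × ℝ => (q.2 : ℂ)) := Complex.ofRealCLM.contDiff.comp contDiff_snd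
  exact h1.mul ((h2.mul contDiff_const).cexp)

theorem norm_polarMap (q : ℝ × ℝ) : ‖polarMap q‖ = |q.1| := by
  simp [polarMap, Complex.norm_exp_ofReal_mul_I]

theorem polarMap_norm_arg (z : ℂ) : polarMap (‖z‖, Complex.arg z) = z :=
  Complex.norm_mul_exp_arg_mul_I z

theorem polarMap_add_two_pi (r θ : ℝ) : polarMap (r, θ + 2 * Real.pi) = polarMap (r, θ) := by
  simp only [polarMap]
  push_cast
  rw [add_mul, Complex.exp_add, Complex.exp_two_pi_mul_I, mul_one]

theorem phase_polarMap {r : ℝ} (hr : 0 < r) (θ : ℝ) : phase (polarMap (r, θ)) = Circle.exp θ := by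
  have : polarMap (r, θ) = r * (Circle.exp θ : ℂ) := by simp [polarMap, Circle.coe_exp]
  rw [this, phase_real_mul hr, phase_coe]

variable {S : Type*} [TopologicalSpace S] [ChartedSpace E7 S]
  [MulAction Circle S] {E : Type*} [NormedAddCommGroup E] [NormedSpace ℝ E]
  {X : Type*} [TopologicalSpace X] [ChartedSpace E X]
  {π : S → X}

/-- The clutching function of a circle bundle over the annulus: two sections differ by a power of
the phase, up to a smooth logarithm. -/
theorem IsPrincipalCircleBundle.exists_degree (hb : IsPrincipalCircleBundle 𝓘(ℝ, E) π)
    {s₀ t : ℂ → S} {A : Set ℂ} (hA : A = {z | 1 / 2 < ‖z‖ ∧ ‖z‖ < 2})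
    (h₀ : ContMDiffOn 𝓘(ℝ, ℂ) (𝓡 7) ∞ s₀ A) (ht : ContMDiffOn 𝓘(ℝ, ℂ) (𝓡 7) ∞ t A)
    (h : ∀ z ∈ A, π (s₀ z) = π (t z)) :
    ∃ (k : ℤ) (H : ℂ → ℝ), ContDiffOn ℝ ∞ H A ∧
      ∀ z ∈ A, phase z ^ k • t z = Circle.exp (H z) • s₀ z := by
  have hAo : IsOpen A := by
    rw [hA]
    exact (isOpen_lt continuous_const continuous_norm).inter
      (isOpen_lt continuous_norm continuous_const)
  -- The annulus is not simply connected, but the strip of polar coordinates over it is convex, so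
  -- there the transition function has a logarithm `G`.
  set W : Set (ℝ × ℝ) := Ioo (1 / 2) 2 ×ˢ univ with hW
  have hWo : IsOpen W := isOpen_Ioo.prod isOpen_univ
  have hWc : Convex ℝ W := (convex_Ioo _ _).prod convex_univ
  have hWA : ∀ q ∈ W, polarMap q ∈ A := by
    intro q hq
    have hq0 : (0 : ℝ) < q.1 := by linarith [hq.1.1]
    rw [hA, mem_ofPred_eq, norm_polarMap, abs_of_pos hq0]
    exact hq.1
  have hp : ContMDiffOn 𝓘(ℝ, ℝ × ℝ) 𝓘(ℝ, ℂ) ∞ polarMap W :=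
    contDiff_polarMap.contMDiff.contMDiffOn
  obtain ⟨D, hD, hD'⟩ := hb.exists_transition hWo (ht.comp hp hWA) (h₀.comp hp hWA)
    fun q hq => (h _ (hWA q hq)).symm
  obtain ⟨G, hG, hG'⟩ := exists_smooth_log hWo hWc hD
  have hshift : ∀ q ∈ W, ∀ x : ℝ, (q.1, x) ∈ W := fun q hq x => ⟨hq.1, mem_univ _⟩
  have hper : ∀ q : ℝ × ℝ, ∃ m : ℤ, q ∈ W →
      G (q.1, q.2 + 2 * Real.pi) = G q + m * (2 * Real.pi) := by
    intro q
    by_cases hq : q ∈ W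
    · have hq' := hshift q hq (q.2 + 2 * Real.pi)
      have h1 : Circle.exp (G (q.1, q.2 + 2 * Real.pi)) = Circle.exp (G q) := by
        rw [← hG' _ hq', ← hG' _ hq]
        apply hb.smul_right_cancel (p := t (polarMap q))
        have h2 := hD' _ hq'
        simp only [Function.comp_apply, polarMap_add_two_pi] at h2
        rw [← h2]
        exact hD' _ hq
      obtain ⟨m, hm⟩ := Circle.exp_eq_exp.1 h1
      exact ⟨m, fun _ => hm⟩
    · exact ⟨0, fun h => absurd h hq⟩
  choose m hm using hper
  -- The defect of periodicity of `G`, divided by `2π`, is continuous and integer valued on a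
  -- connected set, hence constant: it is the winding number `k`.
  have hmc : ContinuousOn m W := by
    rw [Int.isClosedEmbedding_coe_real.isEmbedding.continuousOn_iff]
    have h1 : ContinuousOn (fun q : ℝ × ℝ => (G (q.1, q.2 + 2 * Real.pi) - G q) / (2 * Real.pi)) W := by
      refine (ContinuousOn.sub ?_ hG.continuousOn).div_const _
      exact hG.continuousOn.comp (f := fun q : ℝ × ℝ => (q.1, q.2 + 2 * Real.pi))
        (by fun_prop) fun q hq => hshift q hq _
    refine h1.congr fun q hq => ?_
    have := Real.pi_pos
    simp only [Function.comp_apply]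
    rw [hm q hq]
    field_simp
    ring
  set k : ℤ := m (1, 0) with hk
  have hmk : ∀ q ∈ W, m q = k := fun q hq =>
    hWc.isPreconnected.constant hmc hq ⟨by norm_num, mem_univ _⟩
  have hper : ∀ r ∈ Ioo (1 / 2 : ℝ) 2, ∀ θ : ℝ, ∀ n : ℤ,
      G (r, θ + n * (2 * Real.pi)) = G (r, θ) + k * (n * (2 * Real.pi)) := by
    intro r hr θ n
    induction n using Int.induction_on with
    | zero => simp
    | succ n ih =>
      have h1 := hm (r, θ + (n : ℤ) * (2 * Real.pi)) ⟨hr, mem_univ _⟩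
      rw [hmk _ ⟨hr, mem_univ _⟩] at h1
      simp only at h1
      rw [ih, add_assoc] at h1
      push_cast at h1 ⊢
      rw [add_mul, one_mul, h1]
      ring
    | pred n ih =>
      have h1 := hm (r, θ + (-(n : ℤ) - 1 : ℤ) * (2 * Real.pi)) ⟨hr, mem_univ _⟩
      rw [hmk _ ⟨hr, mem_univ _⟩] at h1
      have h2 : θ + (-(n : ℤ) - 1 : ℤ) * (2 * Real.pi) + 2 * Real.pi =
        θ + (-(n : ℤ) : ℤ) * (2 * Real.pi) := by push_cast; ring
      simp only [h2] at h1
      rw [ih] at h1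
      push_cast at h1 ⊢
      linarith
  have hpos : ∀ z ∈ A, z ≠ 0 := by
    rintro z hz rfl
    rw [hA] at hz
    have := hz.1
    norm_num at this
  have hnorm : ∀ z ∈ A, ‖z‖ ∈ Ioo (1 / 2 : ℝ) 2 := by
    intro z hz
    rw [hA] at hz
    exact hz
  -- `k θ - G (r, θ)` is periodic in `θ`, so it is a smooth function on the annulus although `arg`
  -- jumps. Near each point `arg` is replaced by a smooth branch `B`, which differs from it by a
  -- multiple of `2π`.
  refine ⟨k, fun z => k * Complex.arg z - G (‖z‖, Complex.arg z), fun z hz => ?_, fun z hz => ?_⟩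
  · obtain ⟨B, hB, -, hB'⟩ := exists_branch_arg (hpos z hz)
    have h1 : ContDiffAt ℝ ∞ (fun w : ℂ => (‖w‖, B w)) z :=
      (contDiffAt_norm ℝ (hpos z hz)).prodMk hB
    have h2 : ContDiffAt ℝ ∞ (fun w : ℂ => G (‖w‖, B w)) z :=
      ContDiffAt.comp (g := G) (f := fun w : ℂ => (‖w‖, B w)) z
        (hG.contDiffAt (hWo.mem_nhds ⟨hnorm z hz, mem_univ _⟩)) h1
    have h3 : ContDiffAt ℝ ∞ (fun w : ℂ => (k : ℝ) * B w - G (‖w‖, B w)) z :=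
      (contDiffAt_const.mul hB).sub h2
    refine (h3.congr_of_eventuallyEq ?_).contDiffWithinAt
    filter_upwards [hAo.mem_nhds hz] with w hw
    obtain ⟨n, hn⟩ := Circle.exp_eq_exp.1 (hB' w (hpos w hw)).symm
    rw [hn, hper _ (hnorm w hw)]
    ring
  · have h1 := hD' (‖z‖, Complex.arg z) ⟨hnorm z hz, mem_univ _⟩
    rw [hG' _ ⟨hnorm z hz, mem_univ _⟩] at h1
    simp only [Function.comp_apply, polarMap_norm_arg] at h1
    rw [h1, smul_smul, ← Circle.exp_add, sub_add_cancel, phase, ← Circle.exp_intCast_mul]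

/-- A section of the bundle over the affine line, with its behaviour at infinity. -/
theorem IsPrincipalCircleBundle.exists_section_plane (hb : IsPrincipalCircleBundle 𝓘(ℝ, E) π)
    {β₀ β₁ : ℂ → X} (hβ₀ : ContMDiff 𝓘(ℝ, ℂ) 𝓘(ℝ, E) ∞ β₀)
    (hβ₁ : ContMDiff 𝓘(ℝ, ℂ) 𝓘(ℝ, E) ∞ β₁) (hβ : ∀ z, z ≠ 0 → β₀ z = β₁ z⁻¹) :
    ∃ (s s₁ : ℂ → S) (k : ℤ), IsLiftOn π β₀ s univ ∧ IsLiftOn π β₁ s₁ (Metric.ball 0 2) ∧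
      ∀ z, 1 ≤ ‖z‖ → s z = phase z ^ k • s₁ z⁻¹ := by
  obtain ⟨s₀, h₀⟩ := hb.exists_lift_ball hβ₀ 2
  obtain ⟨s₁, h₁⟩ := hb.exists_lift_ball hβ₁ 2
  set U₂ : Set ℂ := {z | 1 / 2 < ‖z‖} with hU₂
  have hU₂o : IsOpen U₂ := isOpen_lt continuous_const continuous_norm
  have hne : ∀ z ∈ U₂, z ≠ 0 := by
    rintro z hz rfl
    rw [hU₂, mem_ofPred_eq] at hz
    norm_num at hz
  have hinv : ∀ z ∈ U₂, z⁻¹ ∈ Metric.ball (0 : ℂ) 2 := by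
    intro z hz
    rw [mem_ball_zero_iff, norm_inv]
    exact inv_lt_of_inv_lt₀ (by norm_num) (by rw [hU₂, mem_ofPred_eq] at hz; linarith)
  have ht : IsLiftOn π β₀ (fun z => s₁ z⁻¹) U₂ := by
    refine ⟨fun z hz => ContMDiffAt.contMDiffWithinAt ?_, fun z hz => ?_⟩
    · have h2 : ContMDiffAt 𝓘(ℝ, ℂ) 𝓘(ℝ, ℂ) ∞ (fun z : ℂ => z⁻¹) z :=
        (contDiffAt_inv ℝ (hne z hz)).contMDiffAt
      exact (h₁.contMDiffAt Metric.isOpen_ball (hinv z hz)).comp z h2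
    · rw [h₁.proj _ (hinv z hz), hβ z (hne z hz)]
  have hA : Metric.ball (0 : ℂ) 2 ∩ U₂ = {z | 1 / 2 < ‖z‖ ∧ ‖z‖ < 2} := by
    ext z
    simp only [hU₂, mem_inter_iff, mem_ball_zero_iff, mem_ofPred_eq]
    tauto
  obtain ⟨k, H, hH, hH'⟩ := hb.exists_degree hA (h₀.smooth.mono inter_subset_left)
    (ht.smooth.mono inter_subset_right) fun z hz => by rw [h₀.proj z hz.1, ht.proj z hz.2]
  have h₂ : IsLiftOn π β₀ (fun z => phase z ^ k • s₁ z⁻¹) U₂ := by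
    refine ⟨fun z hz => ContMDiffAt.contMDiffWithinAt ?_, fun z hz => ?_⟩
    · obtain ⟨B, hB, -, hB'⟩ := exists_branch_arg (hne z hz)
      have h2 : ContMDiffAt 𝓘(ℝ, ℂ) (𝓡 1) ∞ (fun z => phase z ^ k) z := by
        refine (contMDiffAt_circleExp_comp
          ((contDiffAt_const (c := (k : ℝ))).mul hB)).congr_of_eventuallyEq ?_
        filter_upwards [hU₂o.mem_nhds hz] with w hw
        rw [hB' w (hne w hw), ← Circle.exp_intCast_mul]
      exact hb.contMDiffAt_smul h2 (ht.contMDiffAt hU₂o hz)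
    · rw [hb.smul_proj, ht.proj z hz]
  -- The levels `1/3` and `1/2` of `|z|²` lie in the annulus `1/4 < |z|² < 4` of the overlap and
  -- below `1`, so the glued lift is the twisted one for `|z| ≥ 1`.
  obtain ⟨s, hs, -, hs2⟩ := hb.exists_glue Metric.isOpen_ball hU₂o h₀ h₂ (hA ▸ hH)
    (fun z hz => hH' z hz) (l := fun z => ‖z‖ ^ 2) (contDiff_norm_sq ℝ)
    (c := 1 / 3) (d := 1 / 2) (by norm_num)
  refine ⟨s, s₁, k, hs.mono fun z _ => ?_, h₁, fun z hz => hs2 z (by nlinarith)⟩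
  by_cases hz1 : ‖z‖ ^ 2 < 1 / 3
  · exact Or.inl (Or.inl ⟨by rw [mem_ball_zero_iff]; nlinarith [norm_nonneg z], hz1⟩)
  have hz2 : z ∈ U₂ := by
    rw [hU₂, mem_ofPred_eq]
    by_contra h
    nlinarith [norm_nonneg z]
  by_cases hz3 : 1 / 2 < ‖z‖ ^ 2
  · exact Or.inr ⟨hz2, hz3⟩
  · exact Or.inl (Or.inr ⟨by rw [mem_ball_zero_iff]; nlinarith [norm_nonneg z], hz2⟩)

end

end Clutching

/-! ### Pullbacks of one-forms; polar coordinates -/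

section OneForms

noncomputable section

variable {E : Type*} [NormedAddCommGroup E] [NormedSpace ℝ E]
  {H : Type*} [TopologicalSpace H] {I : ModelWithCorners ℝ E H} [I.Boundaryless]
  {M : Type*} [TopologicalSpace M] [ChartedSpace H M] [IsManifold I ∞ M]
  {V : Type*} [NormedAddCommGroup V] [NormedSpace ℝ V]

/-- One-forms are identified with linear maps, and the pullback becomes the composition of two
smooth families of linear maps. -/
theorem contDiffAt_pullbackForm_one {f : V → M} {v : V} {α : DiffForm I M 1 ℝ}
    (hα : IsSmoothForm α) (hf : ∀ᶠ w in 𝓝 v, ContMDiffAt 𝓘(ℝ, V) I ∞ f w) :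
    ContDiffAt ℝ ∞ (pullbackForm f α) v := by
  have hfv := hf.self_of_nhds
  have hx : f v ∈ (extChartAt I (f v)).source := mem_extChartAt_source _
  have hmem : (extChartAt I (f v) (f v)) ∈ (extChartAt I (f v)).target := mem_extChartAt_target _
  have hsm : ContDiffAt ℝ ∞ (formInChart α (f v)) (extChartAt I (f v) (f v)) :=
    (hα (f v)).contDiffAt ((isOpen_extChartAt_target (f v)).mem_nhds hmem)
  let L := ContinuousAlternatingMap.ofSubsingletonLIE (𝕜 := ℝ) (E := E) (F := ℝ) (0 : Fin 1)
  let L' := ContinuousAlternatingMap.ofSubsingletonLIE (𝕜 := ℝ) (E := V) (F := ℝ) (0 : Fin 1)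
  have hc := contDiffAt_extChartAt_comp hfv hx
  have h1 : ContDiffAt ℝ ∞ (fun w => L' ((L.symm (formInChart α (f v)
      (extChartAt I (f v) (f w)))).comp (fderiv ℝ (fun w => extChartAt I (f v) (f w)) w))) v := by
    refine L'.contDiff.contDiffAt.comp v (ContDiffAt.clm_comp ?_ ?_)
    · exact L.symm.contDiff.contDiffAt.comp v
        (ContDiffAt.comp (g := formInChart α (f v)) v hsm hc)
    · exact hc.fderiv_right (by simp)
  refine h1.congr_of_eventuallyEq ?_
  filter_upwards [hf, hfv.continuousAt.preimage_mem_nhds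
    ((isOpen_extChartAt_source (I := I) (f v)).mem_nhds hx)] with w hw hw'
  rw [pullbackForm_eq_chart hw hw' α]
  ext u
  have : u = ![u 0] := by ext i; fin_cases i; rfl
  rw [this]
  simp only [ContinuousAlternatingMap.compContinuousLinearMap_apply, L', L]
  change _ = formInChart α (f v) (extChartAt I (f v) (f w)) (fun _ => _)
  congr 1
  ext i; fin_cases i; rfl

theorem pullbackForm_one_add (f : V → M) (α : DiffForm I M 1 ℝ) (v a b : V) :
    pullbackForm f α v ![a + b] = pullbackForm f α v ![a] + pullbackForm f α v ![b] := by
  have := ((ContinuousAlternatingMap.ofSubsingletonLIE (𝕜 := ℝ) (E := V) (F := ℝ) (0 : Fin 1)).symm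
    (pullbackForm f α v)).map_add a b
  have h : ∀ c : V, (ContinuousAlternatingMap.ofSubsingletonLIE (𝕜 := ℝ) (E := V) (F := ℝ) (0 : Fin 1)).symm
    (pullbackForm f α v) c = pullbackForm f α v ![c] := by
      intro c
      change pullbackForm f α v (fun _ => c) = _
      congr 1
      ext i; fin_cases i; rfl
  simpa only [h] using this

theorem pullbackForm_one_smul (f : V → M) (α : DiffForm I M 1 ℝ) (v a : V) (c : ℝ) :
    pullbackForm f α v ![c • a] = c * pullbackForm f α v ![a] := by
  have := ((ContinuousAlternatingMap.ofSubsingletonLIE (𝕜 := ℝ) (E := V) (F := ℝ) (0 : Fin 1)).symm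
    (pullbackForm f α v)).map_smul c a
  have h : ∀ c : V, (ContinuousAlternatingMap.ofSubsingletonLIE (𝕜 := ℝ) (E := V) (F := ℝ) (0 : Fin 1)).symm
    (pullbackForm f α v) c = pullbackForm f α v ![c] := by
      intro c
      change pullbackForm f α v (fun _ => c) = _
      congr 1
      ext i; fin_cases i; rfl
  simpa only [h, smul_eq_mul] using this

theorem formAt_one_zero (α : DiffForm I M 1 ℝ) (x : M) : formAt α x ![0] = 0 :=
  (formAt α x).map_coord_zero 0 rfl

theorem pullbackForm_comp {W : Type*} [NormedAddCommGroup W] [NormedSpace ℝ W] {f : V → M}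
    {h : W → V} {w : W} (α : DiffForm I M 1 ℝ) (hf : MDifferentiableAt 𝓘(ℝ, V) I f (h w))
    (hh : DifferentiableAt ℝ h w) (u : W) :
    pullbackForm (fun y => f (h y)) α w ![u] = pullbackForm f α (h w) ![fderiv ℝ h w u] := by
  rw [pullbackForm_one, pullbackForm_one, tderiv_comp_apply w hf hh.mdifferentiableAt,
    tderiv_eq_fderiv]

theorem alternating_two_complex (α : ℂ [⋀^Fin 2]→L[ℝ] ℝ) (a b : ℂ) :
    α ![a, b] = (a.re * b.im - a.im * b.re) * α ![1, Complex.I] := by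
  have h : ∀ z : ℂ, z = z.re • (1 : ℂ) + z.im • Complex.I := by
    intro z
    rw [Complex.real_smul, Complex.real_smul, mul_one, Complex.re_add_im]
  have h1 : α ![a, b] = α ![a.re • (1 : ℂ) + a.im • Complex.I,
      b.re • (1 : ℂ) + b.im • Complex.I] := by rw [← h, ← h]
  rw [h1]
  simp only [alternating_two_add_left, alternating_two_add_right, alternating_two_smul_left,
    alternating_two_smul_right, alternating_two_self, alternating_two_swap α Complex.I 1]
  ring

theorem hasFDerivAt_polarMap (q : ℝ × ℝ) : HasFDerivAt polarMap
    ((Complex.exp (q.2 * Complex.I)) • (Complex.ofRealCLM.comp (ContinuousLinearMap.fst ℝ ℝ ℝ)) +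
      (q.1 * (Complex.exp (q.2 * Complex.I) * Complex.I)) •
        (Complex.ofRealCLM.comp (ContinuousLinearMap.snd ℝ ℝ ℝ))) q := by
  have h1 : HasFDerivAt (fun q : ℝ × ℝ => (q.1 : ℂ))
    (Complex.ofRealCLM.comp (ContinuousLinearMap.fst ℝ ℝ ℝ)) q :=
      (Complex.ofRealCLM.hasFDerivAt).comp q hasFDerivAt_fst
  have h2 : HasFDerivAt (fun q : ℝ × ℝ => (q.2 : ℂ))
    (Complex.ofRealCLM.comp (ContinuousLinearMap.snd ℝ ℝ ℝ)) q :=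
      (Complex.ofRealCLM.hasFDerivAt).comp q hasFDerivAt_snd
  have h3 := h1.mul (h2.mul_const Complex.I).cexp
  refine h3.congr_fderiv ?_
  ext <;> simp

theorem fderiv_polarMap_fst (r θ : ℝ) :
    fderiv ℝ polarMap (r, θ) (1, 0) = Complex.exp (θ * Complex.I) := by
  rw [(hasFDerivAt_polarMap _).fderiv]; simp

theorem fderiv_polarMap_snd (r θ : ℝ) :
    fderiv ℝ polarMap (r, θ) (0, 1) = r * (Complex.exp (θ * Complex.I) * Complex.I) := by
  rw [(hasFDerivAt_polarMap _).fderiv]; simp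

/-- The area form in polar coordinates. -/
theorem alternating_two_polar (α : ℂ [⋀^Fin 2]→L[ℝ] ℝ) (r θ : ℝ) :
    α ![fderiv ℝ polarMap (r, θ) (1, 0), fderiv ℝ polarMap (r, θ) (0, 1)] =
      r * α ![1, Complex.I] := by
  rw [fderiv_polarMap_fst, fderiv_polarMap_snd, alternating_two_complex]
  congr 1
  have := Real.cos_sq_add_sin_sq θ
  simp [Complex.exp_re, Complex.exp_im]
  linear_combination r * this

end

end OneForms

/-! ### The connection form on lifts of the line -/

section Degree

noncomputable section

variable {S : Type*} [TopologicalSpace S] [ChartedSpace E7 S] [IsManifold (𝓡 7) ∞ S]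
  [MulAction Circle S]
  {E : Type*} [NormedAddCommGroup E] [NormedSpace ℂ E]
  {P : Type*} [TopologicalSpace P] [ChartedSpace E P] [IsManifold 𝓘(ℂ, E) ω P]
  {π : S → CP1 × P} {ω₁ : DiffForm 𝓘(ℝ, ℂ) CP1 2 ℝ} {ωP : DiffForm 𝓘(ℝ, E) P 2 ℝ}
  {η : DiffForm (𝓡 7) S 1 ℝ}

/-- The density of a 2-form on the projective line in the affine coordinate. -/
def affineDensity (κ : DiffForm 𝓘(ℝ, ℂ) CP1 2 ℝ) (z : ℂ) : ℝ :=
  pullbackForm (fun w : ℂ => (w : CP1)) κ z ![1, Complex.I]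

theorem integralCP1_eq (κ : DiffForm 𝓘(ℝ, ℂ) CP1 2 ℝ) :
    integralCP1 κ = ∫ z : ℂ, affineDensity κ z := by
  unfold integralCP1 affineDensity
  congr 1
  ext z
  rw [pullbackForm_two]
  rfl

theorem tderiv_affineLine (p : P) (z u : ℂ) : tderiv 𝓘(ℝ, ℂ) 𝓘(ℝ, ℂ × E) (affineLine p) z u =
    (tderiv 𝓘(ℝ, ℂ) 𝓘(ℝ, ℂ) (fun w : ℂ => (w : CP1)) z u, 0) := by
  have h := tderiv_prodMk (J := 𝓘(ℝ, ℂ)) (I := 𝓘(ℝ, ℂ)) (I' := 𝓘(ℝ, E))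
    ((contMDiff_coe_CP1 z).mdifferentiableAt (by simp))
    (mdifferentiableAt_const (c := p) (x := z)) u
  rw [tderiv_const'] at h
  rw [modelWithCornersSelf_prod]
  exact h

namespace IsBundleWithUnitEulerClass

/-- The pullback of the curvature under a lift of a map to the affine line. -/
theorem extDeriv_pullback_lift (hb : IsBundleWithUnitEulerClass π ω₁ ωP η) {p : P}
    {F : ℝ × ℝ → S} (hF : ContMDiff 𝓘(ℝ, ℝ × ℝ) (𝓡 7) ∞ F)
    (hπ : ∀ q, π (F q) = affineLine p (polarMap q)) (r θ : ℝ) :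
    extDeriv (pullbackForm F η) (r, θ) ![(1, 0), (0, 1)] =
      r * affineDensity ω₁ (polarMap (r, θ)) := by
  rw [extDeriv_pullbackForm hb.smooth (Eventually.of_forall fun w => hF w), pullbackForm_two]
  have h1 : ∀ u, tderiv (𝓡 7) 𝓘(ℝ, ℂ × E) π (F (r, θ))
      (tderiv 𝓘(ℝ, ℝ × ℝ) (𝓡 7) F (r, θ) u) =
      (tderiv 𝓘(ℝ, ℂ) 𝓘(ℝ, ℂ) (fun w : ℂ => (w : CP1)) (polarMap (r, θ))
        (fderiv ℝ polarMap (r, θ) u), 0) := by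
    intro u
    rw [← tderiv_comp_apply (r, θ) (hb.bundle.mdifferentiableAt _)
      ((hF _).mdifferentiableAt (by simp))]
    have h2 : (fun y => π (F y)) = fun y => affineLine p (polarMap y) := funext hπ
    rw [h2, tderiv_comp_apply (I' := 𝓘(ℝ, ℂ)) (r, θ)
      ((contMDiff_affineLine p _).mdifferentiableAt (by simp))
      (((contDiff_polarMap.differentiable (by simp)) _).mdifferentiableAt), tderiv_affineLine,
      tderiv_eq_fderiv]
  have h2 : formAt (extDerivative η) (F (r, θ)) ![tderiv 𝓘(ℝ, ℝ × ℝ) (𝓡 7) F (r, θ) (1, 0),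
      tderiv 𝓘(ℝ, ℝ × ℝ) (𝓡 7) F (r, θ) (0, 1)] =
      formAt ω₁ (π (F (r, θ))).1 ![
        (tderiv (𝓡 7) 𝓘(ℝ, ℂ × E) π (F (r, θ)) (tderiv 𝓘(ℝ, ℝ × ℝ) (𝓡 7) F (r, θ) (1, 0))).1,
        (tderiv (𝓡 7) 𝓘(ℝ, ℂ × E) π (F (r, θ)) (tderiv 𝓘(ℝ, ℝ × ℝ) (𝓡 7) F (r, θ) (0, 1))).1] +
      formAt ωP (π (F (r, θ))).2 ![
        (tderiv (𝓡 7) 𝓘(ℝ, ℂ × E) π (F (r, θ)) (tderiv 𝓘(ℝ, ℝ × ℝ) (𝓡 7) F (r, θ) (1, 0))).2,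
        (tderiv (𝓡 7) 𝓘(ℝ, ℂ × E) π (F (r, θ)) (tderiv 𝓘(ℝ, ℝ × ℝ) (𝓡 7) F (r, θ) (0, 1))).2] :=
    hb.curvature (F (r, θ)) _ _
  -- Vectors tangent to `ℂP¹ × {p}` have no component along `P`, so `ω_P` contributes nothing.
  rw [h2, h1, h1, alternating_two_self, add_zero, hπ]
  change formAt ω₁ ((polarMap (r, θ) : ℂ) : CP1) _ = _
  rw [← pullbackForm_two, alternating_two_polar]
  rfl

/-- The contact form on the direction of the fibres. -/
theorem pullbackForm_fibre (hb : IsBundleWithUnitEulerClass π ω₁ ωP η) {s : ℂ → S} {w : ℂ}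
    (hs : ContMDiffAt 𝓘(ℝ, ℂ) (𝓡 7) ∞ s w) (t : ℝ) :
    pullbackForm (fun y : ℝ × ℂ => Circle.exp y.1 • s y.2) η (t, w) ![(1, 0)] =
      (2 * Real.pi)⁻¹ := by
  set G : ℝ × ℂ → S := fun y => Circle.exp y.1 • s y.2 with hG
  have hGs : ContMDiffAt 𝓘(ℝ, ℝ × ℂ) (𝓡 7) ∞ G (t, w) := by
    refine hb.bundle.contMDiffAt_smul (contMDiffAt_circleExp_comp contDiffAt_fst) ?_
    exact ContMDiffAt.comp (t, w) hs contDiffAt_snd.contMDiffAt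
  -- The generator has flow of period one, whereas the parameter of `Circle.exp` has period `2π`;
  -- this is the source of the factor `(2π)⁻¹`.
  have h1 : (fun x : ℝ => Circle.exp (2 * Real.pi * x) • G (t, w)) =
      fun x => G (t + 2 * Real.pi * x, w) := by
    ext x
    simp only [hG]
    rw [smul_smul, ← Circle.exp_add, add_comm]
  have h2 : HasFDerivAt (fun x : ℝ => (t + 2 * Real.pi * x, w))
      ((ContinuousLinearMap.toSpanSingleton ℝ (2 * Real.pi)).prod (0 : ℝ →L[ℝ] ℂ)) 0 := by
    refine HasFDerivAt.prodMk ?_ (hasFDerivAt_const _ _)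
    have := ((hasDerivAt_id (0 : ℝ)).const_mul (2 * Real.pi)).const_add t
    simp only [mul_one] at this
    exact this.hasFDerivAt
  have h3 : tderiv 𝓘(ℝ, ℝ) (𝓡 7) (fun x : ℝ => Circle.exp (2 * Real.pi * x) • G (t, w)) 0 1 =
      (2 * Real.pi) • tderiv 𝓘(ℝ, ℝ × ℂ) (𝓡 7) G (t, w) (1, 0) := by
    have h0 : (t + 2 * Real.pi * 0, w) = (t, w) := by simp
    rw [h1, tderiv_comp_apply (g := G) (f := fun x : ℝ => (t + 2 * Real.pi * x, w))
      (I' := 𝓘(ℝ, ℝ × ℂ)) 0 (by rw [h0]; exact hGs.mdifferentiableAt (by simp))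
      h2.differentiableAt.mdifferentiableAt, tderiv_eq_fderiv, h2.fderiv, h0, ← map_smul]
    congr 1
    simp
  have h4 : formAt η (G (t, w)) ![tderiv 𝓘(ℝ, ℝ) (𝓡 7)
      (fun x : ℝ => Circle.exp (2 * Real.pi * x) • G (t, w)) 0 1] = 1 := by
    exact hb.normalised (G (t, w))
  have h5 : formAt η (G (t, w)) ![(2 * Real.pi) • tderiv 𝓘(ℝ, ℝ × ℂ) (𝓡 7) G (t, w) (1, 0)] =
      2 * Real.pi * pullbackForm G η (t, w) ![(1, 0)] := by
    rw [← pullbackForm_one_smul, pullbackForm_one, map_smul]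
  rw [h3, h5] at h4
  exact eq_inv_of_mul_eq_one_right h4

end IsBundleWithUnitEulerClass

end

end Degree

/-! ### The winding number equals the total curvature -/

section Stokes

noncomputable section

open MeasureTheory

variable {S : Type*} [TopologicalSpace S] [ChartedSpace E7 S] [IsManifold (𝓡 7) ∞ S]
  [MulAction Circle S]
  {E : Type*} [NormedAddCommGroup E] [NormedSpace ℂ E]
  {P : Type*} [TopologicalSpace P] [ChartedSpace E P] [IsManifold 𝓘(ℂ, E) ω P]
  {π : S → CP1 × P} {ω₁ : DiffForm 𝓘(ℝ, ℂ) CP1 2 ℝ} {ωP : DiffForm 𝓘(ℝ, E) P 2 ℝ}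
  {η : DiffForm (𝓡 7) S 1 ℝ}

namespace IsBundleWithUnitEulerClass

/-- Stokes' theorem on a disc, in polar coordinates. -/
theorem integral_disc (hb : IsBundleWithUnitEulerClass π ω₁ ωP η) {p : P} {s : ℂ → S}
    (hs : ContMDiff 𝓘(ℝ, ℂ) (𝓡 7) ∞ s) (hπ : ∀ z, π (s z) = affineLine p z) (R : ℝ) :
    ∫ r in (0 : ℝ)..R, ∫ θ in (-Real.pi)..Real.pi, r * affineDensity ω₁ (polarMap (r, θ)) =
      ∫ θ in (-Real.pi)..Real.pi,
        pullbackForm (fun q => s (polarMap q)) η (R, θ) ![(0, 1)] := by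
  set F : ℝ × ℝ → S := fun q => s (polarMap q) with hF
  have hFs : ContMDiff 𝓘(ℝ, ℝ × ℝ) (𝓡 7) ∞ F := hs.comp contDiff_polarMap.contMDiff
  set β := pullbackForm F η with hβ
  have hβs : ContDiff ℝ ∞ β := contDiff_iff_contDiffAt.2 fun q =>
    contDiffAt_pullbackForm_one hb.smooth (Eventually.of_forall fun w => hFs w)
  have hev : ∀ u : ℝ × ℝ, ContDiff ℝ ∞ fun q => β q ![u] := fun u =>
    (ContinuousAlternatingMap.apply ℝ (ℝ × ℝ) ℝ ![u]).contDiff.comp hβs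
  have hdiv : ∀ q : ℝ × ℝ, fderiv ℝ (fun q => β q ![(0, 1)]) q (1, 0) +
      (-fderiv ℝ (fun q => β q ![(1, 0)]) q) (0, 1) = q.1 * affineDensity ω₁ (polarMap q) := by
    rintro ⟨r, θ⟩
    rw [← hb.extDeriv_pullback_lift hFs (fun q => hπ _) r θ,
      extDeriv_one_apply ((hβs.differentiable (by simp)) _), neg_apply,
      sub_eq_add_neg]
  have hcont : Continuous fun q : ℝ × ℝ => fderiv ℝ (fun q => β q ![(0, 1)]) q (1, 0) +
      (-fderiv ℝ (fun q => β q ![(1, 0)]) q) (0, 1) := by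
    have h1 := ((hev (0, 1)).continuous_fderiv (by simp)).clm_apply
      (continuous_const (y := ((1, 0) : ℝ × ℝ)))
    have h2 := ((hev (1, 0)).continuous_fderiv (by simp)).neg.clm_apply
      (continuous_const (y := ((0, 1) : ℝ × ℝ)))
    exact h1.add h2
  -- Stokes' theorem as the divergence theorem on the rectangle of polar coordinates. Of the four
  -- sides, only `r = R` contributes.
  have h := integral2_divergence_prod_of_hasFDerivAt (fun q => β q ![(0, 1)])
    (fun q => -β q ![(1, 0)]) (fun q => fderiv ℝ (fun q => β q ![(0, 1)]) q)
    (fun q => -fderiv ℝ (fun q => β q ![(1, 0)]) q) 0 (-Real.pi) R Real.pi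
    (hev _).continuous.continuousOn (hev _).continuous.neg.continuousOn
    (fun q _ => ((hev _).differentiable (by simp) q).hasFDerivAt)
    (fun q _ => ((hev _).differentiable (by simp) q).hasFDerivAt.neg)
    (hcont.continuousOn.integrableOn_compact (isCompact_uIcc.prod isCompact_uIcc))
  simp only [hdiv] at h
  rw [h]
  -- The sides `θ = π` and `θ = -π` have the same image and cancel.
  have hper : ∀ x : ℝ, β (x, Real.pi) ![(1, 0)] = β (x, -Real.pi) ![(1, 0)] := by
    intro x
    have h1 : F = fun q => F (q + (0, 2 * Real.pi)) := by
      funext q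
      simp only [hF]
      congr 1
      have : q + (0, 2 * Real.pi) = (q.1, q.2 + 2 * Real.pi) := by ext <;> simp
      rw [this, polarMap_add_two_pi]
    have h2 : β (x, -Real.pi) ![(1, 0)] =
        pullbackForm (fun q => F (q + (0, 2 * Real.pi))) η (x, -Real.pi) ![(1, 0)] := by
      rw [← h1]
    rw [h2, pullbackForm_comp (h := fun q : ℝ × ℝ => q + (0, 2 * Real.pi)) η
      ((hFs _).mdifferentiableAt (by simp)) (by fun_prop)]
    rw [fderiv_add_const, fderiv_fun_id]
    have h3 : ((x, -Real.pi) : ℝ × ℝ) + (0, 2 * Real.pi) = (x, Real.pi) := by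
      ext
      · simp
      · simp; ring
    rw [h3]
    rfl
  -- The side `r = 0` is mapped to a point.
  have hzero : ∀ y : ℝ, β (0, y) ![(0, 1)] = 0 := by
    intro y
    rw [hβ, hF, pullbackForm_comp (h := polarMap) η ((hs _).mdifferentiableAt (by simp))
      ((contDiff_polarMap.differentiable (by simp)) _), fderiv_polarMap_snd, pullbackForm_one]
    simp only [Complex.ofReal_zero, zero_mul, map_zero]
    exact formAt_one_zero _ _
  simp only [hper, hzero]
  simp

/-- The total curvature of the line is the limit of the integrals of the connection form over
large circles. -/
theorem tendsto_integral_circle (hb : IsBundleWithUnitEulerClass π ω₁ ωP η) {p : P} {s : ℂ → S}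
    (hs : ContMDiff 𝓘(ℝ, ℂ) (𝓡 7) ∞ s) (hπ : ∀ z, π (s z) = affineLine p z) :
    Tendsto (fun R : ℝ => ∫ θ in (-Real.pi)..Real.pi,
        pullbackForm (fun q => s (polarMap q)) η (R, θ) ![(0, 1)]) atTop (𝓝 1) := by
  have h1 : ∫ q in Ioi (0 : ℝ) ×ˢ Ioo (-Real.pi) Real.pi,
      q.1 * affineDensity ω₁ (polarMap q) = 1 := by
    rw [← hb.integral₁, integralCP1_eq, ← Complex.integral_comp_polarCoord_symm,
      polarCoord_target]
    refine setIntegral_congr_fun (measurableSet_Ioi.prod measurableSet_Ioo) fun q _ => ?_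
    simp only [smul_eq_mul, Complex.polarCoord_symm_apply, polarMap]
    rw [Complex.exp_mul_I]
    push_cast
    rfl
  -- The integral of a non-integrable function is zero by convention, and this one is `1`; so
  -- integrability follows from the normalisation of `ω₁`. The same device is used for the integral
  -- over `r`.
  have hint : IntegrableOn (fun q : ℝ × ℝ => q.1 * affineDensity ω₁ (polarMap q))
      (Ioi (0 : ℝ) ×ˢ Ioo (-Real.pi) Real.pi) := by
    by_contra h
    rw [integral_undef h] at h1
    exact zero_ne_one h1
  rw [Measure.volume_eq_prod] at h1 hint
  rw [setIntegral_prod _ hint] at h1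
  have hint2 : IntegrableOn (fun r : ℝ => ∫ θ in Ioo (-Real.pi) Real.pi,
      r * affineDensity ω₁ (polarMap (r, θ))) (Ioi (0 : ℝ)) := by
    by_contra h
    rw [integral_undef h] at h1
    exact zero_ne_one h1
  have h2 := intervalIntegral_tendsto_integral_Ioi 0 hint2 tendsto_id
  rw [h1] at h2
  refine h2.congr fun R => ?_
  rw [← hb.integral_disc hs hπ R]
  refine intervalIntegral.integral_congr fun r _ => ?_
  rw [intervalIntegral.integral_of_le (by linarith [Real.pi_pos]), integral_Ioc_eq_integral_Ioo]

/-- The connection form on a large circle, for a section with winding number `k` at infinity. -/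
theorem integral_circle_sub_le (hb : IsBundleWithUnitEulerClass π ω₁ ωP η) {s s₁ : ℂ → S}
    (hs : ContMDiff 𝓘(ℝ, ℂ) (𝓡 7) ∞ s) (hs₁ : ContMDiffOn 𝓘(ℝ, ℂ) (𝓡 7) ∞ s₁ (Metric.ball 0 2))
    {k : ℤ} (hk : ∀ z, 1 ≤ ‖z‖ → s z = phase z ^ k • s₁ z⁻¹) :
    ∃ C : ℝ, ∀ R : ℝ, 1 ≤ R → |(∫ θ in (-Real.pi)..Real.pi,
        pullbackForm (fun q => s (polarMap q)) η (R, θ) ![(0, 1)]) - k| ≤ C / R := by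
  -- On the circle of radius `R` the section is `G (kθ, e^{-iθ} / R)`. All these points lie in the
  -- compact set `K`, on which `G^* η` is bounded uniformly in `R`.
  set G : ℝ × ℂ → S := fun y => Circle.exp y.1 • s₁ y.2 with hG
  have hball : ∀ y : ℝ × ℂ, ‖y.2‖ < 2 → ∀ᶠ w in 𝓝 y, ContMDiffAt 𝓘(ℝ, ℝ × ℂ) (𝓡 7) ∞ G w := by
    intro y hy
    filter_upwards [(isOpen_lt continuous_snd.norm continuous_const).mem_nhds hy] with w hw
    refine hb.bundle.contMDiffAt_smul (contMDiffAt_circleExp_comp contDiffAt_fst) ?_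
    exact ContMDiffAt.comp (g := s₁) (f := Prod.snd) w (hs₁.contMDiffAt
      (Metric.isOpen_ball.mem_nhds (by simpa using hw))) contDiffAt_snd.contMDiffAt
  set K : Set (ℝ × ℂ) := Icc (-(|k| * Real.pi)) (|k| * Real.pi) ×ˢ Metric.closedBall 0 1 with hK
  have hKc : IsCompact K := isCompact_Icc.prod (isCompact_closedBall 0 1)
  have hcont : ContinuousOn (pullbackForm G η) K := by
    intro y hy
    have h1 : ‖y.2‖ < 2 := by
      have := mem_closedBall_zero_iff.1 hy.2
      linarith
    exact (contDiffAt_pullbackForm_one hb.smooth (hball y h1)).continuousAt.continuousWithinAt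
  obtain ⟨C, hC⟩ := hKc.exists_bound_of_continuousOn hcont
  refine ⟨C * (2 * Real.pi), fun R hR => ?_⟩
  have hR0 : 0 < R := by linarith
  set F : ℝ × ℝ → S := fun q => s (polarMap q) with hF
  have hFs : ContMDiff 𝓘(ℝ, ℝ × ℝ) (𝓡 7) ∞ F := hs.comp contDiff_polarMap.contMDiff
  have hβs : ContDiff ℝ ∞ (pullbackForm F η) := contDiff_iff_contDiffAt.2 fun q =>
    contDiffAt_pullbackForm_one hb.smooth (Eventually.of_forall fun w => hFs w)
  have hcurve : (fun θ : ℝ => F (R, θ)) = fun θ : ℝ => G (k * θ, polarMap (R⁻¹, -θ)) := by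
    funext θ
    simp only [hF, hG]
    rw [hk _ (by rw [norm_polarMap, abs_of_pos hR0]; exact hR), phase_polarMap hR0,
      ← Circle.exp_intCast_mul]
    congr 2
    simp [polarMap, Complex.exp_neg, mul_comm]
  have hpt : ∀ θ ∈ Icc (-Real.pi) Real.pi, |pullbackForm F η (R, θ) ![(0, 1)] -
      k * (2 * Real.pi)⁻¹| ≤ C / R := by
    intro θ hθ
    have hw : ‖polarMap (R⁻¹, -θ)‖ ≤ 1 := by
      rw [norm_polarMap, abs_of_pos (inv_pos.2 hR0)]
      exact inv_le_one_of_one_le₀ hR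
    have hmem : ((k * θ, polarMap (R⁻¹, -θ)) : ℝ × ℂ) ∈ K := by
      refine ⟨?_, mem_closedBall_zero_iff.2 hw⟩
      rw [mem_Icc, ← abs_le, abs_mul, Int.cast_abs]
      exact mul_le_mul_of_nonneg_left (abs_le.2 hθ) (abs_nonneg _)
    have h1 : pullbackForm F η (R, θ) ![(0, 1)] =
        pullbackForm (fun θ : ℝ => F (R, θ)) η θ ![1] := by
      rw [pullbackForm_comp (f := F) (h := fun θ : ℝ => (R, θ)) η
        ((hFs _).mdifferentiableAt (by simp)) (by fun_prop)]
      have : HasFDerivAt (fun θ : ℝ => (R, θ)) ((0 : ℝ →L[ℝ] ℝ).prod (ContinuousLinearMap.id ℝ ℝ)) θ :=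
        (hasFDerivAt_const R θ).prodMk (hasFDerivAt_id θ)
      rw [this.fderiv]
      rfl
    have h2 : HasFDerivAt (fun θ : ℝ => ((k : ℝ) * θ, polarMap (R⁻¹, -θ)))
        ((ContinuousLinearMap.toSpanSingleton ℝ (k : ℝ)).prod
          ((fderiv ℝ polarMap (R⁻¹, -θ)).comp
            ((0 : ℝ →L[ℝ] ℝ).prod (-ContinuousLinearMap.id ℝ ℝ)))) θ := by
      refine HasFDerivAt.prodMk ?_ ?_
      · have := (hasDerivAt_id θ).const_mul (k : ℝ)
        simp only [mul_one] at this
        exact this.hasFDerivAt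
      · exact HasFDerivAt.comp (g := polarMap) (f := fun θ : ℝ => (R⁻¹, -θ)) θ
          ((contDiff_polarMap.differentiable (by simp)) _).hasFDerivAt
          ((hasFDerivAt_const R⁻¹ θ).prodMk (hasFDerivAt_id θ).neg)
    set v : ℂ := fderiv ℝ polarMap (R⁻¹, -θ) (0, -1) with hv
    have hvn : ‖v‖ = R⁻¹ := by
      have : ((0, -1) : ℝ × ℝ) = -(0, 1) := by ext <;> simp
      rw [hv, this, map_neg, norm_neg, fderiv_polarMap_snd, norm_mul, norm_mul, Complex.norm_I,
        Complex.norm_exp_ofReal_mul_I, Complex.norm_real, Real.norm_of_nonneg (inv_pos.2 hR0).le]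
      ring
    -- The velocity is `k` times the fibre direction, which contributes `k / 2π`, plus a vector of
    -- length `1 / R` in the base coordinate, whose contribution is at most `C / R`.
    have h3 : pullbackForm F η (R, θ) ![(0, 1)] = k * (2 * Real.pi)⁻¹ +
        pullbackForm G η (k * θ, polarMap (R⁻¹, -θ)) ![(0, v)] := by
      have hsplit : ((k : ℝ), v) = (k : ℝ) • ((1, 0) : ℝ × ℂ) + (0, v) := by ext <;> simp
      rw [h1, hcurve, pullbackForm_comp (f := G) (h := fun θ : ℝ => ((k : ℝ) * θ, polarMap (R⁻¹, -θ)))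
        η ((hball _ (by simpa using hw.trans_lt one_lt_two)).self_of_nhds.mdifferentiableAt (by simp))
        h2.differentiableAt, h2.fderiv]
      have h4 : ((ContinuousLinearMap.toSpanSingleton ℝ (k : ℝ)).prod
          ((fderiv ℝ polarMap (R⁻¹, -θ)).comp
            ((0 : ℝ →L[ℝ] ℝ).prod (-ContinuousLinearMap.id ℝ ℝ)))) 1 = ((k : ℝ), v) := by
        simp [hv]
      rw [h4, hsplit, pullbackForm_one_add, pullbackForm_one_smul, hb.pullbackForm_fibre
        (hs₁.contMDiffAt (Metric.isOpen_ball.mem_nhds (by simpa using hw.trans_lt one_lt_two)))]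
    rw [h3, add_sub_cancel_left]
    have h5 := (pullbackForm G η (k * θ, polarMap (R⁻¹, -θ))).le_opNorm ![((0 : ℝ), v)]
    simp only [Finset.univ_unique, Finset.prod_singleton, Matrix.cons_val_fin_one, Prod.norm_mk,
      norm_zero, hvn] at h5
    rw [max_eq_right (inv_pos.2 hR0).le] at h5
    rw [← Real.norm_eq_abs, div_eq_mul_inv]
    exact h5.trans (mul_le_mul_of_nonneg_right (hC _ hmem) (inv_pos.2 hR0).le)
  have hpi := Real.pi_pos
  have h6 : (∫ θ in (-Real.pi)..Real.pi, pullbackForm F η (R, θ) ![(0, 1)]) - k =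
      ∫ θ in (-Real.pi)..Real.pi, (pullbackForm F η (R, θ) ![(0, 1)] - k * (2 * Real.pi)⁻¹) := by
    rw [intervalIntegral.integral_sub, intervalIntegral.integral_const]
    · rw [smul_eq_mul]
      field_simp
      ring
    · refine Continuous.intervalIntegrable ?_ _ _
      exact ((ContinuousAlternatingMap.apply ℝ (ℝ × ℝ) ℝ ![((0 : ℝ), (1 : ℝ))]).continuous.comp
        hβs.continuous).comp (by fun_prop)
    · exact intervalIntegrable_const
  rw [h6, ← Real.norm_eq_abs]
  have h7 := intervalIntegral.norm_integral_le_of_norm_le_const (a := -Real.pi) (b := Real.pi)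
    (C := C / R) (f := fun θ => pullbackForm F η (R, θ) ![(0, 1)] - k * (2 * Real.pi)⁻¹)
    fun θ hθ => by
      rw [uIoc_of_le (by linarith)] at hθ
      exact hpt θ (Ioc_subset_Icc_self hθ)
  refine h7.trans (le_of_eq ?_)
  rw [abs_of_pos (by linarith)]
  ring

/-- The Euler number of the bundle over the line is the winding number of its sections. -/
theorem degree_eq_one (hb : IsBundleWithUnitEulerClass π ω₁ ωP η) {p : P} {s s₁ : ℂ → S}
    (hs : ContMDiff 𝓘(ℝ, ℂ) (𝓡 7) ∞ s) (hπ : ∀ z, π (s z) = affineLine p z)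
    (hs₁ : ContMDiffOn 𝓘(ℝ, ℂ) (𝓡 7) ∞ s₁ (Metric.ball 0 2))
    {k : ℤ} (hk : ∀ z, 1 ≤ ‖z‖ → s z = phase z ^ k • s₁ z⁻¹) : k = 1 := by
  obtain ⟨C, hC⟩ := hb.integral_circle_sub_le hs hs₁ hk
  have h1 : Tendsto (fun R : ℝ => C / R) atTop (𝓝 0) := tendsto_const_nhds.div_atTop tendsto_id
  have h2 : Tendsto (fun R : ℝ => (∫ θ in (-Real.pi)..Real.pi,
        pullbackForm (fun q => s (polarMap q)) η (R, θ) ![(0, 1)]) - k) atTop (𝓝 0) := by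
    refine squeeze_zero_norm' ?_ h1
    filter_upwards [eventually_ge_atTop 1] with R hR
    exact hC R hR
  have h3 := h2.add_const (k : ℝ)
  simp only [sub_add_cancel, zero_add] at h3
  exact_mod_cast tendsto_nhds_unique h3 (hb.tendsto_integral_circle hs hπ)

end IsBundleWithUnitEulerClass

end

end Stokes

/-! ### The 3-sphere in `ℂ²` -/

section Sphere

noncomputable section

/-- The Euclidean space that contains the 3-sphere. -/
abbrev E4 := EuclideanSpace ℝ (Fin (3 + 1))

/-- Euclidean space of dimension four as a complex plane. -/
def complexPair : E4 ≃L[ℝ] ℂ × ℂ :=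
  LinearEquiv.toContinuousLinearEquiv
    { toFun := fun x => (⟨x 0, x 1⟩, ⟨x 2, x 3⟩)
      map_add' := fun _ _ => rfl
      map_smul' := fun c x => by ext <;> simp [Complex.ext_iff]
      invFun := fun q => !₂[q.1.re, q.1.im, q.2.re, q.2.im]
      left_inv := fun x => by ext i; fin_cases i <;> rfl
      right_inv := fun _ => rfl }

theorem norm_sq_complexPair (x : E4) :
    ‖(complexPair x).1‖ ^ 2 + ‖(complexPair x).2‖ ^ 2 = ‖x‖ ^ 2 := by
  have h1 : (complexPair x).1 = ⟨x 0, x 1⟩ := rfl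
  have h2 : (complexPair x).2 = ⟨x 2, x 3⟩ := rfl
  rw [EuclideanSpace.norm_sq_eq, h1, h2, Complex.sq_norm, Complex.sq_norm, Complex.normSq_mk,
    Complex.normSq_mk]
  simp only [Real.norm_eq_abs, sq_abs]
  rw [show (∑ i : Fin (3 + 1), x.ofLp i ^ 2) = x.ofLp 0 ^ 2 + x.ofLp 1 ^ 2 + x.ofLp 2 ^ 2 +
    x.ofLp 3 ^ 2 from Fin.sum_univ_four _]
  ring

/-- The length of the second component of a unit vector whose components have quotient `z`. -/
def hopfScale (z : ℂ) : ℝ := (√(1 + ‖z‖ ^ 2))⁻¹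

theorem hopfScale_pos (z : ℂ) : 0 < hopfScale z := inv_pos.2 (Real.sqrt_pos.2 (by positivity))

theorem hopfScale_sq (z : ℂ) : hopfScale z ^ 2 * (1 + ‖z‖ ^ 2) = 1 := by
  rw [hopfScale, inv_pow, Real.sq_sqrt (by positivity)]
  exact inv_mul_cancel₀ (by positivity)

theorem contDiff_hopfScale : ContDiff ℝ ∞ hopfScale := by
  have h1 : ContDiff ℝ ∞ (fun z : ℂ => 1 + ‖z‖ ^ 2) := contDiff_const.add (contDiff_norm_sq ℝ)
  exact (h1.sqrt fun z => by positivity).inv fun z => (Real.sqrt_pos.2 (by positivity)).ne'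

theorem hopfScale_div {a b : ℂ} (hb : b ≠ 0) (h : ‖a‖ ^ 2 + ‖b‖ ^ 2 = 1) :
    hopfScale (a / b) = ‖b‖ := by
  have hb' : 0 < ‖b‖ := norm_pos_iff.2 hb
  have h1 : 1 + ‖a / b‖ ^ 2 = (‖b‖⁻¹) ^ 2 := by
    rw [norm_div, div_pow, inv_pow]
    field_simp
    linarith
  rw [hopfScale, h1, Real.sqrt_sq (inv_pos.2 hb').le, inv_inv]

theorem hopfScale_mul_phase {a b : ℂ} (hb : b ≠ 0) (h : ‖a‖ ^ 2 + ‖b‖ ^ 2 = 1) :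
    (hopfScale (a / b) : ℂ) * phase b = b := by
  rw [hopfScale_div hb h, norm_mul_phase]

/-- The unit vector with second component of phase `u` and components of quotient `z`. -/
def hopfVector (q : ℂ × ℂ) : ℂ × ℂ :=
  (hopfScale q.2 * q.1 * q.2, hopfScale q.2 * q.1)

theorem contDiff_hopfVector : ContDiff ℝ ∞ hopfVector := by
  have h1 : ContDiff ℝ ∞ (fun q : ℂ × ℂ => (hopfScale q.2 : ℂ)) :=
    Complex.ofRealCLM.contDiff.comp (contDiff_hopfScale.comp contDiff_snd)
  exact ((h1.mul contDiff_fst).mul contDiff_snd).prodMk (h1.mul contDiff_fst)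

/-- `hopfVector` inverts `(a, b) ↦ (phase b, a / b)` on unit vectors. Its first argument ranges over
`ℂ` and not only over the circle, so that it is smooth on a vector space and can serve in local left
inverses. -/
theorem hopfVector_phase {a b : ℂ} (hb : b ≠ 0) (h : ‖a‖ ^ 2 + ‖b‖ ^ 2 = 1) :
    hopfVector (phase b, a / b) = (a, b) := by
  simp only [hopfVector, hopfScale_mul_phase hb h, mul_div_cancel₀ _ hb]

theorem norm_hopfVector (u : Circle) (z : ℂ) :
    ‖(hopfVector (u, z)).1‖ ^ 2 + ‖(hopfVector (u, z)).2‖ ^ 2 = 1 := by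
  have h := hopfScale_sq z
  simp only [hopfVector, norm_mul, Circle.norm_coe, Complex.norm_real,
    Real.norm_of_nonneg (hopfScale_pos z).le]
  linear_combination h

theorem hopfVector_snd_ne_zero (u : Circle) (z : ℂ) : (hopfVector (u, z)).2 ≠ 0 :=
  mul_ne_zero (by exact_mod_cast (hopfScale_pos z).ne') (Circle.coe_ne_zero u)

theorem phase_hopfVector (u : Circle) (z : ℂ) : phase (hopfVector (u, z)).2 = u := by
  rw [hopfVector, phase_real_mul (hopfScale_pos z), phase_coe]

theorem hopfVector_div (u : Circle) (z : ℂ) : (hopfVector (u, z)).1 / (hopfVector (u, z)).2 = z :=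
  mul_div_cancel_left₀ _ (hopfVector_snd_ne_zero u z)

end

end Sphere

/-! ### The map from `ℂ²` without the origin to the circle bundle -/

section HopfMap

noncomputable section

open RiemannSphere

variable {S : Type*} [TopologicalSpace S] [ChartedSpace E7 S]
  [MulAction Circle S]

/-- The map to a circle bundle over the projective line determined by a section `s` over the affine
line and a section `s₁` around infinity. -/
def hopfMap (s s₁ : ℂ → S) (q : ℂ × ℂ) : S :=
  open Classical in
  if q.2 = 0 then phase q.1 • s₁ (q.2 / q.1) else phase q.2 • s (q.1 / q.2)

theorem hopfMap_of_ne (s s₁ : ℂ → S) {q : ℂ × ℂ} (h : q.2 ≠ 0) :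
    hopfMap s s₁ q = phase q.2 • s (q.1 / q.2) := if_neg h

/-- Winding number one is essential here: `phase b * phase (a / b) = phase a`, so the transition
between `s` and `s₁` turns one formula into the other. -/
theorem hopfMap_of_le {s s₁ : ℂ → S} (hk : ∀ z, 1 ≤ ‖z‖ → s z = phase z • s₁ z⁻¹) {q : ℂ × ℂ}
    (h : q.1 ≠ 0) (hle : ‖q.2‖ ≤ ‖q.1‖) : hopfMap s s₁ q = phase q.1 • s₁ (q.2 / q.1) := by
  by_cases h2 : q.2 = 0
  · exact if_pos h2
  · have h3 : 0 < ‖q.2‖ := norm_pos_iff.2 h2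
    rw [hopfMap_of_ne s s₁ h2, hk _ (by rw [norm_div]; exact (one_le_div h3).2 hle), smul_smul,
      ← phase_mul h2 (div_ne_zero h h2), mul_div_cancel₀ _ h2, inv_div]

variable {E : Type*} [NormedAddCommGroup E] [NormedSpace ℂ E]
  {P : Type*} [TopologicalSpace P] [ChartedSpace E P] [IsManifold 𝓘(ℂ, E) ω P]
  {π : S → CP1 × P}

/-- Around a point with `b = 0` one has `|b| < |a|` on a whole neighbourhood, where the formula with
`s₁` holds. -/
theorem contMDiffAt_hopfMap (hb : IsPrincipalCircleBundle 𝓘(ℝ, ℂ × E) π) {s s₁ : ℂ → S}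
    (hs : ContMDiff 𝓘(ℝ, ℂ) (𝓡 7) ∞ s) (hs₁ : ContMDiffOn 𝓘(ℝ, ℂ) (𝓡 7) ∞ s₁ (Metric.ball 0 2))
    (hk : ∀ z, 1 ≤ ‖z‖ → s z = phase z • s₁ z⁻¹) {q : ℂ × ℂ} (hq : q ≠ 0) :
    ContMDiffAt 𝓘(ℝ, ℂ × ℂ) (𝓡 7) ∞ (hopfMap s s₁) q := by
  by_cases h2 : q.2 = 0
  · have h1 : q.1 ≠ 0 := fun h => hq (Prod.ext h h2)
    have h3 : ContDiffAt ℝ ∞ (fun y : ℂ × ℂ => y.2 / y.1) q := by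
      simp only [div_eq_mul_inv]
      exact contDiffAt_snd.mul (contDiffAt_fst.inv h1)
    have h4 : ContMDiffAt 𝓘(ℝ, ℂ) (𝓡 7) ∞ s₁ (q.2 / q.1) :=
      hs₁.contMDiffAt (Metric.isOpen_ball.mem_nhds (by simp [h2]))
    refine (hb.contMDiffAt_smul (ContMDiffAt.comp (g := phase) (f := Prod.fst) q
      (contMDiffAt_phase h1) contDiffAt_fst.contMDiffAt)
      (ContMDiffAt.comp (g := s₁) (f := fun y : ℂ × ℂ => y.2 / y.1) q h4
        h3.contMDiffAt)).congr_of_eventuallyEq ?_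
    filter_upwards [(isOpen_ne_fun continuous_fst continuous_const).mem_nhds h1,
      (isOpen_lt continuous_snd.norm continuous_fst.norm).mem_nhds
        (show ‖q.2‖ < ‖q.1‖ by rw [h2, norm_zero]; exact norm_pos_iff.2 h1)] with y hy hy'
    exact hopfMap_of_le hk hy hy'.le
  · have h3 : ContDiffAt ℝ ∞ (fun y : ℂ × ℂ => y.1 / y.2) q := by
      simp only [div_eq_mul_inv]
      exact contDiffAt_fst.mul (contDiffAt_snd.inv h2)
    refine (hb.contMDiffAt_smul (ContMDiffAt.comp (g := phase) (f := Prod.snd) q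
      (contMDiffAt_phase h2) contDiffAt_snd.contMDiffAt)
      (ContMDiffAt.comp (g := s) (f := fun y : ℂ × ℂ => y.1 / y.2) q (hs _)
        h3.contMDiffAt)).congr_of_eventuallyEq ?_
    filter_upwards [(isOpen_ne_fun continuous_snd continuous_const).mem_nhds h2] with y hy
    exact hopfMap_of_ne s s₁ hy

/-- The phase and the base coordinate of the point `u • t z` are smooth functions of it. -/
theorem IsPrincipalCircleBundle.exists_local_inverse {E X : Type*} [NormedAddCommGroup E]
    [NormedSpace ℝ E] [TopologicalSpace X] [ChartedSpace E X] {π : S → X}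
    (hb : IsPrincipalCircleBundle 𝓘(ℝ, E) π) {β : ℂ → X} {t : ℂ → S} {U : Set ℂ} (hU : IsOpen U)
    (ht : IsLiftOn π β t U) {ψ : X → ℂ} {z₀ : ℂ} (hz₀ : z₀ ∈ U)
    (hψ : ContMDiffAt 𝓘(ℝ, E) 𝓘(ℝ, ℂ) ∞ ψ (β z₀)) (hψβ : ∀ z, ψ (β z) = z) (u₀ : Circle) :
    ∃ Q : S → ℂ × ℂ, MDifferentiableAt (𝓡 7) 𝓘(ℝ, ℂ × ℂ) Q (u₀ • t z₀) ∧
      ∀ᶠ z in 𝓝 z₀, ∀ u : Circle, Q (u • t z) = ((u : ℂ), z) := by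
  -- With `τ` equivariant, a point `q = u • t z` has `z = ψ (π q)` and `u = τ q / τ (t z)`; both are
  -- smooth in `q`.
  obtain ⟨W, hW, hzW, τ, hτ, hτ'⟩ := hb.exists_equivariant (β z₀)
  have hWS : IsOpen (π ⁻¹' W) := hW.preimage hb.smooth.continuous
  have hp0 : π (u₀ • t z₀) = β z₀ := by rw [hb.smul_proj, ht.proj _ hz₀]
  have htz := ht.contMDiffAt hU hz₀
  have h1 : ContMDiffAt (𝓡 7) (𝓡 1) ∞ τ (u₀ • t z₀) :=
    hτ.contMDiffAt (hWS.mem_nhds (by rwa [mem_preimage, hp0]))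
  have h2 : ContMDiffAt (𝓡 7) 𝓘(ℝ, ℂ) ∞ (fun q => ψ (π q)) (u₀ • t z₀) :=
    ContMDiffAt.comp (g := ψ) (f := π) _ (by rwa [hp0]) (hb.smooth _)
  have h3 : ContMDiffAt (𝓡 7) (𝓡 1) ∞ (fun q => τ (t (ψ (π q)))) (u₀ • t z₀) := by
    have hψ0 : ψ (π (u₀ • t z₀)) = z₀ := by rw [hp0, hψβ]
    refine ContMDiffAt.comp (g := fun z => τ (t z)) (f := fun q => ψ (π q)) _ ?_ h2
    rw [hψ0]
    exact (hτ.contMDiffAt (hWS.mem_nhds (by rwa [mem_preimage, ht.proj _ hz₀]))).comp z₀ htz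
  have h4 : ContMDiffAt (𝓡 7) 𝓘(ℝ, ℂ) ∞
      (fun q => ((τ q * (τ (t (ψ (π q))))⁻¹ : Circle) : ℂ)) (u₀ • t z₀) := by
    have : Fact (Module.finrank ℝ ℂ = 1 + 1) := ⟨Complex.finrank_real_complex⟩
    exact (contMDiff_coe_sphere (m := ∞) (n := 1) (E := ℂ)).contMDiffAt.comp _ (h1.mul h3.inv)
  refine ⟨fun q => (((τ q * (τ (t (ψ (π q))))⁻¹ : Circle) : ℂ), ψ (π q)),
    (h4.mdifferentiableAt (by simp)).prodMk_space (h2.mdifferentiableAt (by simp)), ?_⟩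
  have h5 : ∀ᶠ z in 𝓝 z₀, t z ∈ π ⁻¹' W := htz.continuousAt.preimage_mem_nhds
    (hWS.mem_nhds (by rwa [mem_preimage, ht.proj _ hz₀]))
  filter_upwards [hU.mem_nhds hz₀, h5] with z hz hz' u
  rw [hb.smul_proj, ht.proj z hz, hψβ, hτ' u _ hz', mul_inv_cancel_right]

end

end HopfMap

/-! ### The embedding of the 3-sphere -/

section HopfEmbedding

noncomputable section

open RiemannSphere

/-- The unit sphere of dimension three. -/
abbrev Sphere3 := Metric.sphere (0 : E4) 1

theorem contMDiff_coe_sphere3 : ContMDiff (𝓡 3) 𝓘(ℝ, E4) ∞ (fun x : Sphere3 => (x : E4)) := by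
  have : Fact (Module.finrank ℝ E4 = 3 + 1) := ⟨by simp⟩
  exact contMDiff_coe_sphere (m := ∞) (n := 3) (E := E4)

theorem injective_tderiv_coe_sphere3 (x : Sphere3) :
    Function.Injective (tderiv (𝓡 3) 𝓘(ℝ, E4) (fun x : Sphere3 => (x : E4)) x) := by
  have : Fact (Module.finrank ℝ E4 = 3 + 1) := ⟨by simp⟩
  exact injective_mvfderiv_subtypeVal_sphere x

theorem norm_sq_sphere3 (x : Sphere3) :
    ‖(complexPair x).1‖ ^ 2 + ‖(complexPair x).2‖ ^ 2 = 1 := by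
  rw [norm_sq_complexPair, norm_eq_of_mem_sphere, one_pow]

/-- The point of the 3-sphere with given complex coordinates. -/
def spherePoint (q : ℂ × ℂ) (hq : ‖q.1‖ ^ 2 + ‖q.2‖ ^ 2 = 1) : Sphere3 :=
  ⟨complexPair.symm q, by
    have h := norm_sq_complexPair (complexPair.symm q)
    rw [ContinuousLinearEquiv.apply_symm_apply, hq] at h
    rw [mem_sphere_zero_iff_norm]
    exact (sq_eq_sq₀ (norm_nonneg _) zero_le_one).1 (by rw [← h, one_pow])⟩

theorem complexPair_spherePoint (q : ℂ × ℂ) (hq : ‖q.1‖ ^ 2 + ‖q.2‖ ^ 2 = 1) :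
    complexPair (spherePoint q hq : E4) = q := complexPair.apply_symm_apply q

theorem sphere3_ext {x y : Sphere3} (h : complexPair x = complexPair y) : x = y :=
  Subtype.ext (complexPair.injective h)

variable {S : Type*} [TopologicalSpace S] [T2Space S] [ChartedSpace E7 S] [IsManifold (𝓡 7) ∞ S]
  [MulAction Circle S]
  {E : Type*} [NormedAddCommGroup E] [NormedSpace ℂ E]
  {P : Type*} [TopologicalSpace P] [ChartedSpace E P] [IsManifold 𝓘(ℂ, E) ω P]
  {π : S → CP1 × P}

variable (E) in
/-- A pair of sections of a circle bundle over `ℂP¹ × {p}`, on the affine line and around infinity,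
that differ by the phase. -/
structure IsHopfPair (π : S → CP1 × P) (p : P) (s s₁ : ℂ → S) : Prop where
  bundle : IsPrincipalCircleBundle 𝓘(ℝ, ℂ × E) π
  lift : IsLiftOn π (affineLine p) s univ
  lift_infty : IsLiftOn π (affineLineInfty p) s₁ (Metric.ball 0 2)
  transition : ∀ z, 1 ≤ ‖z‖ → s z = phase z • s₁ z⁻¹

namespace IsHopfPair

variable {p : P} {s s₁ : ℂ → S}

/-- The map from the 3-sphere determined by the sections. -/
def _root_.SasakiGeometry.hopfSphere (s s₁ : ℂ → S) (x : Sphere3) : S := hopfMap s s₁ (complexPair x)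

theorem complexPair_ne_zero (x : Sphere3) : complexPair x ≠ 0 := by
  intro h
  have := norm_sq_sphere3 x
  simp [h] at this

theorem fst_ne_zero {x : Sphere3} (h : (complexPair x).2 = 0) : (complexPair x).1 ≠ 0 :=
  fun h1 => complexPair_ne_zero x (Prod.ext h1 h)

theorem contMDiff_hopfSphere (h : IsHopfPair E π p s s₁) :
    ContMDiff (𝓡 3) (𝓡 7) ∞ (hopfSphere s s₁) := by
  intro x
  refine ContMDiffAt.comp (g := hopfMap s s₁) (f := fun x : Sphere3 => complexPair x) x
    (contMDiffAt_hopfMap h.bundle (contMDiffOn_univ.1 h.lift.smooth) h.lift_infty.smooth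
      h.transition (complexPair_ne_zero x)) ?_
  exact complexPair.contDiff.contMDiff.contMDiffAt.comp x (contMDiff_coe_sphere3 x)

theorem hopfSphere_of_ne {x : Sphere3} (hx : (complexPair x).2 ≠ 0) :
    hopfSphere s s₁ x = phase (complexPair x).2 • s ((complexPair x).1 / (complexPair x).2) :=
  hopfMap_of_ne s s₁ hx

theorem hopfSphere_of_le (h : IsHopfPair E π p s s₁) {x : Sphere3} (hx : (complexPair x).1 ≠ 0)
    (hle : ‖(complexPair x).2‖ ≤ ‖(complexPair x).1‖) :
    hopfSphere s s₁ x = phase (complexPair x).1 • s₁ ((complexPair x).2 / (complexPair x).1) :=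
  hopfMap_of_le h.transition hx hle

theorem hopfSphere_of_eq_zero (h : IsHopfPair E π p s s₁) {x : Sphere3}
    (hx : (complexPair x).2 = 0) : hopfSphere s s₁ x = phase (complexPair x).1 • s₁ 0 := by
  rw [h.hopfSphere_of_le (fst_ne_zero hx) (by simp [hx]), hx, zero_div]

theorem proj_hopfSphere_of_ne (h : IsHopfPair E π p s s₁) {x : Sphere3}
    (hx : (complexPair x).2 ≠ 0) : π (hopfSphere s s₁ x) =
      affineLine p ((complexPair x).1 / (complexPair x).2) := by
  rw [hopfSphere_of_ne hx, h.bundle.smul_proj, h.lift.proj _ (mem_univ _)]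

theorem proj_hopfSphere_of_eq_zero (h : IsHopfPair E π p s s₁) {x : Sphere3}
    (hx : (complexPair x).2 = 0) : π (hopfSphere s s₁ x) = affineLineInfty p 0 := by
  rw [h.hopfSphere_of_eq_zero hx, h.bundle.smul_proj, h.lift_infty.proj _ (by simp)]

theorem affineLine_ne_infty (z : ℂ) : affineLine p z ≠ affineLineInfty p 0 := by
  intro h
  have h1 : (z : CP1) = inv ((0 : ℂ) : CP1) := congrArg Prod.fst h
  rw [inv_coe, if_pos rfl] at h1
  exact OnePoint.coe_ne_infty z h1

theorem hopfVector_of_ne {x : Sphere3} (hx : (complexPair x).2 ≠ 0) :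
    hopfVector (phase (complexPair x).2, (complexPair x).1 / (complexPair x).2) =
      complexPair x := hopfVector_phase hx (norm_sq_sphere3 x)

theorem hopfVector_swap_of_ne {x : Sphere3} (hx : (complexPair x).1 ≠ 0) :
    (hopfVector (phase (complexPair x).1, (complexPair x).2 / (complexPair x).1)).swap =
      complexPair x := by
  rw [hopfVector_phase hx (by rw [add_comm]; exact norm_sq_sphere3 x)]
  rfl

/-- The projection to the base determines `a / b`, with `b = 0` lying over infinity. Freeness of the
action then determines the phase, and a unit vector is recovered from the two. -/
theorem injective_hopfSphere (h : IsHopfPair E π p s s₁) :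
    Function.Injective (hopfSphere s s₁) := by
  intro x y hxy
  have hp := congrArg π hxy
  apply sphere3_ext
  by_cases hx : (complexPair x).2 = 0 <;> by_cases hy : (complexPair y).2 = 0
  · have h1 : phase (complexPair x).1 = phase (complexPair y).1 := by
      rw [h.hopfSphere_of_eq_zero hx, h.hopfSphere_of_eq_zero hy] at hxy
      exact h.bundle.smul_right_cancel hxy
    rw [← hopfVector_swap_of_ne (fst_ne_zero hx), ← hopfVector_swap_of_ne (fst_ne_zero hy), h1, hx,
      hy, zero_div, zero_div]
  · rw [h.proj_hopfSphere_of_eq_zero hx, h.proj_hopfSphere_of_ne hy] at hp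
    exact absurd hp.symm (affineLine_ne_infty _)
  · rw [h.proj_hopfSphere_of_ne hx, h.proj_hopfSphere_of_eq_zero hy] at hp
    exact absurd hp (affineLine_ne_infty _)
  · rw [h.proj_hopfSphere_of_ne hx, h.proj_hopfSphere_of_ne hy] at hp
    have h2 : (complexPair x).1 / (complexPair x).2 = (complexPair y).1 / (complexPair y).2 :=
      OnePoint.coe_injective (congrArg Prod.fst hp)
    have h1 : phase (complexPair x).2 = phase (complexPair y).2 := by
      rw [hopfSphere_of_ne hx, hopfSphere_of_ne hy, h2] at hxy
      exact h.bundle.smul_right_cancel hxy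
    rw [← hopfVector_of_ne hx, ← hopfVector_of_ne hy, h1, h2]

/-- A point over `z` is `u • s z` and comes from `hopfVector (u, z)`; a point over infinity is `u •
s₁ 0` and comes from `(u, 0)`. -/
theorem range_hopfSphere (h : IsHopfPair E π p s s₁) :
    range (hopfSphere s s₁) = π ⁻¹' {x : CP1 × P | x.2 = p} := by
  apply Subset.antisymm
  · rintro _ ⟨x, rfl⟩
    change (π (hopfSphere s s₁ x)).2 = p
    by_cases hx : (complexPair x).2 = 0
    · rw [h.proj_hopfSphere_of_eq_zero hx]; rfl
    · rw [h.proj_hopfSphere_of_ne hx]; rfl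
  · intro q hq
    have hq2 : (π q).2 = p := hq
    rcases hq1 : (π q).1 with _ | z
    · have h1 : π (s₁ 0) = π q := by
        rw [h.lift_infty.proj _ (by simp)]
        refine Prod.ext ?_ hq2.symm
        rw [hq1]
        change inv ((0 : ℂ) : CP1) = _
        rw [inv_coe, if_pos rfl]
        rfl
      obtain ⟨u, hu⟩ := (h.bundle.fibre _ _).1 h1
      refine ⟨spherePoint ((u : ℂ), 0) (by simp [Circle.norm_coe]), ?_⟩
      rw [h.hopfSphere_of_eq_zero (by rw [complexPair_spherePoint]), complexPair_spherePoint,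
        phase_coe, hu]
    · have h1 : π (s z) = π q := by
        rw [h.lift.proj _ (mem_univ _)]
        exact Prod.ext hq1.symm hq2.symm
      obtain ⟨u, hu⟩ := (h.bundle.fibre _ _).1 h1
      refine ⟨spherePoint (hopfVector (u, z)) (norm_hopfVector u z), ?_⟩
      rw [hopfSphere_of_ne (by rw [complexPair_spherePoint]; exact hopfVector_snd_ne_zero u z),
        complexPair_spherePoint, phase_hopfVector, hopfVector_div, hu]

/-- A map from the sphere with a smooth local left inverse has injective derivative. -/
theorem _root_.SasakiGeometry.injective_tderiv_of_leftInverse {f : Sphere3 → S} {x : Sphere3}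
    (hf : MDifferentiableAt (𝓡 3) (𝓡 7) f x) {Q : S → ℂ × ℂ}
    (hQ : MDifferentiableAt (𝓡 7) 𝓘(ℝ, ℂ × ℂ) Q (f x)) {R : ℂ × ℂ → ℂ × ℂ} (hR : ContDiff ℝ ∞ R)
    (h : ∀ᶠ y in 𝓝 x, R (Q (f y)) = complexPair y) :
    Function.Injective (tderiv (𝓡 3) (𝓡 7) f x) := by
  let L : ℂ × ℂ → E4 := fun q => complexPair.symm (R q)
  have hL : MDifferentiableAt 𝓘(ℝ, ℂ × ℂ) 𝓘(ℝ, E4) L (Q (f x)) :=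
    ((complexPair.symm.contDiff.comp hR).differentiable (by simp) _).mdifferentiableAt
  have hLQ : MDifferentiableAt (𝓡 7) 𝓘(ℝ, E4) (fun q => L (Q q)) (f x) := hL.comp (f x) hQ
  -- The composition of `f` with the local left inverse is the inclusion of the sphere in Euclidean
  -- space, whose derivative is injective.
  have h1 : (fun y : Sphere3 => L (Q (f y))) =ᶠ[𝓝 x] fun y => (y : E4) := by
    filter_upwards [h] with y hy
    simp only [L, hy, ContinuousLinearEquiv.symm_apply_apply]
  intro u v huv
  apply injective_tderiv_coe_sphere3 x
  rw [← tderiv_congr h1, tderiv_comp_apply (g := fun q => L (Q q)) x hLQ hf,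
    tderiv_comp_apply (g := fun q => L (Q q)) x hLQ hf, huv]

theorem injective_tderiv_hopfSphere (h : IsHopfPair E π p s s₁) (x : Sphere3) :
    Function.Injective (tderiv (𝓡 3) (𝓡 7) (hopfSphere s s₁) x) := by
  have hf := (h.contMDiff_hopfSphere x).mdifferentiableAt (by simp)
  have hc : Continuous fun y : Sphere3 => complexPair y :=
    complexPair.continuous.comp continuous_subtype_val
  have hc1 : Continuous fun y : Sphere3 => (complexPair y).1 := continuous_fst.comp hc
  have hc2 : Continuous fun y : Sphere3 => (complexPair y).2 := continuous_snd.comp hc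
  by_cases hx : (complexPair x).2 = 0
  · have hx1 := fst_ne_zero hx
    have hle : ‖(complexPair x).2‖ < ‖(complexPair x).1‖ := by
      rw [hx, norm_zero]; exact norm_pos_iff.2 hx1
    obtain ⟨Q, hQ, hQ'⟩ := h.bundle.exists_local_inverse Metric.isOpen_ball h.lift_infty
      (z₀ := (complexPair x).2 / (complexPair x).1) (by simp [hx])
      (contMDiffAt_affineCoord_inv_fst p _) (fun z => by simp [affineLineInfty, inv_inv])
      (phase (complexPair x).1)
    rw [← h.hopfSphere_of_le hx1 hle.le] at hQ
    refine injective_tderiv_of_leftInverse hf hQ (R := fun q => (hopfVector q).swap)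
      (contDiff_snd.prodMk contDiff_fst |>.comp contDiff_hopfVector) ?_
    filter_upwards [(isOpen_ne_fun hc1 continuous_const).mem_nhds hx1,
      (isOpen_lt hc2.norm hc1.norm).mem_nhds hle,
      (hc2.continuousAt.div hc1.continuousAt hx1).eventually hQ'] with y hy hy' hy2
    simp only [Pi.div_apply] at hy2
    rw [h.hopfSphere_of_le hy hy'.le, hy2, hopfVector_swap_of_ne hy]
  · obtain ⟨Q, hQ, hQ'⟩ := h.bundle.exists_local_inverse isOpen_univ h.lift
      (z₀ := (complexPair x).1 / (complexPair x).2) (mem_univ _)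
      (contMDiffAt_affineCoord_fst p _) (fun z => by simp [affineLine])
      (phase (complexPair x).2)
    rw [← hopfSphere_of_ne (s₁ := s₁) hx] at hQ
    refine injective_tderiv_of_leftInverse hf hQ contDiff_hopfVector ?_
    filter_upwards [(isOpen_ne_fun hc2 continuous_const).mem_nhds hx,
      (hc1.continuousAt.div hc2.continuousAt hx).eventually hQ'] with y hy hy2
    simp only [Pi.div_apply] at hy2
    rw [hopfSphere_of_ne hy, hy2, hopfVector_of_ne hy]

/-- An injective continuous map from a compact space to a Hausdorff space is a closed embedding, and
injectivity of the derivative makes it an immersion; the complement has dimension `7 - 3 = 4`. -/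
theorem isSmoothEmbedding_hopfSphere (h : IsHopfPair E π p s s₁) :
    Manifold.IsSmoothEmbedding (𝓡 3) (𝓡 7) ∞ (hopfSphere s s₁) := by
  refine ⟨⟨EuclideanSpace ℝ (Fin 4), inferInstance, inferInstance, fun x => ?_⟩, ?_⟩
  · exact isImmersionAtOfComplement_of_injective (by simp) h.contMDiff_hopfSphere x
      (h.injective_tderiv_hopfSphere x)
  · exact (h.contMDiff_hopfSphere.continuous.isClosedEmbedding h.injective_hopfSphere).isEmbedding

end IsHopfPair

/-- The bundle over `ℂP¹ × {p}` has sections that differ by the phase at infinity. -/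
theorem IsBundleWithUnitEulerClass.exists_hopfPair {ω₁ : DiffForm 𝓘(ℝ, ℂ) CP1 2 ℝ}
    {ωP : DiffForm 𝓘(ℝ, E) P 2 ℝ} {η : DiffForm (𝓡 7) S 1 ℝ}
    (hb : IsBundleWithUnitEulerClass π ω₁ ωP η) (p : P) :
    ∃ s s₁ : ℂ → S, IsHopfPair E π p s s₁ := by
  obtain ⟨s, s₁, k, hs, hs₁, hk⟩ := hb.bundle.exists_section_plane (contMDiff_affineLine p)
    (contMDiff_affineLineInfty p) fun z hz => affineLine_eq p hz
  obtain rfl : k = 1 := hb.degree_eq_one (contMDiffOn_univ.1 hs.smooth)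
    (fun z => hs.proj z (mem_univ _)) hs₁.smooth hk
  exact ⟨s, s₁, hb.bundle, hs, hs₁, fun z hz => by rw [hk z hz, zpow_one]⟩

end

end HopfEmbedding

end SasakiGeometry

open SasakiGeometry
/-- First part: preimages of complex curves under the fibration of a regular Sasaki-Einstein
7-manifold. Second part: the case `X = ℂP¹ × P`, with `Σ = ℂP¹ × {p}`. -/
theorem mainTheorem6 :
    (∀ (E : Type*) [NormedAddCommGroup E] [NormedSpace ℂ E]
        (X : Type*) [TopologicalSpace X] [T2Space X] [SecondCountableTopology X]
        [ChartedSpace E X] [IsManifold 𝓘(ℂ, E) ω X]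
        (S : Type*) [TopologicalSpace S] [T2Space S] [SecondCountableTopology S]
        [ChartedSpace (EuclideanSpace ℝ (Fin 7)) S] [IsManifold (𝓡 7) ∞ S] [MulAction Circle S]
        (s : SasakiEinstein S) (h : KahlerMetric E X) (π : S → X) (Y : Set X),
        Module.finrank ℂ E = 3 →
        IsRegularOver s h π →
        IsSubmanifold 𝓘(ℂ, E) ω 1 Y →
          s.IsInvariant (π ⁻¹' Y) ∧
          IsMinimalSubmanifold s.g 3 (π ⁻¹' Y) ∧
          ∃ ν : DiffForm (𝓡 7) S 3 ℝ, ∀ t : ℝ, IsAssociative s.g (s.g2Form t) ν (π ⁻¹' Y)) ∧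
    (∀ (E : Type*) [NormedAddCommGroup E] [NormedSpace ℂ E]
        (P : Type*) [TopologicalSpace P] [T2Space P] [SecondCountableTopology P]
        [ChartedSpace E P] [IsManifold 𝓘(ℂ, E) ω P]
        (S : Type*) [TopologicalSpace S] [T2Space S] [SecondCountableTopology S]
        [ChartedSpace (EuclideanSpace ℝ (Fin 7)) S] [IsManifold (𝓡 7) ∞ S] [MulAction Circle S]
        (π : S → CP1 × P) (ω₁ : DiffForm 𝓘(ℝ, ℂ) CP1 2 ℝ) (ωP : DiffForm 𝓘(ℝ, E) P 2 ℝ)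
        (η : DiffForm (𝓡 7) S 1 ℝ) (p : P),
        Module.finrank ℂ E = 2 →
        IsBundleWithUnitEulerClass π ω₁ ωP η →
          IsSubmanifold 𝓘(ℂ, ℂ × E) ω 1 {x : CP1 × P | x.2 = p} ∧
          ∃ f : Metric.sphere (0 : EuclideanSpace ℝ (Fin (3 + 1))) 1 → S,
            Manifold.IsSmoothEmbedding (𝓡 3) (𝓡 7) ∞ f ∧
            Set.range f = π ⁻¹' {x : CP1 × P | x.2 = p}) := by
  refine ⟨?_, ?_⟩
  · intro E _ _ X _ _ _ _ _ S _ _ _ _ _ _ s h π Y hdim hr hY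
    -- `finrank` is zero in infinite dimension, so the value `3` forces finite dimension.
    have : FiniteDimensional ℂ E := Module.finite_of_finrank_pos (by omega)
    exact ⟨hr.isInvariant_preimage hdim hY, hr.isMinimalSubmanifold_preimage hdim hY,
      s.OmegaEta, fun t => hr.isAssociative_preimage hdim hY t⟩
  · intro E _ _ P _ _ _ _ _ S _ _ _ _ _ _ π ω₁ ωP η p _ hb
    obtain ⟨s, s₁, h⟩ := hb.exists_hopfPair p
    exact ⟨isSubmanifold_line p, hopfSphere s s₁, h.isSmoothEmbedding_hopfSphere,
      h.range_hopfSphere⟩
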